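/- **Setting.** Let $3\le k\le\infty$ or $k=\omega$, let $\alpha^c$ be a real function of class $C^k$ on $\mathbb S^3=\{(p,w)\in\mathbb R^3\times\mathbb R:\ |p|^2+w^2=1\}$, let $\mathbb P(q)=(q,1)/\sqrt{|q|^2+1}$, $\alpha=\alpha^c\circ\mathbb P$, and let $A(\alpha)=\{q\in\mathbb R^3:\alpha(q)=0\}$. The end locus $E(\alpha)\subset\mathbb S^2$ is the set of limits of $q_n/|q_n|$ for sequences $q_n\to\infty$ in $A(\alpha)$. Let $p\in E(\alpha)$ be a regular end point, i.e. $\nabla\alpha^c_0(p)\neq0$ where $\alpha_0^c=\alpha^c(\cdot,0)$ on $\mathbb S^2$. Put $\nu=\nabla\alpha_0^c(p)/|\nabla\alpha_0^c(p)|$, $\tau=p\wedge\nu$. Let $h$ be a $C^k$ function near $(0,0)$ such that, near $(p,0)$, $\{\alpha^c=0\}$ is the radial projection of the graph $v=h(u,w)$ in the tangent space of $\mathbb S^3$ at $(p,0)$, with orthonormal coordinates $(u,v,w)$ along $\tau,\nu,(0,0,0,1)$. Thus $$\overline\alpha(u,w)=\frac{u}{w}\,\tau+\frac{h(u,w)}{w}\,\nu+\frac1w\,p,\qquad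 w>0,$$ parametrizes $A(\alpha)$ near $p$. Write $a=h_{uu}(0,0)$, $b=h_{uw}(0,0)$, $a_{30}=h_{uuu}(0,0)$, $\beta=a_{30}b$. Let $E,F,G$ and $e,f,g$ be the coefficients of the fundamental forms of $\overline\alpha$. The equation of the principal lines, $(Fg-Gf)dw^2+(Eg-Ge)\,du\,dw+(Ef-Fe)du^2=0$, multiplied by $w^8\sqrt{EG-F^2}$, becomes $L\,dw^2+M\,du\,dw+N\,du^2=0$ with $$\begin{aligned}L&=w\,\big(h_u(wh_w-h)-u\big)h_{ww}-\big(1+u^2+(wh_w-h)^2\big)h_{uw},\\ M&=w^2(1+h_u^2)h_{ww}-\big(1+u^2+(wh_w-h)^2\big)h_{uu},\\ N&=w\Big[w(1+h_u^2)h_{uw}-\big(h_u(wh_w-h)-u\big)h_{uu}\Big],\end{aligned}$$ which makes sense in a full neighborhood of $(0,0)$ in the $(u,w)$-plane. On a set $S$ of this plane the *extended principal net* is given by two $C^{k-2}$ vector fields on $S$, linearly independent at each point of $S$, which span exactly the solution directions of this equation, and which for $w>0$ are mapped by $D\overline\alpha$ to the minimal and the maximal principal direction of $A(\alpha)$ respectively.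 **Proposition.** * The end locus near $p$ is the regular $C^k$ curve $v=h(u,w)$, $w=0$: for some $\varepsilon>0$ and some open $U\ni p$, $E(\alpha)\cap U$ is the image of $(-\varepsilon,\varepsilon)$ under the injective $C^k$ map $u\mapsto \dfrac{p+u\tau+h(u,0)\nu}{|p+u\tau+h(u,0)\nu|}$, whose derivative does not vanish. The point $p$ is biregular (the geodesic curvature of $E(\alpha)$ at $p$ is nonzero) if and only if $a\ne0$, and it is an inflexion end point (that curvature is zero) if and only if $a=0$. * a) If $p$ is biregular, the extended principal net exists in a full neighborhood of $(0,0)$, the point $(0,0)$ included (so the two extended foliations are regular and transversal), and there is a homeomorphism of a neighborhood of $(0,0)$ onto a neighborhood of $(0,0)$ in the $(x,y)$-plane that fixes $(0,0)$, maps the leaves of the minimal foliation to horizontal and those of the maximal one to vertical lines, and maps the finite region $w>0$ to the half plane $y>0$, or to the half plane $x>0$. (In particular the end curve $w=0$ is a leaf of one foliation and is transversal to the other.) * b) Let $p$ be an inflexion end point with $\beta\neq0$. Put $\mathcal F(u,w,q)=Lq^2+Mq+N$, with $q=dw/du$. The Lie–Cartan field $X=(\mathcal F_q,\ q\mathcal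 F_q,\ -(\mathcal F_u+q\mathcal F_w))$ has a hyperbolic saddle at $0\in\mathcal F^{-1}(0)$: $X(0)=0$, and $DX(0)$ exists and has eigenvalues $-a_{30},\,a_{30},\,0$, the eigenvectors for $\pm a_{30}$ being tangent to $\mathcal F^{-1}(0)$. At $(0,0)$ the two solution directions coincide ($dw=0$). In a punctured neighborhood of $(0,0)$ the extended principal net exists, and there is a homeomorphism of a neighborhood of $(0,0)$ onto a neighborhood of $(0,0)$ in the $(x,y)$-plane that fixes $(0,0)$, maps, outside $(0,0)$, the leaves of the minimal foliation to leaves of the net of horizontal lines and those of the maximal foliation to leaves of the net of vertical lines, and maps the finite region $w>0$ * to the three-quadrant region $\{x>0\text{ or }y>0\}$ if $\beta<0$ (*hyperbolic inflexion pattern*: each foliation has exactly one separatrix issuing from the end point into the finite region); * to the quadrant $\{x>0\text{ and }y>0\}$ if $\beta>0$ (*elliptic inflexion pattern*: no such separatrix). -/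

import Mathlib

open scoped Manifold ContDiff Topology

noncomputable section

namespace EndPoint

/-! ### The sphere, the central projection and the surface -/

abbrev E3 := EuclideanSpace ℝ (Fin 3)

abbrev E4 := EuclideanSpace ℝ (Fin 4)

/-- The sphere `|p|² + w² = 1` of `ℝ⁴`, with coordinates `(p, w) = (x, y, z, w)`. -/
abbrev S3 := Metric.sphere (0 : E4) 1

/-- The point `(p, w)` of `ℝ⁴`. -/
def pt (x : E3) (w : ℝ) : E4 := !₂[x 0, x 1, x 2, w]

/-- Radial projection of `ℝ⁴ ∖ 0` to the sphere (the value at `0` is irrelevant). -/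
def radial (X : E4) : S3 :=
  if hX : X = 0 then ⟨EuclideanSpace.single 3 1, by simp⟩
  else ⟨‖X‖⁻¹ • X, by
    have h : ‖X‖ ≠ 0 := norm_ne_zero_iff.mpr hX
    simp [norm_smul, h]⟩

/-- The central projection of `ℝ³` (the tangent space at the north pole) onto the open northern
hemisphere, `q ↦ (q, 1) / (|q|² + 1)^{1/2}`. -/
def centralProj (q : E3) : S3 := radial (pt q 1)

/-- The function `α = αᶜ ∘ ℙ` on `ℝ³`. -/
def affineFn (αc : S3 → ℝ) (q : E3) : ℝ := αc (centralProj q)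

/-- The surface `A(α)`. -/
def surface (αc : S3 → ℝ) : Set E3 := {q | affineFn αc q = 0}

/-- The restriction of `αᶜ` to the equatorial sphere, extended to `ℝ³ ∖ 0` as a function that is
constant on rays. Its gradient at a point of the unit sphere is the spherical gradient. -/
def equatorFn (αc : S3 → ℝ) (x : E3) : ℝ := αc (radial (pt x 0))

/-- The end locus: limits of `qₙ / |qₙ|` for `qₙ` tending to infinity in the surface. -/
def endLocus (αc : S3 → ℝ) : Set E3 :=
  {p | ∃ s : ℕ → E3, (∀ n, s n ∈ surface αc) ∧
    Filter.Tendsto (fun n => ‖s n‖) Filter.atTop Filter.atTop ∧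
    Filter.Tendsto (fun n => ‖s n‖⁻¹ • s n) Filter.atTop (𝓝 p)}

/-- A regular end point. -/
def IsRegularEndPoint (αc : S3 → ℝ) (p : E3) : Prop :=
  p ∈ endLocus αc ∧ gradient (equatorFn αc) p ≠ 0

/-- The vector product of `ℝ³`. -/
def cross (x y : E3) : E3 := WithLp.toLp 2 (crossProduct x.ofLp y.ofLp)

/-- The positive unit normal `ν` of the end locus. -/
def normalVec (αc : S3 → ℝ) (p : E3) : E3 :=
  ‖gradient (equatorFn αc) p‖⁻¹ • gradient (equatorFn αc) p

/-- The positive unit tangent vector `τ = p ∧ ν` of the end locus. -/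
def tangentVec (αc : S3 → ℝ) (p : E3) : E3 := cross p (normalVec αc p)

/-! ### Geodesic curvature of the end locus -/

/-- Geodesic curvature at time `t` of a regular curve `c` in the unit sphere of `ℝ³`. -/
def geodesicCurvature (c : ℝ → E3) (t : ℝ) : ℝ :=
  inner ℝ (cross (c t) (deriv c t)) (deriv (deriv c) t) / ‖deriv c t‖ ^ 3

/-- The end locus, oriented by `τ`, has geodesic curvature `κ` at `p`. -/
def EndLocusHasGeodesicCurvature (αc : S3 → ℝ) (p : E3) (κ : ℝ) : Prop :=
  ∃ c : ℝ → E3, ContDiffAt ℝ 2 c 0 ∧ c 0 = p ∧ (∀ᶠ t in 𝓝 0, c t ∈ endLocus αc) ∧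
    (∃ r : ℝ, 0 < r ∧ deriv c 0 = r • tangentVec αc p) ∧ geodesicCurvature c 0 = κ

/-- A biregular end point: a regular end point with nonzero geodesic curvature. -/
def IsBiregularEndPoint (αc : S3 → ℝ) (p : E3) : Prop :=
  IsRegularEndPoint αc p ∧ ∃ κ : ℝ, κ ≠ 0 ∧ EndLocusHasGeodesicCurvature αc p κ

/-- An inflexion end point: a regular end point with zero geodesic curvature. -/
def IsInflexionEndPoint (αc : S3 → ℝ) (p : E3) : Prop :=
  IsRegularEndPoint αc p ∧ EndLocusHasGeodesicCurvature αc p 0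

/-! ### The chart at a regular end point -/

/-- `h` is the function of the chart at `p`: it is `C^k` near `0`, and near `p` the zero set of
`αᶜ` is the radial projection of the graph `v = h(u, w)`, where `(u, v, w)` are the orthonormal
coordinates along `τ, ν, (0,0,0,1)` in the tangent space of the sphere at `(p, 0)`. -/
structure IsEndChart (k : WithTop ℕ∞) (αc : S3 → ℝ) (p : E3) (h : ℝ × ℝ → ℝ) : Prop where
  smooth : ∃ W : Set (ℝ × ℝ), IsOpen W ∧ (0 : ℝ × ℝ) ∈ W ∧ ContDiffOn ℝ k h W
  graph : ∀ᶠ X : ℝ × ℝ × ℝ in 𝓝 0,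
    αc (radial (pt (p + X.1 • tangentVec αc p + X.2.1 • normalVec αc p) X.2.2)) = 0 ↔
      X.2.1 = h (X.1, X.2.2)

/-- The parametrization of the surface: the point with coordinates
`(u / w, h(u, w) / w, 1 / w)` with respect to `τ, ν, p`. It is used for `w > 0`. -/
def chart (αc : S3 → ℝ) (p : E3) (h : ℝ × ℝ → ℝ) (z : ℝ × ℝ) : E3 :=
  (z.1 / z.2) • tangentVec αc p + (h z / z.2) • normalVec αc p + (1 / z.2) • p

/-- The curve `v = h(u, w)`, `w = 0`, projected to the equatorial sphere. -/
def endCurve (αc : S3 → ℝ) (p : E3) (h : ℝ × ℝ → ℝ) (u : ℝ) : E3 :=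
  ‖p + u • tangentVec αc p + h (u, 0) • normalVec αc p‖⁻¹ •
    (p + u • tangentVec αc p + h (u, 0) • normalVec αc p)

/-! ### Principal directions of the surface -/

/-- The Gauss map `N = ∇α / |∇α|`. -/
def gaussMap (αc : S3 → ℝ) (q : E3) : E3 :=
  ‖gradient (affineFn αc) q‖⁻¹ • gradient (affineFn αc) q

/-- `v` is a principal vector at the regular point `q` of the surface with principal
curvature `κ`: it is a nonzero tangent vector with `DN(q) v = -κ v`. -/
def IsPrincipalVector (αc : S3 → ℝ) (q : E3) (κ : ℝ) (v : E3) : Prop :=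
  q ∈ surface αc ∧ gradient (affineFn αc) q ≠ 0 ∧ v ≠ 0 ∧
    inner ℝ (gradient (affineFn αc) q) v = 0 ∧ fderiv ℝ (gaussMap αc) q v = -κ • v

/-! ### The extended differential equation of the principal lines -/

/-- Partial derivative in `u`. -/
def du (f : ℝ × ℝ → ℝ) (z : ℝ × ℝ) : ℝ := fderiv ℝ f z (1, 0)

/-- Partial derivative in `w`. -/
def dw (f : ℝ × ℝ → ℝ) (z : ℝ × ℝ) : ℝ := fderiv ℝ f z (0, 1)

/-- The Taylor coefficient `a` of `h = ½ a u² + b u w + ⋯ + ⅙ a₃₀ u³ + ⋯`. -/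
def coeffA (h : ℝ × ℝ → ℝ) : ℝ := du (du h) 0

/-- The Taylor coefficient `b`. -/
def coeffB (h : ℝ × ℝ → ℝ) : ℝ := dw (du h) 0

/-- The Taylor coefficient `a₃₀`. -/
def coeffA30 (h : ℝ × ℝ → ℝ) : ℝ := du (du (du h)) 0

/- For `w > 0` the first and second fundamental forms of the chart are, with `u, w` as
parameters,
  `E = (1 + h_u²) / w²`, `F = (h_u (w h_w - h) - u) / w³`, `G = (1 + u² + (w h_w - h)²) / w⁴`,
  `e = h_uu / (w⁴ Δ)`, `f = h_uw / (w⁴ Δ)`, `g = h_ww / (w⁴ Δ)`, `Δ = √(E G - F²)`.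
The coefficients below are `w⁸ Δ` times `F g - G f`, `E g - G e`, `E f - F e`; written in this
form they make sense on the whole domain of `h`, with `w = 0` and `w < 0` included. -/

/-- Coefficient of `dw²`. -/
def eqL (h : ℝ × ℝ → ℝ) (z : ℝ × ℝ) : ℝ :=
  z.2 * (du h z * (z.2 * dw h z - h z) - z.1) * dw (dw h) z
    - (1 + z.1 ^ 2 + (z.2 * dw h z - h z) ^ 2) * dw (du h) z

/-- Coefficient of `du dw`. -/
def eqM (h : ℝ × ℝ → ℝ) (z : ℝ × ℝ) : ℝ :=
  z.2 ^ 2 * (1 + du h z ^ 2) * dw (dw h) z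
    - (1 + z.1 ^ 2 + (z.2 * dw h z - h z) ^ 2) * du (du h) z

/-- Coefficient of `du²`. -/
def eqN (h : ℝ × ℝ → ℝ) (z : ℝ × ℝ) : ℝ :=
  z.2 * (z.2 * (1 + du h z ^ 2) * dw (du h) z
    - (du h z * (z.2 * dw h z - h z) - z.1) * du (du h) z)

/-- The quadratic form `L dw² + M du dw + N du²` at `z`, evaluated at `v = (du, dw)`. -/
def eqForm (h : ℝ × ℝ → ℝ) (z v : ℝ × ℝ) : ℝ :=
  eqL h z * v.2 ^ 2 + eqM h z * (v.1 * v.2) + eqN h z * v.1 ^ 2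

/-- The extended principal net on a set `S` of the chart, given by two `C^{k-2}` vector fields:
they are transversal, span exactly the two solution directions of the extended equation, and,
in the finite region `w > 0`, the first one spans the minimal and the second one the maximal
principal direction of the surface. -/
structure IsExtendedPrincipalNet (k : WithTop ℕ∞) (αc : S3 → ℝ) (p : E3) (h : ℝ × ℝ → ℝ)
    (S : Set (ℝ × ℝ)) (l₁ l₂ : ℝ × ℝ → ℝ × ℝ) : Prop where
  smooth : ∀ n : WithTop ℕ∞, n + 2 ≤ k → ContDiffOn ℝ n l₁ S ∧ ContDiffOn ℝ n l₂ S
  transversal : ∀ z ∈ S, LinearIndependent ℝ ![l₁ z, l₂ z]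
  directions : ∀ z ∈ S, ∀ v : ℝ × ℝ,
    eqForm h z v = 0 ↔ v ∈ Submodule.span ℝ {l₁ z} ∨ v ∈ Submodule.span ℝ {l₂ z}
  principal : ∀ z ∈ S, 0 < z.2 → ∃ κ₁ κ₂ : ℝ, κ₁ < κ₂ ∧
    IsPrincipalVector αc (chart αc p h z) κ₁ (fderiv ℝ (chart αc p h) z (l₁ z)) ∧
    IsPrincipalVector αc (chart αc p h z) κ₂ (fderiv ℝ (chart αc p h) z (l₂ z))

/-! ### Leaves, topological equivalence, patterns -/

/-- `z` and `z'` lie on the same leaf, in the region `S`, of the foliation generated by the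
nonvanishing vector field `l`: an integral curve of `l` inside `S` goes from `z` to `z'`, in
positive or in negative time. -/
def SameLeaf (l : ℝ × ℝ → ℝ × ℝ) (S : Set (ℝ × ℝ)) (z z' : ℝ × ℝ) : Prop :=
  ∃ (γ : ℝ → ℝ × ℝ) (T : ℝ), γ 0 = z ∧ γ T = z' ∧
    ∀ t ∈ Set.uIcc 0 T, γ t ∈ S ∧ HasDerivWithinAt γ (l (γ t)) (Set.uIcc 0 T) t

/-- Near `0` the extended principal net, with singular set `Z`, is topologically equivalent to
the net of horizontal and vertical lines of the plane, by a homeomorphism of a neighborhood of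
`0` onto a neighborhood of `0` that fixes `0`, maps the finite region `w > 0` to the
region `R`, and maps the leaves of the first (minimal) foliation outside `Z` to horizontal leaves
and those of the second (maximal) one to vertical leaves. -/
def HasNetPattern (k : WithTop ℕ∞) (αc : S3 → ℝ) (p : E3) (h : ℝ × ℝ → ℝ)
    (Z R : Set (ℝ × ℝ)) : Prop :=
  ∃ (e : OpenPartialHomeomorph (ℝ × ℝ) (ℝ × ℝ)) (l₁ l₂ : ℝ × ℝ → ℝ × ℝ),
    (0 : ℝ × ℝ) ∈ e.source ∧ e 0 = 0 ∧
    (∀ z ∈ e.source, 0 < z.2 ↔ e z ∈ R) ∧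
    IsExtendedPrincipalNet k αc p h (e.source \ Z) l₁ l₂ ∧
    (∀ z ∈ e.source \ Z, ∀ z' ∈ e.source \ Z,
      (SameLeaf l₁ (e.source \ Z) z z' ↔
        SameLeaf (fun _ => (1, 0)) (e '' (e.source \ Z)) (e z) (e z')) ∧
      (SameLeaf l₂ (e.source \ Z) z z' ↔
        SameLeaf (fun _ => (0, 1)) (e '' (e.source \ Z)) (e z) (e z')))

/-- The regular pattern: no singularity, and the net in the finite region is that of horizontal
and vertical lines in a half plane bounded by a horizontal or by a vertical line. -/
def HasBiregularPattern (k : WithTop ℕ∞) (αc : S3 → ℝ) (p : E3) (h : ℝ × ℝ → ℝ) : Prop :=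
  HasNetPattern k αc p h ∅ {x | 0 < x.2} ∨ HasNetPattern k αc p h ∅ {x | 0 < x.1}

/-- The hyperbolic inflexion pattern: the net in the finite region is that of horizontal and
vertical lines in the union of three quadrants; each foliation has one separatrix that
enters the finite region from the end point (the rays `y = 0 < x` and `x = 0 < y`). -/
def HasHyperbolicInflexionPattern (k : WithTop ℕ∞) (αc : S3 → ℝ) (p : E3) (h : ℝ × ℝ → ℝ) :
    Prop :=
  HasNetPattern k αc p h {0} {x | 0 < x.1 ∨ 0 < x.2}

/-- The elliptic inflexion pattern: the net in the finite region is that of horizontal and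
vertical lines in one quadrant; no leaf in the finite region tends to the end point. -/
def HasEllipticInflexionPattern (k : WithTop ℕ∞) (αc : S3 → ℝ) (p : E3) (h : ℝ × ℝ → ℝ) :
    Prop :=
  HasNetPattern k αc p h {0} {x | 0 < x.1 ∧ 0 < x.2}

/-! ### The Lie–Cartan field -/

/-- `𝓕(u, w, q) = L q² + M q + N`, with `q = dw / du`. -/
def lieCartanFn (h : ℝ × ℝ → ℝ) (x : ℝ × ℝ × ℝ) : ℝ :=
  eqL h (x.1, x.2.1) * x.2.2 ^ 2 + eqM h (x.1, x.2.1) * x.2.2 + eqN h (x.1, x.2.1)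

/-- The surface `𝓕 = 0`. -/
def lieCartanSurface (h : ℝ × ℝ → ℝ) : Set (ℝ × ℝ × ℝ) := {x | lieCartanFn h x = 0}

/-- The field `(𝓕_q, q 𝓕_q, -(𝓕_u + q 𝓕_w))`. -/
def lieCartanField (h : ℝ × ℝ → ℝ) (x : ℝ × ℝ × ℝ) : ℝ × ℝ × ℝ :=
  (fderiv ℝ (lieCartanFn h) x (0, 0, 1),
    x.2.2 * fderiv ℝ (lieCartanFn h) x (0, 0, 1),
    -(fderiv ℝ (lieCartanFn h) x (1, 0, 0) + x.2.2 * fderiv ℝ (lieCartanFn h) x (0, 1, 0)))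

/-- The field `X` of `ℝ³`, considered on the (possibly singular) surface `Q`, has at `x₀` a
hyperbolic saddle with eigenvalues `r` and `s`: it vanishes there, `r` and `s` have opposite signs,
the eigenvalues of its derivative are `r`, `s` and `0` (the latter is transversal to
the surface), and the eigenvectors for `r` and `s` are tangent to `Q`. -/
def HasHyperbolicSaddle (Q : Set (ℝ × ℝ × ℝ)) (X : ℝ × ℝ × ℝ → ℝ × ℝ × ℝ) (x₀ : ℝ × ℝ × ℝ)
    (r s : ℝ) : Prop :=
  x₀ ∈ Q ∧ X x₀ = 0 ∧ r * s < 0 ∧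
  ∃ A : (ℝ × ℝ × ℝ) →L[ℝ] (ℝ × ℝ × ℝ), HasFDerivAt X A x₀ ∧
    LinearMap.charpoly (A : (ℝ × ℝ × ℝ) →ₗ[ℝ] (ℝ × ℝ × ℝ)) =
      Polynomial.X * (Polynomial.X - Polynomial.C r) * (Polynomial.X - Polynomial.C s) ∧
    (∀ v, A v = r • v → v ∈ tangentConeAt ℝ Q x₀) ∧
    (∀ v, A v = s • v → v ∈ tangentConeAt ℝ Q x₀)

end EndPoint

end

/-! Both local pictures come from one topological fact about scalar equations. Let q₁ ≤ q₂ be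
Lipschitz slopes near the origin of the plane with q₁ < q₂ off the origin, and let Φ₁, Φ₂ send a
point to the heights at which its two leaves meet the line of time 0. Then (Φ₁, Φ₂) is a local
homeomorphism that carries leaves of q₁ to vertical and leaves of q₂ to horizontal lines. It is
injective because a leaf of q₁ and a leaf of q₂ cross at most once (`IsSol.cross`), even at the
origin, where they may be tangent; it covers a small square by the intermediate value theorem
(`exists_straightensGraphs`). The image of w > 0 follows from two remarks: the order of Φ₁ and Φ₂ is
determined by the side of time 0, and on a half axis that is a leaf of one foliation the sign of w
is the sign of the corresponding Φ.

It remains to produce the slopes. The extended equation has L(0) = -b, M(0) = -a and N = w N₁. If a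
≠ 0 the two solution directions are distinct at 0 and depend on the point as smoothly as L, M, N;
one of them is tangent to w = 0. If a = 0 and β ≠ 0, then L ≠ 0 and the slopes are g ± √E with g =
-M/(2L) and E = g² - w N₁/L. To first order N₁/L is -w, and g has u-derivative d = -a₃₀/(2b) ≠ 0, so
E is comparable to a definite quadratic form. Hence √E is Lipschitz although E vanishes at the
origin (`exists_le_sq_sub`, `lipschitzOnWith_sqrt_of_le`), and the topological fact applies at the
singular point itself. On w = 0 the slopes are g ± |g|, so the two half axes belong to different
foliations; the sign of d, opposite to that of β, decides which half belongs to which, and this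
separates three quadrants from one.

The geometric input is the following. A solution direction is principal because the extended form is
the determinant of the two fundamental forms contracted with that direction
(`exists_nhds_isPrincipalVector`); which direction is minimal is read off an algebraic identity
(`secondForm_mul_sub`). The end locus is the projected graph v = h(u, 0), and p ∧ τ = -ν gives
geodesic curvature -a. The Lie–Cartan saddle is a separate first-order computation at 0; the
patterns do not depend on it. -/

namespace EndPoint

/-! ### Comparison and crossing of solutions of scalar equations. -/

section ScalarODE

open Set Filter Metric
open scoped NNReal

/-- Two-sided Grönwall inequality on an interval. -/
theorem abs_le_exp_mul_of_abs_deriv_le {d d' : ℝ → ℝ} {a b K : ℝ}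
    (hc : ContinuousOn d (Icc a b)) (hd : ∀ t ∈ Ioo a b, HasDerivAt d (d' t) t)
    (hK : ∀ t ∈ Ioo a b, |d' t| ≤ K * |d t|) {s t : ℝ} (hs : s ∈ Icc a b) (ht : t ∈ Icc a b) :
    |d t| ≤ Real.exp (K * |t - s|) * |d s| := by
  -- Squares avoid the corner of |d|: since |d d'| ≤ K d², the function d² e^{2Kx} increases and d²
  -- e^{-2Kx} decreases, which gives the bound backward and forward in time.
  have key : ∀ c : ℝ, ∀ x ∈ Ioo a b, HasDerivAt (fun x => d x ^ 2 * Real.exp (c * x))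
      ((2 * (d x * d' x) + c * d x ^ 2) * Real.exp (c * x)) x := by
    intro c x hx
    have h1 := ((hd x hx).fun_pow 2).mul (((hasDerivAt_id x).const_mul c).exp)
    refine h1.congr_deriv ?_
    simp; ring
  have hcont : ∀ c : ℝ, ContinuousOn (fun x => d x ^ 2 * Real.exp (c * x)) (Icc a b) := by
    intro c
    exact (hc.pow 2).mul (by fun_prop)
  have hb : ∀ x ∈ Ioo a b, |d x * d' x| ≤ K * d x ^ 2 := by
    intro x hx
    rw [abs_mul, ← sq_abs (d x)]
    nlinarith [hK x hx, abs_nonneg (d x)]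
  have hmono : MonotoneOn (fun x => d x ^ 2 * Real.exp (2 * K * x)) (Icc a b) := by
    apply monotoneOn_of_deriv_nonneg (convex_Icc a b) (hcont _)
    · rw [interior_Icc]
      exact fun x hx => (key _ x hx).differentiableAt.differentiableWithinAt
    · rw [interior_Icc]
      intro x hx
      rw [(key _ x hx).deriv]
      have := (abs_le.1 (hb x hx)).1
      exact mul_nonneg (by nlinarith) (Real.exp_pos _).le
  have hanti : AntitoneOn (fun x => d x ^ 2 * Real.exp (-(2 * K) * x)) (Icc a b) := by
    apply antitoneOn_of_deriv_nonpos (convex_Icc a b) (hcont _)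
    · rw [interior_Icc]
      exact fun x hx => (key _ x hx).differentiableAt.differentiableWithinAt
    · rw [interior_Icc]
      intro x hx
      rw [(key _ x hx).deriv]
      have := (abs_le.1 (hb x hx)).2
      exact mul_nonpos_of_nonpos_of_nonneg (by nlinarith) (Real.exp_pos _).le
  have fin : d t ^ 2 ≤ d s ^ 2 * Real.exp (2 * K * |t - s|) := by
    rcases le_total s t with h | h
    · have h1 := hanti hs ht h
      simp only at h1
      rw [abs_of_nonneg (by linarith)]
      have h2 := mul_le_mul_of_nonneg_right h1 (Real.exp_pos (2 * K * t)).le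
      rw [mul_assoc (d t ^ 2), mul_assoc (d s ^ 2), ← Real.exp_add, ← Real.exp_add] at h2
      rwa [show -(2 * K) * t + 2 * K * t = 0 by ring, Real.exp_zero, mul_one,
        show -(2 * K) * s + 2 * K * t = 2 * K * (t - s) by ring] at h2
    · have h1 := hmono ht hs h
      simp only at h1
      rw [abs_of_nonpos (by linarith)]
      have h2 := mul_le_mul_of_nonneg_right h1 (Real.exp_pos (-(2 * K * t))).le
      rw [mul_assoc (d t ^ 2), mul_assoc (d s ^ 2), ← Real.exp_add, ← Real.exp_add] at h2
      rwa [show 2 * K * t + -(2 * K * t) = 0 by ring, Real.exp_zero, mul_one,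
        show 2 * K * s + -(2 * K * t) = 2 * K * -(t - s) by ring] at h2
  have hpos : 0 ≤ Real.exp (K * |t - s|) * |d s| := by positivity
  refine abs_le_of_sq_le_sq' ?_ hpos |> abs_le.2
  refine fin.trans_eq ?_
  rw [mul_pow, sq_abs, ← Real.exp_nat_mul, mul_comm (d s ^ 2), Nat.cast_ofNat, mul_assoc]

/-- A function with `d' ≤ K |d|` that decreases strictly through its zeros, except possibly for
one zero at `0`, becomes negative after a zero. -/
theorem neg_of_deriv_le {d d' : ℝ → ℝ} {a b K : ℝ} (hK0 : 0 < K) (hab : a < b)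
    (hd : ∀ t ∈ Icc a b, HasDerivAt d (d' t) t)
    (hK : ∀ t ∈ Icc a b, d' t ≤ K * |d t|)
    (hneg : ∀ t ∈ Icc a b, d t = 0 → t ≠ 0 → d' t < 0) (ha : d a = 0) : d b < 0 := by
  have hc : ContinuousOn d (Icc a b) := fun t ht => (hd t ht).continuousAt.continuousWithinAt
  -- Barrier argument: at a contact with ε e^{2Kx} the barrier has slope 2K d > K |d| ≥ d'.
  have hle : ∀ t ∈ Icc a b, d t ≤ 0 := by
    intro t ht
    refine le_of_forall_pos_le_add fun δ hδ => ?_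
    have hB : ∀ ε > 0, d t ≤ ε * Real.exp (2 * K * t) := by
      intro ε hε
      refine image_le_of_deriv_right_lt_deriv_boundary (f' := d') hc
        (fun x hx => (hd x ⟨hx.1, hx.2.le⟩).hasDerivWithinAt)
        (B := fun x => ε * Real.exp (2 * K * x))
        (B' := fun x => ε * (Real.exp (2 * K * x) * (2 * K))) (by rw [ha]; positivity) ?_ ?_ ht
      · intro x
        refine ((((hasDerivAt_id x).const_mul (2 * K)).exp).const_mul ε).congr_deriv ?_
        simp
      · intro x hx hx'
        have hp : 0 < ε * Real.exp (2 * K * x) := by positivity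
        have := hK x ⟨hx.1, hx.2.le⟩
        rw [hx', abs_of_pos hp] at this
        nlinarith
    have h2 := hB (δ / Real.exp (2 * K * t)) (by positivity)
    rw [div_mul_cancel₀ _ (Real.exp_pos _).ne'] at h2
    linarith
  refine lt_of_le_of_ne (hle b (right_mem_Icc.2 hab.le)) fun hb => ?_
  -- With d ≤ 0 the bound reads d' ≤ -K d, so e^{Kx} d decreases. If it ended at 0 it would be
  -- nonnegative before, and d would vanish identically.
  have hanti : AntitoneOn (fun x => Real.exp (K * x) * d x) (Icc a b) := by
    have key : ∀ x ∈ Icc a b, HasDerivAt (fun x => Real.exp (K * x) * d x)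
        (Real.exp (K * x) * (K * d x + d' x)) x := by
      intro x hx
      refine ((((hasDerivAt_id x).const_mul K).exp).mul (hd x hx)).congr_deriv ?_
      simp; ring
    apply antitoneOn_of_deriv_nonpos (convex_Icc a b)
    · exact fun x hx => (key x hx).continuousAt.continuousWithinAt
    · rw [interior_Icc]
      exact fun x hx => (key x ⟨hx.1.le, hx.2.le⟩).differentiableAt.differentiableWithinAt
    · rw [interior_Icc]
      intro x hx
      have hx' : x ∈ Icc a b := ⟨hx.1.le, hx.2.le⟩
      rw [(key x hx').deriv]
      have := hK x hx'
      rw [abs_of_nonpos (hle x hx')] at this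
      exact mul_nonpos_of_nonneg_of_nonpos (Real.exp_pos _).le (by linarith)
  have hzero : ∀ t ∈ Icc a b, d t = 0 := by
    intro t ht
    refine le_antisymm (hle t ht) ?_
    have := hanti ht (right_mem_Icc.2 hab.le) ht.2
    simp only [hb, mul_zero] at this
    exact nonneg_of_mul_nonneg_right this (Real.exp_pos _)
  -- An interior time other than the exceptional time 0: there d vanishes locally, so d' = 0,
  -- against strict decrease.
  obtain ⟨t, ht, ht0⟩ : ∃ t ∈ Ioo a b, t ≠ 0 := by
    rcases eq_or_ne ((a + b) / 2) 0 with h | h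
    · exact ⟨(a + (a + b) / 2) / 2, ⟨by linarith, by linarith⟩, by
        rw [h]; intro h3; linarith⟩
    · exact ⟨(a + b) / 2, ⟨by linarith, by linarith⟩, h⟩
  have ht' : t ∈ Icc a b := ⟨ht.1.le, ht.2.le⟩
  have h1 : HasDerivAt d 0 t := by
    refine (hasDerivAt_const t (0 : ℝ)).congr_of_eventuallyEq ?_
    filter_upwards [Icc_mem_nhds ht.1 ht.2] with x hx using hzero x hx
  have := h1.unique (hd t ht')
  have h3 := hneg t ht' (hzero t ht') ht0
  linarith

/-- The reflected statement: the function is positive before a zero. -/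
theorem pos_of_deriv_le {d d' : ℝ → ℝ} {a b K : ℝ} (hK0 : 0 < K) (hab : a < b)
    (hd : ∀ t ∈ Icc a b, HasDerivAt d (d' t) t)
    (hK : ∀ t ∈ Icc a b, d' t ≤ K * |d t|)
    (hneg : ∀ t ∈ Icc a b, d t = 0 → t ≠ 0 → d' t < 0) (hb : d b = 0) : 0 < d a := by
  have hm : ∀ t ∈ Icc (-b) (-a), -t ∈ Icc a b := fun t ht =>
    ⟨by linarith [ht.2], by linarith [ht.1]⟩
  have := neg_of_deriv_le (d := fun t => -d (-t)) (d' := fun t => d' (-t)) (a := -b) (b := -a)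
    hK0 (by linarith) ?_ ?_ ?_ (by simp [hb])
  · simpa using this
  · intro t ht
    have := (hd (-t) (hm t ht)).scomp t (hasDerivAt_neg t)
    refine this.neg.congr_deriv ?_
    simp
  · intro t ht
    simpa using hK _ (hm t ht)
  · intro t ht h0 ht0
    exact hneg _ (hm t ht) (by simpa using h0) (by simpa using ht0)

/-- `y` solves `y' = q(t, y)` on `[-1, 1]`. -/
def IsSol (q : ℝ × ℝ → ℝ) (y : ℝ → ℝ) : Prop :=
  ∀ t ∈ Icc (-1 : ℝ) 1, HasDerivAt y (q (t, y t)) t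

theorem exists_isSol {q : ℝ × ℝ → ℝ} {K B : ℝ≥0} (hq : LipschitzWith K q) (hB : ∀ z, |q z| ≤ B)
    {u₀ : ℝ} (hu : u₀ ∈ Icc (-1 : ℝ) 1) (w₀ : ℝ) : ∃ y, y u₀ = w₀ ∧ IsSol q y := by
  have hu' : u₀ ∈ Icc (-2 : ℝ) 2 := ⟨by linarith [hu.1], by linarith [hu.2]⟩
  -- The larger interval [-2, 2] gives two-sided derivatives at ±1. As |t - u₀| ≤ 3 and |q| ≤ B, a
  -- ball of radius 4 B is never left.
  have hPL : IsPicardLindelof (fun t y => q (t, y)) (tmin := -2) (tmax := 2) ⟨u₀, hu'⟩ w₀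
      (B * 4) 0 B K := by
    refine ⟨fun t _ => ?_, fun x _ => ?_, fun t _ x _ => hB _, ?_⟩
    · refine LipschitzWith.lipschitzOnWith ?_
      simpa [Function.comp_def] using hq.comp (LipschitzWith.prodMk_left t)
    · exact (hq.continuous.comp (by fun_prop)).continuousOn
    · simp only [NNReal.coe_mul, NNReal.coe_ofNat, NNReal.coe_zero, sub_zero]
      exact mul_le_mul_of_nonneg_left (max_le (by linarith [hu.1]) (by linarith [hu.2])) B.2
  obtain ⟨y, hy0, hy⟩ := hPL.exists_eq_forall_mem_Icc_hasDerivWithinAt₀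
  refine ⟨y, hy0, fun t ht => ?_⟩
  exact (hy t ⟨by linarith [ht.1], by linarith [ht.2]⟩).hasDerivAt
    (Icc_mem_nhds (by linarith [ht.1]) (by linarith [ht.2]))

theorem IsSol.abs_sub_le {q : ℝ × ℝ → ℝ} {K : ℝ≥0} (hq : LipschitzWith K q) {y y' : ℝ → ℝ}
    {a b : ℝ} (hy : ContinuousOn y (Icc a b)) (hy' : ContinuousOn y' (Icc a b))
    (hd : ∀ t ∈ Ioo a b, HasDerivAt y (q (t, y t)) t)
    (hd' : ∀ t ∈ Ioo a b, HasDerivAt y' (q (t, y' t)) t) {s t : ℝ} (hs : s ∈ Icc a b)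
    (ht : t ∈ Icc a b) : |y t - y' t| ≤ Real.exp (K * |t - s|) * |y s - y' s| := by
  refine abs_le_exp_mul_of_abs_deriv_le (d := fun t => y t - y' t) (hy.sub hy')
    (fun t ht => (hd t ht).sub (hd' t ht)) (fun t _ => ?_) hs ht
  have := hq.dist_le_mul (t, y t) (t, y' t)
  simpa [Real.dist_eq, Prod.dist_eq] using this

theorem IsSol.continuousOn {q : ℝ × ℝ → ℝ} {y : ℝ → ℝ} (hy : IsSol q y) :
    ContinuousOn y (Icc (-1) 1) := fun t ht => (hy t ht).continuousAt.continuousWithinAt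

theorem IsSol.dist_bound {q : ℝ × ℝ → ℝ} {K : ℝ≥0} (hq : LipschitzWith K q) {y y' : ℝ → ℝ}
    (hy : IsSol q y) (hy' : IsSol q y') {s t : ℝ} (hs : s ∈ Icc (-1 : ℝ) 1)
    (ht : t ∈ Icc (-1 : ℝ) 1) : |y t - y' t| ≤ Real.exp (K * |t - s|) * |y s - y' s| :=
  IsSol.abs_sub_le hq hy.continuousOn hy'.continuousOn (fun t ht => hy t ⟨ht.1.le, ht.2.le⟩)
    (fun t ht => hy' t ⟨ht.1.le, ht.2.le⟩) hs ht

theorem IsSol.eqOn {q : ℝ × ℝ → ℝ} {K : ℝ≥0} (hq : LipschitzWith K q) {y y' : ℝ → ℝ}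
    (hy : IsSol q y) (hy' : IsSol q y') {s t : ℝ} (hs : s ∈ Icc (-1 : ℝ) 1)
    (ht : t ∈ Icc (-1 : ℝ) 1) (h : y s = y' s) : y t = y' t := by
  have := hy.dist_bound hq hy' hs ht
  rw [h, sub_self, abs_zero, mul_zero] at this
  linarith [abs_nonpos_iff.1 this]

/-- A change of order would produce a common point, excluded by uniqueness; the direction of time is
irrelevant. -/
theorem IsSol.lt_of_lt {q : ℝ × ℝ → ℝ} {K : ℝ≥0} (hq : LipschitzWith K q) {y y' : ℝ → ℝ}
    (hy : IsSol q y) (hy' : IsSol q y') {s t : ℝ} (hs : s ∈ Icc (-1 : ℝ) 1)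
    (ht : t ∈ Icc (-1 : ℝ) 1) (h : y s < y' s) : y t < y' t := by
  by_contra hcon
  have hsub : uIcc s t ⊆ Icc (-1 : ℝ) 1 := uIcc_subset_Icc hs ht
  have hc : ContinuousOn (fun x => y' x - y x) (uIcc s t) :=
    (hy'.continuousOn.sub hy.continuousOn).mono hsub
  have h0 : (0 : ℝ) ∈ uIcc (y' s - y s) (y' t - y t) := by
    rw [mem_uIcc]; right; constructor <;> linarith
  obtain ⟨x, hx, hx0⟩ := intermediate_value_uIcc hc h0
  have := hy.eqOn hq hy' (hsub hx) hs (by simp only at hx0; linarith)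
  linarith

theorem IsSol.abs_sub_le_mul {q : ℝ × ℝ → ℝ} {B : ℝ≥0} (hB : ∀ z, |q z| ≤ B) {y : ℝ → ℝ}
    (hy : IsSol q y) {s t : ℝ} (hs : s ∈ Icc (-1 : ℝ) 1) (ht : t ∈ Icc (-1 : ℝ) 1) :
    |y t - y s| ≤ B * |t - s| :=
  (convex_Icc (-1 : ℝ) 1).norm_image_sub_le_of_norm_hasDerivWithin_le
    (fun x hx => (hy x hx).hasDerivWithinAt) (fun _ _ => hB _) hs ht

/-- Solutions of two equations with `q₁ < q₂` off the origin: `y₁ - y₂` changes sign at a common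
point. -/
theorem IsSol.cross {q₁ q₂ : ℝ × ℝ → ℝ} {K : ℝ≥0} (hq : LipschitzWith K q₂)
    (hlt : ∀ z, z ≠ 0 → q₁ z < q₂ z) (hle : ∀ z, q₁ z ≤ q₂ z) {y₁ y₂ : ℝ → ℝ} (h₁ : IsSol q₁ y₁)
    (h₂ : IsSol q₂ y₂) {s t : ℝ} (hs : s ∈ Icc (-1 : ℝ) 1) (ht : t ∈ Icc (-1 : ℝ) 1)
    (hst : s < t) : (y₁ s = y₂ s → y₁ t < y₂ t) ∧ (y₁ t = y₂ t → y₂ s < y₁ s) := by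
  have hsub : Icc s t ⊆ Icc (-1 : ℝ) 1 := Icc_subset_Icc hs.1 ht.2
  have hd : ∀ x ∈ Icc s t, HasDerivAt (fun x => y₁ x - y₂ x) (q₁ (x, y₁ x) - q₂ (x, y₂ x)) x :=
    fun x hx => (h₁ x (hsub hx)).sub (h₂ x (hsub hx))
  -- Split into (q₁ - q₂)(x, y₁) ≤ 0 and a difference of values of q₂, so only q₂ has to be
  -- Lipschitz. K + 1 replaces K to have a positive constant.
  have hK : ∀ x ∈ Icc s t, q₁ (x, y₁ x) - q₂ (x, y₂ x) ≤ (K + 1) * |y₁ x - y₂ x| := by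
    intro x _
    have h1 := hq.dist_le_mul (x, y₁ x) (x, y₂ x)
    simp only [Prod.dist_eq, dist_self, Real.dist_eq] at h1
    rw [max_eq_right (abs_nonneg _)] at h1
    have h2 := (abs_le.1 h1).2
    have h3 := hle (x, y₁ x)
    nlinarith [abs_nonneg (y₁ x - y₂ x)]
  have hneg : ∀ x ∈ Icc s t, y₁ x - y₂ x = 0 → x ≠ 0 → q₁ (x, y₁ x) - q₂ (x, y₂ x) < 0 := by
    intro x _ h0 hx
    rw [sub_eq_zero.1 h0, sub_neg]
    refine hlt _ fun h => hx ?_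
    simpa using congrArg Prod.fst h
  have hK0 : (0 : ℝ) < K + 1 := by positivity
  constructor
  · intro h
    have := neg_of_deriv_le hK0 hst hd hK hneg (by rw [h, sub_self])
    linarith
  · intro h
    have := pos_of_deriv_le hK0 hst hd hK hneg (by rw [h, sub_self])
    linarith

end ScalarODE

/-! ### Leaves as level sets, and homeomorphisms from compactness. -/

section NetHomeo

open Set Filter Metric
open scoped NNReal

/-- The strip on which solutions are considered. -/
def strip : Set (ℝ × ℝ) := {z | z.1 ∈ Icc (-1 : ℝ) 1}

/-- `Φ` assigns to a point the height at time `0` of the solution through it. -/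
def IsFlat (q Φ : ℝ × ℝ → ℝ) : Prop :=
  ContinuousOn Φ strip ∧ ∀ y, IsSol q y → ∀ t ∈ Icc (-1 : ℝ) 1, Φ (t, y t) = y 0

theorem zero_mem_Icc : (0 : ℝ) ∈ Icc (-1 : ℝ) 1 := ⟨by norm_num, by norm_num⟩

/-- Continuity comes from a Lipschitz bound: following the solution through z from time z.1 to z'.1
changes its height by at most B |z.1 - z'.1|, and the passage from there to time 0 costs at most a
factor e^K by Grönwall. -/
theorem exists_isFlat {q : ℝ × ℝ → ℝ} {K B : ℝ≥0} (hq : LipschitzWith K q)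
    (hB : ∀ z, |q z| ≤ B) : ∃ Φ, IsFlat q Φ := by
  have hex : ∀ z : ℝ × ℝ, ∃ y, z ∈ strip → y z.1 = z.2 ∧ IsSol q y := by
    intro z
    by_cases hz : z ∈ strip
    · obtain ⟨y, hy⟩ := exists_isSol hq hB hz z.2
      exact ⟨y, fun _ => hy⟩
    · exact ⟨0, fun h => (hz h).elim⟩
  choose Y hY using hex
  refine ⟨fun z => Y z 0, ?_, fun y hy t ht => ?_⟩
  · have hlip : LipschitzOnWith (Real.toNNReal (Real.exp K * (1 + B))) (fun z => Y z 0) strip := by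
      refine LipschitzOnWith.of_dist_le_mul fun z hz z' hz' => ?_
      obtain ⟨h1, h2⟩ := hY z hz
      obtain ⟨h1', h2'⟩ := hY z' hz'
      rw [Real.coe_toNNReal _ (by positivity), Real.dist_eq]
      have e1 := h2.dist_bound hq h2' hz' zero_mem_Icc
      have e2 := h2.abs_sub_le_mul hB hz hz'
      have e3 : |Y z z'.1 - Y z' z'.1| ≤ (1 + B) * dist z z' := by
        have a1 : |z.2 - z'.2| ≤ dist z z' := by
          rw [← Real.dist_eq]; exact le_max_right _ _
        have a2 : |z.1 - z'.1| ≤ dist z z' := by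
          rw [← Real.dist_eq]; exact le_max_left _ _
        rw [h1', show Y z z'.1 - z'.2 = (Y z z'.1 - Y z z.1) + (z.2 - z'.2) by rw [h1]; ring]
        refine (abs_add_le _ _).trans ?_
        rw [abs_sub_comm z'.1] at e2
        nlinarith [mul_le_mul_of_nonneg_left a2 B.2]
      have e4 : Real.exp (K * |0 - z'.1|) ≤ Real.exp K := by
        apply Real.exp_le_exp.2
        have : |0 - z'.1| ≤ 1 := by rw [zero_sub, abs_neg]; exact abs_le.2 hz'
        nlinarith [K.2, mul_le_mul_of_nonneg_left this K.2]
      calc _ ≤ _ := e1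
        _ ≤ Real.exp K * ((1 + B) * dist z z') :=
          mul_le_mul e4 e3 (abs_nonneg _) (Real.exp_pos _).le
        _ = _ := by ring
    exact hlip.continuousOn
  · obtain ⟨h1, h2⟩ := hY (t, y t) ht
    exact h2.eqOn hq hy ht zero_mem_Icc h1

theorem IsFlat.comp_continuousOn {q q' Φ : ℝ × ℝ → ℝ} (hΦ : IsFlat q' Φ) {y : ℝ → ℝ}
    (hy : IsSol q y) : ContinuousOn (fun t => Φ (t, y t)) (Icc (-1) 1) :=
  hΦ.1.comp (continuousOn_id.prodMk hy.continuousOn) fun _ ht => ht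

theorem eq_add_mul_of_hasDerivWithinAt {g : ℝ → ℝ} {m T : ℝ}
    (hg : ∀ t ∈ uIcc 0 T, HasDerivWithinAt g m (uIcc 0 T) t) :
    ∀ t ∈ uIcc 0 T, g t = g 0 + t * m := by
  intro t ht
  have := (convex_uIcc 0 T).norm_image_sub_le_of_norm_hasDerivWithin_le (C := 0)
    (f := fun t => g t - t * m) (f' := fun _ => m - 1 * m) (x := 0) (y := t)
    (fun x hx => (hg x hx).sub ((hasDerivWithinAt_id x _).mul_const m)) (fun x _ => by simp)
    left_mem_uIcc ht
  simp only [zero_mul, sub_zero] at this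
  linarith [norm_le_zero_iff.1 this]

theorem hasDerivWithinAt_fst {γ : ℝ → ℝ × ℝ} {v : ℝ × ℝ} {s : Set ℝ} {t : ℝ}
    (h : HasDerivWithinAt γ v s t) : HasDerivWithinAt (fun t => (γ t).1) v.1 s t :=
  (hasFDerivAt_fst (𝕜 := ℝ) (p := γ t)).comp_hasDerivWithinAt t h

theorem hasDerivWithinAt_snd {γ : ℝ → ℝ × ℝ} {v : ℝ × ℝ} {s : Set ℝ} {t : ℝ}
    (h : HasDerivWithinAt γ v s t) : HasDerivWithinAt (fun t => (γ t).2) v.2 s t :=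
  (hasFDerivAt_snd (𝕜 := ℝ) (p := γ t)).comp_hasDerivWithinAt t h

theorem sameLeaf_const_iff {V : Set (ℝ × ℝ)} {x x' v : ℝ × ℝ} :
    SameLeaf (fun _ => v) V x x' ↔ ∃ T : ℝ, x' = x + T • v ∧ ∀ t ∈ uIcc 0 T, x + t • v ∈ V := by
  constructor
  · rintro ⟨γ, T, h0, hT, hγ⟩
    have key : ∀ t ∈ uIcc 0 T, γ t = x + t • v := by
      intro t ht
      have h1 := eq_add_mul_of_hasDerivWithinAt (g := fun t => (γ t).1) (m := v.1)
        (fun t ht => (hasDerivWithinAt_fst (hγ t ht).2)) t ht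
      have h2 := eq_add_mul_of_hasDerivWithinAt (g := fun t => (γ t).2) (m := v.2)
        (fun t ht => (hasDerivWithinAt_snd (hγ t ht).2)) t ht
      rw [h0] at h1 h2
      exact Prod.ext (by simpa using h1) (by simpa using h2)
    refine ⟨T, by rw [← hT, key T right_mem_uIcc], fun t ht => ?_⟩
    rw [← key t ht]
    exact (hγ t ht).1
  · rintro ⟨T, hT, hγ⟩
    refine ⟨fun t => x + t • v, T, by simp, hT.symm, fun t ht => ⟨hγ t ht, ?_⟩⟩
    have := (((hasDerivAt_id t).smul_const v).const_add x).hasDerivWithinAt (s := uIcc 0 T)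
    simpa using this

theorem sameLeaf_horizontal_iff {V : Set (ℝ × ℝ)} {x x' : ℝ × ℝ} :
    SameLeaf (fun _ => (1, 0)) V x x' ↔
      x.2 = x'.2 ∧ ∀ c ∈ uIcc x.1 x'.1, (c, x.2) ∈ V := by
  rw [sameLeaf_const_iff]
  constructor
  · rintro ⟨T, rfl, h⟩
    refine ⟨by simp, fun c hc => ?_⟩
    have := h (c - x.1) (by
      simp only [Prod.smul_mk, smul_eq_mul, mul_one, mul_zero, Prod.fst_add] at hc
      rw [mem_uIcc] at hc ⊢
      rcases hc with h | h
      · left; constructor <;> linarith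
      · right; constructor <;> linarith)
    convert this using 1
    ext <;> simp
  · rintro ⟨h1, h2⟩
    refine ⟨x'.1 - x.1, by ext <;> simp [h1], fun t ht => ?_⟩
    convert h2 (x.1 + t) _ using 1
    · ext <;> simp
    · rw [mem_uIcc] at ht ⊢
      rcases ht with h | h
      · left; constructor <;> linarith
      · right; constructor <;> linarith

theorem sameLeaf_vertical_iff {V : Set (ℝ × ℝ)} {x x' : ℝ × ℝ} :
    SameLeaf (fun _ => (0, 1)) V x x' ↔
      x.1 = x'.1 ∧ ∀ c ∈ uIcc x.2 x'.2, (x.1, c) ∈ V := by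
  rw [sameLeaf_const_iff]
  constructor
  · rintro ⟨T, rfl, h⟩
    refine ⟨by simp, fun c hc => ?_⟩
    have := h (c - x.2) (by
      simp only [Prod.smul_mk, smul_eq_mul, mul_one, mul_zero, Prod.snd_add] at hc
      rw [mem_uIcc] at hc ⊢
      rcases hc with h | h
      · left; constructor <;> linarith
      · right; constructor <;> linarith)
    convert this using 1
    ext <;> simp
  · rintro ⟨h1, h2⟩
    refine ⟨x'.2 - x.2, by ext <;> simp [h1], fun t ht => ?_⟩
    convert h2 (x.2 + t) _ using 1
    · ext <;> simp
    · rw [mem_uIcc] at ht ⊢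
      rcases ht with h | h
      · left; constructor <;> linarith
      · right; constructor <;> linarith

/-- Leaves of q are level sets of Φ, and Ψ is a monotone parameter on each, because (Φ, Ψ) is
injective. So a leaf segment stays in S exactly when every intermediate value of Ψ is taken in S on
that level. S is an arbitrary subset of the strip, in order to include punctured neighborhoods,
where a leaf through the removed point is cut. -/
theorem sameLeaf_graph_iff {q q' Φ Ψ : ℝ × ℝ → ℝ} {K B : ℝ≥0} (hq : LipschitzWith K q)
    (hB : ∀ z, |q z| ≤ B) (hΦ : IsFlat q Φ) (hΨ : IsFlat q' Ψ)
    (hinj : ∀ z ∈ strip, ∀ z' ∈ strip, Φ z = Φ z' → Ψ z = Ψ z' → z = z')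
    {S : Set (ℝ × ℝ)} (hS : S ⊆ strip) {z z' : ℝ × ℝ} (hz : z ∈ S) (hz' : z' ∈ S) :
    SameLeaf (fun x => (1, q x)) S z z' ↔
      Φ z = Φ z' ∧ ∀ c ∈ uIcc (Ψ z) (Ψ z'), ∃ x ∈ S, Φ x = Φ z ∧ Ψ x = c := by
  obtain ⟨y, hy0, hy⟩ := exists_isSol hq hB (hS hz) z.2
  have hΦz : Φ z = y 0 := by rw [← hΦ.2 y hy z.1 (hS hz), hy0]
  constructor
  · rintro ⟨γ, T, h0, hT, hγ⟩
    have hd1 : ∀ t ∈ uIcc 0 T, HasDerivWithinAt (fun t => (γ t).1) 1 (uIcc 0 T) t :=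
      fun t ht => hasDerivWithinAt_fst (hγ t ht).2
    have hd2 : ∀ t ∈ uIcc 0 T, HasDerivWithinAt (fun t => (γ t).2) (q (γ t)) (uIcc 0 T) t :=
      fun t ht => hasDerivWithinAt_snd (hγ t ht).2
    have h1 : ∀ t ∈ uIcc 0 T, (γ t).1 = z.1 + t := by
      intro t ht
      rw [eq_add_mul_of_hasDerivWithinAt hd1 t ht, h0, mul_one]
    have hs : ∀ t ∈ uIcc 0 T, z.1 + t ∈ Icc (-1 : ℝ) 1 := by
      intro t ht
      rw [← h1 t ht]
      exact hS (hγ t ht).1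
    have hd3 : ∀ t ∈ uIcc 0 T, HasDerivAt (fun t => y (z.1 + t)) (q (z.1 + t, y (z.1 + t))) t := by
      intro t ht
      have := HasDerivAt.comp_const_add z.1 t (hy (z.1 + t) (hs t ht))
      exact this
    -- The field has first component 1, so γ is a graph over time; Grönwall identifies it with `y`,
    -- using derivatives only at interior times.
    have h2 : ∀ t ∈ uIcc 0 T, (γ t).2 = y (z.1 + t) := by
      intro t ht
      have := abs_le_exp_mul_of_abs_deriv_le (d := fun t => (γ t).2 - y (z.1 + t))
        (d' := fun t => q (γ t) - q (z.1 + t, y (z.1 + t))) (K := K) (a := min 0 T)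
        (b := max 0 T) (fun t ht => ((hd2 t ht).continuousWithinAt).sub
          (hd3 t ht).continuousAt.continuousWithinAt)
        (fun t ht => ((hd2 t ⟨ht.1.le, ht.2.le⟩).hasDerivAt (Icc_mem_nhds ht.1 ht.2)).sub
          (hd3 t ⟨ht.1.le, ht.2.le⟩)) (fun t ht => ?_) (left_mem_uIcc (a := (0 : ℝ)) (b := T)) ht
      · simp only [h0, add_zero, hy0, sub_self, abs_zero, mul_zero] at this
        linarith [abs_nonpos_iff.1 this]
      · have e := hq.dist_le_mul (γ t) (z.1 + t, y (z.1 + t))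
        simpa [Real.dist_eq, Prod.dist_eq, h1 t ⟨ht.1.le, ht.2.le⟩] using e
    have hγ' : ∀ t ∈ uIcc 0 T, γ t = (z.1 + t, y (z.1 + t)) := fun t ht =>
      Prod.ext (h1 t ht) (h2 t ht)
    have hΦγ : ∀ t ∈ uIcc 0 T, Φ (γ t) = y 0 := by
      intro t ht
      rw [hγ' t ht]
      exact hΦ.2 y hy _ (hs t ht)
    refine ⟨by rw [← hT, hΦγ T right_mem_uIcc, hΦz], fun c hc => ?_⟩
    have hcont : ContinuousOn (fun t => Ψ (γ t)) (uIcc 0 T) :=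
      hΨ.1.comp (fun t ht => (hγ t ht).2.continuousWithinAt) fun t ht => hS (hγ t ht).1
    rw [← hT, ← h0] at hc
    obtain ⟨t, ht, htc⟩ := intermediate_value_uIcc hcont hc
    exact ⟨γ t, (hγ t ht).1, by rw [hΦγ t ht, hΦz], htc⟩
  · rintro ⟨h1, h2⟩
    have hz1 : z'.2 = y z'.1 := by
      obtain ⟨y', hy0', hy'⟩ := exists_isSol hq hB (hS hz') z'.2
      have e : Φ z' = y' 0 := by rw [← hΦ.2 y' hy' z'.1 (hS hz'), hy0']
      rw [← hy0']
      exact hy'.eqOn hq hy zero_mem_Icc (hS hz') (by rw [← e, ← h1, hΦz])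
    have hsub : uIcc z.1 z'.1 ⊆ Icc (-1) 1 := uIcc_subset_Icc (hS hz) (hS hz')
    have hcont : ContinuousOn (fun t => Ψ (t, y t)) (uIcc z.1 z'.1) :=
      (hΨ.comp_continuousOn hy).mono hsub
    have hinj' : InjOn (fun t => Ψ (t, y t)) (uIcc z.1 z'.1) := by
      intro s hs t ht hst
      have := hinj (s, y s) (hsub hs) (t, y t) (hsub ht)
        (by rw [hΦ.2 y hy s (hsub hs), hΦ.2 y hy t (hsub ht)]) hst
      exact congrArg Prod.fst this
    -- A continuous injective function on an interval is strictly monotone, hence stays between its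
    -- end values.
    have hbetw : ∀ s ∈ uIcc z.1 z'.1, Ψ (s, y s) ∈ uIcc (Ψ z) (Ψ z') := by
      intro s hs
      have ez : Ψ z = Ψ (z.1, y z.1) := by rw [hy0]
      have ez' : Ψ z' = Ψ (z'.1, y z'.1) := by rw [← hz1]
      rw [ez, ez']
      have hmon := ContinuousOn.strictMonoOn_of_injOn_Icc' (min_le_max (a := z.1) (b := z'.1))
        hcont hinj'
      rcases hmon with hm | hm
      · exact hm.monotoneOn.mapsTo_uIcc hs
      · exact hm.antitoneOn.mapsTo_uIcc hs
    have hmem : ∀ s ∈ uIcc z.1 z'.1, (s, y s) ∈ S := by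
      intro s hs
      obtain ⟨x, hx, hx1, hx2⟩ := h2 _ (hbetw s hs)
      have : x = (s, y s) := hinj x (hS hx) _ (hsub hs)
        (by rw [hx1, hΦz, hΦ.2 y hy s (hsub hs)]) hx2
      rwa [← this]
    have hsh : ∀ t ∈ uIcc 0 (z'.1 - z.1), z.1 + t ∈ uIcc z.1 z'.1 := by
      intro t ht
      rw [mem_uIcc] at ht ⊢
      rcases ht with h | h
      · left; constructor <;> linarith
      · right; constructor <;> linarith
    refine ⟨fun t => (z.1 + t, y (z.1 + t)), z'.1 - z.1, ?_, ?_, fun t ht => ⟨hmem _ (hsh t ht), ?_⟩⟩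
    · ext <;> simp [hy0]
    · ext <;> simp [hz1]
    · have e1 : HasDerivAt (fun t => z.1 + t) 1 t := (hasDerivAt_id t).const_add z.1
      exact (e1.prodMk (HasDerivAt.comp_const_add z.1 t
        (hy (z.1 + t) (hsub (hsh t ht))))).hasDerivWithinAt

/-- A continuous injection of a compact set is a closed embedding, so the inverse is continuous on
V. Since V is assumed to be covered, invariance of domain is not needed. -/
theorem exists_homeo_of_compact {f : ℝ × ℝ → ℝ × ℝ} {K O V : Set (ℝ × ℝ)} (hK : IsCompact K)
    (hO : IsOpen O) (hOK : O ⊆ K) (hf : ContinuousOn f K) (hinj : InjOn f K) (hV : IsOpen V)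
    (hsurj : V ⊆ f '' O) : ∃ e : OpenPartialHomeomorph (ℝ × ℝ) (ℝ × ℝ),
      e.source = O ∩ f ⁻¹' V ∧ e.target = V ∧ ∀ z, e z = f z := by
  have hex : ∀ v : ℝ × ℝ, ∃ z, v ∈ V → z ∈ O ∧ f z = v := by
    intro v
    by_cases hv : v ∈ V
    · obtain ⟨z, hz, hzv⟩ := hsurj hv
      exact ⟨z, fun _ => ⟨hz, hzv⟩⟩
    · exact ⟨0, fun h => (hv h).elim⟩
  choose g hg using hex
  have hgc : ContinuousOn g V := by
    have : CompactSpace K := isCompact_iff_compactSpace.1 hK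
    have hF : Topology.IsClosedEmbedding (fun x : K => f x) :=
      Continuous.isClosedEmbedding (continuousOn_iff_continuous_domRestrict.1 hf)
        fun x y hxy => Subtype.ext (hinj x.2 y.2 hxy)
    have hg' : Continuous (fun v : V => (⟨g v, hOK (hg v v.2).1⟩ : K)) := by
      rw [hF.isInducing.continuous_iff]
      have : (fun x : K => f x) ∘ (fun v : V => (⟨g v, hOK (hg v v.2).1⟩ : K)) =
          (Subtype.val : V → ℝ × ℝ) := by
        funext v
        exact (hg v v.2).2
      rw [this]
      exact continuous_subtype_val
    exact continuousOn_iff_continuous_domRestrict.2 (continuous_subtype_val.comp hg')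
  refine ⟨{ toFun := f, invFun := g, source := O ∩ f ⁻¹' V, target := V, map_source' := ?_,
            map_target' := ?_, left_inv' := ?_, right_inv' := ?_, open_source := ?_,
            open_target := hV, continuousOn_toFun := ?_, continuousOn_invFun := hgc }, rfl, rfl,
            fun z => rfl⟩
  · exact fun z hz => hz.2
  · intro v hv
    refine ⟨(hg v hv).1, ?_⟩
    rw [mem_preimage, (hg v hv).2]
    exact hv
  · intro z hz
    exact hinj (hOK (hg _ hz.2).1) (hOK hz.1) (hg _ hz.2).2
  · exact fun v hv => (hg v hv).2
  · exact hf.mono fun z hz => hOK hz.1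
  · exact (hf.mono hOK).isOpen_inter_preimage hO hV

end NetHomeo

/-! ### The straightening homeomorphism for two foliations by graphs. -/

section NetHomeo

open Set Filter Metric
open scoped NNReal

/-- A half axis on which q vanishes is part of a solution. Solutions keep their order, so lying
above it at time z.1 and lying above it at time 0 are equivalent. -/
theorem pos_iff_of_axis_right {q Φ : ℝ × ℝ → ℝ} {K B : ℝ≥0} (hq : LipschitzWith K q)
    (hB : ∀ z, |q z| ≤ B) (hΦ : IsFlat q Φ) (hax : ∀ s ∈ Icc (0 : ℝ) 1, q (s, 0) = 0)
    {z : ℝ × ℝ} (hz : z ∈ strip) (hz0 : 0 ≤ z.1) : 0 < z.2 ↔ 0 < Φ z := by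
  obtain ⟨y, hy0, hy⟩ := exists_isSol hq hB hz z.2
  obtain ⟨y₀, hy₀0, hy₀⟩ := exists_isSol hq hB zero_mem_Icc 0
  have hΦz : Φ z = y 0 := by rw [← hΦ.2 y hy z.1 hz, hy0]
  have hzero : y₀ z.1 = 0 := by
    have := IsSol.abs_sub_le (y := y₀) (y' := fun _ => 0) (a := 0) (b := 1) (s := 0) (t := z.1) hq
      (hy₀.continuousOn.mono (Icc_subset_Icc (by norm_num) le_rfl)) continuousOn_const
      (fun t ht => hy₀ t ⟨by linarith [ht.1], ht.2.le⟩)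
      (fun t ht => by rw [hax t ⟨ht.1.le, ht.2.le⟩]; exact hasDerivAt_const _ _)
      ⟨le_rfl, zero_le_one⟩ ⟨hz0, hz.2⟩
    simp only [hy₀0, sub_zero, abs_zero, mul_zero] at this
    exact abs_nonpos_iff.1 this
  rw [hΦz]
  constructor
  · intro h
    have := hy₀.lt_of_lt hq hy hz zero_mem_Icc (by rw [hzero, hy0]; exact h)
    rwa [hy₀0] at this
  · intro h
    have := hy₀.lt_of_lt hq hy zero_mem_Icc hz (by rw [hy₀0]; exact h)
    rwa [hzero, hy0] at this

theorem pos_iff_of_axis_left {q Φ : ℝ × ℝ → ℝ} {K B : ℝ≥0} (hq : LipschitzWith K q)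
    (hB : ∀ z, |q z| ≤ B) (hΦ : IsFlat q Φ) (hax : ∀ s ∈ Icc (-1 : ℝ) 0, q (s, 0) = 0)
    {z : ℝ × ℝ} (hz : z ∈ strip) (hz0 : z.1 ≤ 0) : 0 < z.2 ↔ 0 < Φ z := by
  obtain ⟨y, hy0, hy⟩ := exists_isSol hq hB hz z.2
  obtain ⟨y₀, hy₀0, hy₀⟩ := exists_isSol hq hB zero_mem_Icc 0
  have hΦz : Φ z = y 0 := by rw [← hΦ.2 y hy z.1 hz, hy0]
  have hzero : y₀ z.1 = 0 := by
    have := IsSol.abs_sub_le (y := y₀) (y' := fun _ => 0) (a := -1) (b := 0) (s := 0) (t := z.1) hq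
      (hy₀.continuousOn.mono (Icc_subset_Icc le_rfl (by norm_num))) continuousOn_const
      (fun t ht => hy₀ t ⟨ht.1.le, by linarith [ht.2]⟩)
      (fun t ht => by rw [hax t ⟨ht.1.le, ht.2.le⟩]; exact hasDerivAt_const _ _)
      ⟨by norm_num, le_rfl⟩ ⟨hz.1, hz0⟩
    simp only [hy₀0, sub_zero, abs_zero, mul_zero] at this
    exact abs_nonpos_iff.1 this
  rw [hΦz]
  constructor
  · intro h
    have := hy₀.lt_of_lt hq hy hz zero_mem_Icc (by rw [hzero, hy0]; exact h)
    rwa [hy₀0] at this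
  · intro h
    have := hy₀.lt_of_lt hq hy zero_mem_Icc hz (by rw [hy₀0]; exact h)
    rwa [hzero, hy0] at this

/-- The data of a homeomorphism that straightens the foliations by graphs with slopes `q₁`
(to vertical lines) and `q₂` (to horizontal lines). -/
structure StraightensGraphs (q₁ q₂ : ℝ × ℝ → ℝ) (U : Set (ℝ × ℝ)) (ρ : ℝ)
    (e : OpenPartialHomeomorph (ℝ × ℝ) (ℝ × ℝ)) : Prop where
  zero_mem : (0 : ℝ × ℝ) ∈ e.source
  subset : e.source ⊆ U
  map_zero : e 0 = 0
  leaf₁ : ∀ S ⊆ e.source, ∀ z ∈ S, ∀ z' ∈ S, SameLeaf (fun x => (1, q₁ x)) S z z' ↔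
    SameLeaf (fun _ => (0, 1)) (e '' S) (e z) (e z')
  leaf₂ : ∀ S ⊆ e.source, ∀ z ∈ S, ∀ z' ∈ S, SameLeaf (fun x => (1, q₂ x)) S z z' ↔
    SameLeaf (fun _ => (1, 0)) (e '' S) (e z) (e z')
  order_right : ∀ z ∈ e.source, 0 ≤ z.1 → (e z).2 ≤ (e z).1
  order_left : ∀ z ∈ e.source, z.1 ≤ 0 → (e z).1 ≤ (e z).2
  axis_right₁ : (∀ s ∈ Icc 0 ρ, q₁ (s, 0) = 0) →
    ∀ z ∈ e.source, 0 ≤ z.1 → (0 < z.2 ↔ 0 < (e z).1)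
  axis_left₁ : (∀ s ∈ Icc (-ρ) 0, q₁ (s, 0) = 0) →
    ∀ z ∈ e.source, z.1 ≤ 0 → (0 < z.2 ↔ 0 < (e z).1)
  axis_right₂ : (∀ s ∈ Icc 0 ρ, q₂ (s, 0) = 0) →
    ∀ z ∈ e.source, 0 ≤ z.1 → (0 < z.2 ↔ 0 < (e z).2)
  axis_left₂ : (∀ s ∈ Icc (-ρ) 0, q₂ (s, 0) = 0) →
    ∀ z ∈ e.source, z.1 ≤ 0 → (0 < z.2 ↔ 0 < (e z).2)

/-- The homeomorphism is (Φ₁, Φ₂). Two points with the same image lie on the same pair of solutions,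
which by `IsSol.cross` meet only once. The pair of heights (v₁, v₂) is attained because the
corresponding solutions, close to those through the origin, still exchange their order across a
small interval. -/
theorem exists_straightensGraphs_of_lipschitzWith {q₁ q₂ : ℝ × ℝ → ℝ} {K B : ℝ≥0}
    (hq₁ : LipschitzWith K q₁) (hq₂ : LipschitzWith K q₂) (hB₁ : ∀ z, |q₁ z| ≤ B)
    (hB₂ : ∀ z, |q₂ z| ≤ B) (hlt : ∀ z, z ≠ 0 → q₁ z < q₂ z) (hle : ∀ z, q₁ z ≤ q₂ z)
    {U : Set (ℝ × ℝ)} (hU : U ∈ 𝓝 0) : ∃ e, StraightensGraphs q₁ q₂ U 1 e := by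
  obtain ⟨Φ₁, hΦ₁⟩ := exists_isFlat hq₁ hB₁
  obtain ⟨Φ₂, hΦ₂⟩ := exists_isFlat hq₂ hB₂
  have hinj : ∀ z ∈ strip, ∀ z' ∈ strip, Φ₁ z = Φ₁ z' → Φ₂ z = Φ₂ z' → z = z' := by
    have aux : ∀ z ∈ strip, ∀ z' ∈ strip, Φ₁ z = Φ₁ z' → Φ₂ z = Φ₂ z' → ¬ z.1 < z'.1 := by
      intro z hz z' hz' h1 h2 hlt'
      obtain ⟨y₁, e₁, s₁⟩ := exists_isSol hq₁ hB₁ hz z.2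
      obtain ⟨y₂, e₂, s₂⟩ := exists_isSol hq₂ hB₂ hz z.2
      obtain ⟨y₁', e₁', s₁'⟩ := exists_isSol hq₁ hB₁ hz' z'.2
      obtain ⟨y₂', e₂', s₂'⟩ := exists_isSol hq₂ hB₂ hz' z'.2
      have a₁ : y₁ 0 = y₁' 0 := by
        rw [← hΦ₁.2 y₁ s₁ z.1 hz, ← hΦ₁.2 y₁' s₁' z'.1 hz', e₁, e₁']; exact h1
      have a₂ : y₂ 0 = y₂' 0 := by
        rw [← hΦ₂.2 y₂ s₂ z.1 hz, ← hΦ₂.2 y₂' s₂' z'.1 hz', e₂, e₂']; exact h2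
      have b₁ := s₁.eqOn hq₁ s₁' zero_mem_Icc hz' a₁
      have b₂ := s₂.eqOn hq₂ s₂' zero_mem_Icc hz' a₂
      have := (IsSol.cross hq₂ hlt hle s₁ s₂ hz hz' hlt').1 (by rw [e₁, e₂])
      rw [b₁, b₂, e₁', e₂'] at this
      exact lt_irrefl _ this
    intro z hz z' hz' h1 h2
    have h : z.1 = z'.1 := le_antisymm (not_lt.1 (aux z' hz' z hz h1.symm h2.symm))
      (not_lt.1 (aux z hz z' hz' h1 h2))
    obtain ⟨y₁, e₁, s₁⟩ := exists_isSol hq₁ hB₁ hz z.2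
    obtain ⟨y₁', e₁', s₁'⟩ := exists_isSol hq₁ hB₁ hz' z'.2
    have a₁ : y₁ 0 = y₁' 0 := by
      rw [← hΦ₁.2 y₁ s₁ z.1 hz, ← hΦ₁.2 y₁' s₁' z'.1 hz', e₁, e₁']; exact h1
    refine Prod.ext h ?_
    rw [← e₁, ← e₁', ← h]
    exact s₁.eqOn hq₁ s₁' zero_mem_Icc hz a₁
  obtain ⟨r₀, hr₀, hr₀U⟩ := Metric.mem_nhds_iff.1 hU
  obtain ⟨r, hr, hr1, hrr₀⟩ : ∃ r, 0 < r ∧ r ≤ 1 ∧ r ≤ r₀ :=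
    ⟨min 1 r₀, lt_min one_pos hr₀, min_le_left _ _, min_le_right _ _⟩
  -- On the time interval [-r', r'] a solution, of slope at most B, climbs at most r / 2, so it
  -- stays in the box.
  obtain ⟨r', hr', hr'r, hBr'⟩ : ∃ r', 0 < r' ∧ r' ≤ r ∧ B * r' ≤ r / 2 := by
    have hB1 : (0 : ℝ) < B + 1 := by positivity
    refine ⟨min r (r / 2 / (B + 1)), lt_min hr (by positivity), min_le_left _ _, ?_⟩
    calc (B : ℝ) * min r (r / 2 / (B + 1)) ≤ (B + 1) * (r / 2 / (B + 1)) :=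
          mul_le_mul (by linarith) (min_le_right _ _) (lt_min hr (by positivity)).le hB1.le
      _ = r / 2 := by field_simp
  have hr'1 : r' ≤ 1 := hr'r.trans hr1
  have hr'm : r' ∈ Icc (-1 : ℝ) 1 := ⟨by linarith, hr'1⟩
  have hr'm' : -r' ∈ Icc (-1 : ℝ) 1 := ⟨by linarith, by linarith⟩
  set f : ℝ × ℝ → ℝ × ℝ := fun z => (Φ₁ z, Φ₂ z) with hfdef
  set Kb : Set (ℝ × ℝ) := Icc (-r') r' ×ˢ Icc (-r) r with hKb
  set O : Set (ℝ × ℝ) := Ioo (-r') r' ×ˢ Ioo (-r) r with hOdef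
  have hKbs : Kb ⊆ strip := fun z hz => ⟨by linarith [hz.1.1], by linarith [hz.1.2]⟩
  have hOK : O ⊆ Kb := prod_mono Ioo_subset_Icc_self Ioo_subset_Icc_self
  have hO : IsOpen O := isOpen_Ioo.prod isOpen_Ioo
  obtain ⟨y₁, e₁, s₁⟩ := exists_isSol hq₁ hB₁ zero_mem_Icc 0
  obtain ⟨y₂, e₂, s₂⟩ := exists_isSol hq₂ hB₂ zero_mem_Icc 0
  have g₁ := (IsSol.cross hq₂ hlt hle s₁ s₂ zero_mem_Icc hr'm hr').1 (by rw [e₁, e₂])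
  have g₂ := (IsSol.cross hq₂ hlt hle s₁ s₂ hr'm' zero_mem_Icc (by linarith)).2 (by rw [e₁, e₂])
  -- A change of initial height below δ moves each solution by less than e^K δ. Two such changes do
  -- not close the gap at ±r' between the solutions through the origin, so the change of sign
  -- persists.
  obtain ⟨δ, hδ, hδr, hδ1, hδ2⟩ : ∃ δ, 0 < δ ∧ δ ≤ r / 2 ∧
      2 * (Real.exp K * δ) ≤ y₂ r' - y₁ r' ∧ 2 * (Real.exp K * δ) ≤ y₁ (-r') - y₂ (-r') := by
    set g := min (y₂ r' - y₁ r') (y₁ (-r') - y₂ (-r')) with hg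
    have hg0 : 0 < g := lt_min (by linarith) (by linarith)
    have hE := Real.exp_pos (K : ℝ)
    have h3 : 2 * (Real.exp K * min (r / 2) (g / 2 / Real.exp K)) ≤ g := by
      calc 2 * (Real.exp K * min (r / 2) (g / 2 / Real.exp K))
          ≤ 2 * (Real.exp K * (g / 2 / Real.exp K)) := by
            gcongr
            exact min_le_right _ _
        _ = g := by field_simp
    exact ⟨min (r / 2) (g / 2 / Real.exp K), lt_min (by positivity) (by positivity),
      min_le_left _ _, h3.trans (min_le_left _ _), h3.trans (min_le_right _ _)⟩
  set V : Set (ℝ × ℝ) := Ioo (-δ) δ ×ˢ Ioo (-δ) δ with hVdef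
  have hV : IsOpen V := isOpen_Ioo.prod isOpen_Ioo
  have hexp : ∀ t ∈ Icc (-1 : ℝ) 1, Real.exp (K * |t - 0|) ≤ Real.exp K := by
    intro t ht
    apply Real.exp_le_exp.2
    have : |t - 0| ≤ 1 := by rw [sub_zero]; exact abs_le.2 ht
    nlinarith [K.2, mul_le_mul_of_nonneg_left this K.2]
  have hsurj : V ⊆ f '' O := by
    intro v hv
    obtain ⟨x₁, c₁, t₁⟩ := exists_isSol hq₁ hB₁ zero_mem_Icc v.1
    obtain ⟨x₂, c₂, t₂⟩ := exists_isSol hq₂ hB₂ zero_mem_Icc v.2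
    have hv1 : |v.1| < δ := abs_lt.2 hv.1
    have hv2 : |v.2| < δ := abs_lt.2 hv.2
    have n₁ : ∀ t ∈ Icc (-1 : ℝ) 1, |x₁ t - y₁ t| < Real.exp K * δ := by
      intro t ht
      refine (t₁.dist_bound hq₁ s₁ zero_mem_Icc ht).trans_lt ?_
      rw [c₁, e₁, sub_zero v.1]
      exact mul_lt_mul' (hexp t ht) hv1 (abs_nonneg _) (Real.exp_pos _)
    have n₂ : ∀ t ∈ Icc (-1 : ℝ) 1, |x₂ t - y₂ t| < Real.exp K * δ := by
      intro t ht
      refine (t₂.dist_bound hq₂ s₂ zero_mem_Icc ht).trans_lt ?_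
      rw [c₂, e₂, sub_zero v.2]
      exact mul_lt_mul' (hexp t ht) hv2 (abs_nonneg _) (Real.exp_pos _)
    have m₁ : x₁ r' - x₂ r' < 0 := by
      have a := abs_lt.1 (n₁ r' hr'm)
      have b := abs_lt.1 (n₂ r' hr'm)
      linarith [a.2, b.1]
    have m₂ : 0 < x₁ (-r') - x₂ (-r') := by
      have a := abs_lt.1 (n₁ (-r') hr'm')
      have b := abs_lt.1 (n₂ (-r') hr'm')
      linarith [a.1, b.2]
    have hsub : Icc (-r') r' ⊆ Icc (-1 : ℝ) 1 := Icc_subset_Icc hr'm'.1 hr'1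
    have hc : ContinuousOn (fun t => x₁ t - x₂ t) (Icc (-r') r') :=
      (t₁.continuousOn.sub t₂.continuousOn).mono hsub
    obtain ⟨u, hu, hu0⟩ := intermediate_value_Ioo' (by linarith) hc ⟨m₁, m₂⟩
    have hu' : u ∈ Icc (-1 : ℝ) 1 := hsub (Ioo_subset_Icc_self hu)
    refine ⟨(u, x₁ u), ⟨hu, ?_⟩, ?_⟩
    · have hb := t₁.abs_sub_le_mul hB₁ zero_mem_Icc hu'
      rw [c₁, sub_zero] at hb
      have hb2 : (B : ℝ) * |u| ≤ B * r' :=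
        mul_le_mul_of_nonneg_left (abs_lt.2 hu).le B.2
      have hb3 := abs_le.1 (hb.trans (hb2.trans hBr'))
      have hb4 := abs_lt.1 hv1
      exact ⟨by simp only; linarith [hb3.1, hb4.1], by simp only; linarith [hb3.2, hb4.2]⟩
    · refine Prod.ext ?_ ?_
      · simp only [hfdef]
        rw [hΦ₁.2 x₁ t₁ u hu', c₁]
      · simp only [hfdef]
        rw [show x₁ u = x₂ u by simp only at hu0; linarith, hΦ₂.2 x₂ t₂ u hu', c₂]
  have hfc : ContinuousOn f Kb := (hΦ₁.1.prodMk hΦ₂.1).mono hKbs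
  have hfi : InjOn f Kb := fun z hz z' hz' h =>
    hinj z (hKbs hz) z' (hKbs hz') (congrArg Prod.fst h) (congrArg Prod.snd h)
  obtain ⟨e, hes, -, hef⟩ := exists_homeo_of_compact (isCompact_Icc.prod isCompact_Icc) hO hOK
    hfc hfi hV hsurj
  have hsO : e.source ⊆ O := by rw [hes]; exact inter_subset_left
  have hss : e.source ⊆ strip := hsO.trans (hOK.trans hKbs)
  have hf0 : f 0 = 0 := by
    have h1 := hΦ₁.2 y₁ s₁ 0 zero_mem_Icc
    have h2 := hΦ₂.2 y₂ s₂ 0 zero_mem_Icc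
    rw [e₁] at h1
    rw [e₂] at h2
    exact Prod.ext h1 h2
  -- The two solutions through z cross at time z.1, and `IsSol.cross` orders their heights at time
  -- 0.
  have hord : ∀ z ∈ strip, (0 < z.1 → Φ₂ z < Φ₁ z) ∧ (z.1 < 0 → Φ₁ z < Φ₂ z) ∧
      (z.1 = 0 → Φ₁ z = Φ₂ z) := by
    intro z hz
    obtain ⟨x₁, c₁, t₁⟩ := exists_isSol hq₁ hB₁ hz z.2
    obtain ⟨x₂, c₂, t₂⟩ := exists_isSol hq₂ hB₂ hz z.2
    have a₁ : Φ₁ z = x₁ 0 := by rw [← hΦ₁.2 x₁ t₁ z.1 hz, c₁]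
    have a₂ : Φ₂ z = x₂ 0 := by rw [← hΦ₂.2 x₂ t₂ z.1 hz, c₂]
    rw [a₁, a₂]
    refine ⟨fun h => ?_, fun h => ?_, fun h => ?_⟩
    · exact (IsSol.cross hq₂ hlt hle t₁ t₂ zero_mem_Icc hz h).2 (by rw [c₁, c₂])
    · exact (IsSol.cross hq₂ hlt hle t₁ t₂ hz zero_mem_Icc h).1 (by rw [c₁, c₂])
    · rw [← h, c₁, c₂]
  refine ⟨e, ?_, ?_, by rw [hef, hf0], ?_, ?_, ?_, ?_, ?_, ?_, ?_, ?_⟩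
  · rw [hes]
    refine ⟨⟨⟨by simpa using hr', hr'⟩, ⟨by simpa using hr, hr⟩⟩, ?_⟩
    rw [mem_preimage, hf0]
    exact ⟨⟨by simpa using hδ, hδ⟩, ⟨by simpa using hδ, hδ⟩⟩
  · intro z hz
    apply hr₀U
    have := hsO hz
    rw [mem_ball_zero_iff, Prod.norm_def]
    exact max_lt (abs_lt.2 ⟨by linarith [this.1.1], by linarith [this.1.2]⟩)
      (abs_lt.2 ⟨by linarith [this.2.1], by linarith [this.2.2]⟩)
  · intro S hS z hz z' hz'
    rw [sameLeaf_graph_iff hq₁ hB₁ hΦ₁ hΦ₂ hinj (hS.trans hss) hz hz', sameLeaf_vertical_iff]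
    simp only [hef, hfdef, mem_image, Prod.ext_iff]
  · intro S hS z hz z' hz'
    rw [sameLeaf_graph_iff hq₂ hB₂ hΦ₂ hΦ₁ (fun z hz z' hz' h h' => hinj z hz z' hz' h' h)
      (hS.trans hss) hz hz', sameLeaf_horizontal_iff]
    simp only [hef, hfdef, mem_image, Prod.ext_iff, and_comm]
  · intro z hz h
    rw [hef]
    rcases h.lt_or_eq with h | h
    · exact ((hord z (hss hz)).1 h).le
    · exact ((hord z (hss hz)).2.2 h.symm).ge
  · intro z hz h
    rw [hef]
    rcases h.lt_or_eq with h | h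
    · exact ((hord z (hss hz)).2.1 h).le
    · exact ((hord z (hss hz)).2.2 h).le
  · intro h z hz h0
    rw [hef]
    exact pos_iff_of_axis_right hq₁ hB₁ hΦ₁ h (hss hz) h0
  · intro h z hz h0
    rw [hef]
    exact pos_iff_of_axis_left hq₁ hB₁ hΦ₁ h (hss hz) h0
  · intro h z hz h0
    rw [hef]
    exact pos_iff_of_axis_right hq₂ hB₂ hΦ₂ h (hss hz) h0
  · intro h z hz h0
    rw [hef]
    exact pos_iff_of_axis_left hq₂ hB₂ hΦ₂ h (hss hz) h0

theorem SameLeaf.congr {l l' : ℝ × ℝ → ℝ × ℝ} {S : Set (ℝ × ℝ)} (h : ∀ z ∈ S, l z = l' z)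
    {z z' : ℝ × ℝ} (hl : SameLeaf l S z z') : SameLeaf l' S z z' := by
  obtain ⟨γ, T, h0, hT, hγ⟩ := hl
  exact ⟨γ, T, h0, hT, fun t ht => ⟨(hγ t ht).1, by rw [← h _ (hγ t ht).1]; exact (hγ t ht).2⟩⟩

theorem sameLeaf_congr {l l' : ℝ × ℝ → ℝ × ℝ} {S : Set (ℝ × ℝ)} (h : ∀ z ∈ S, l z = l' z)
    {z z' : ℝ × ℝ} : SameLeaf l S z z' ↔ SameLeaf l' S z z' :=
  ⟨SameLeaf.congr h, SameLeaf.congr fun z hz => (h z hz).symm⟩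

/-- The retraction of the plane to a square. -/
def clampSquare (ρ : ℝ) (z : ℝ × ℝ) : ℝ × ℝ := (max (-ρ) (min ρ z.1), max (-ρ) (min ρ z.2))

theorem lipschitzWith_clampSquare (ρ : ℝ) : LipschitzWith 1 (clampSquare ρ) := by
  have h1 : LipschitzWith 1 (fun x : ℝ => max (-ρ) (min ρ x)) :=
    (LipschitzWith.id.const_min ρ).const_max (-ρ)
  have := (h1.comp LipschitzWith.prod_fst).prodMk (h1.comp LipschitzWith.prod_snd)
  rwa [mul_one, max_self] at this

theorem clampSquare_mem {ρ : ℝ} (hρ : 0 ≤ ρ) (z : ℝ × ℝ) :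
    clampSquare ρ z ∈ closedBall (0 : ℝ × ℝ) ρ := by
  have h : ∀ x : ℝ, |max (-ρ) (min ρ x)| ≤ ρ := fun x =>
    abs_le.2 ⟨le_max_left _ _, max_le (by linarith) (min_le_left _ _)⟩
  rw [mem_closedBall_zero_iff, Prod.norm_def]
  exact max_le (h _) (h _)

theorem clampSquare_eq {ρ : ℝ} {z : ℝ × ℝ} (hz : z ∈ closedBall (0 : ℝ × ℝ) ρ) :
    clampSquare ρ z = z := by
  rw [mem_closedBall_zero_iff, Prod.norm_def, max_le_iff] at hz
  have h1 := abs_le.1 hz.1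
  have h2 := abs_le.1 hz.2
  exact Prod.ext (by simp [clampSquare, h1.1, h1.2]) (by simp [clampSquare, h2.1, h2.2])

theorem clampSquare_ne_zero {ρ : ℝ} (hρ : 0 < ρ) {z : ℝ × ℝ} (hz : z ≠ 0) :
    clampSquare ρ z ≠ 0 := by
  have h : ∀ x : ℝ, max (-ρ) (min ρ x) = 0 → x = 0 := by
    intro x hx
    rcases le_total (-ρ) (min ρ x) with h1 | h1
    · rw [max_eq_right h1] at hx
      rcases le_total ρ x with h2 | h2
      · rw [min_eq_left h2] at hx; linarith
      · rwa [min_eq_right h2] at hx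
    · rw [max_eq_left h1] at hx; linarith
  intro h0
  exact hz (Prod.ext (h _ (congrArg Prod.fst h0)) (h _ (congrArg Prod.snd h0)))

/-- Two foliations by graphs with Lipschitz slopes `q₁ ≤ q₂`, transversal off the origin, are
simultaneously straightened by a homeomorphism. -/
theorem exists_straightensGraphs {q₁ q₂ : ℝ × ℝ → ℝ} {K : ℝ≥0} {ρ : ℝ} (hρ : 0 < ρ)
    (hq₁ : LipschitzOnWith K q₁ (closedBall 0 ρ)) (hq₂ : LipschitzOnWith K q₂ (closedBall 0 ρ))
    (hlt : ∀ z ∈ closedBall 0 ρ, z ≠ 0 → q₁ z < q₂ z) (h0 : q₁ 0 ≤ q₂ 0)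
    {U : Set (ℝ × ℝ)} (hU : U ∈ 𝓝 0) : ∃ e, StraightensGraphs q₁ q₂ U ρ e := by
  have hlip : ∀ q : ℝ × ℝ → ℝ, LipschitzOnWith K q (closedBall 0 ρ) →
      LipschitzWith K (q ∘ clampSquare ρ) := by
    intro q hq
    have := hq.comp ((lipschitzWith_clampSquare ρ).lipschitzOnWith (s := univ))
      (fun z _ => clampSquare_mem hρ.le z)
    rwa [mul_one, lipschitzOnWith_univ] at this
  have hbd : ∀ q : ℝ × ℝ → ℝ, LipschitzOnWith K q (closedBall 0 ρ) →
      ∀ z, |(q ∘ clampSquare ρ) z| ≤ |q 0| + K * ρ := by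
    intro q hq z
    have h1 := hq.dist_le_mul _ (clampSquare_mem hρ.le z) _ (mem_closedBall_self hρ.le)
    have h2 : dist (clampSquare ρ z) 0 ≤ ρ := clampSquare_mem hρ.le z
    rw [Real.dist_eq] at h1
    have h3 := abs_sub_abs_le_abs_sub (q (clampSquare ρ z)) (q 0)
    have h4 := mul_le_mul_of_nonneg_left h2 K.2
    simp only [Function.comp_apply]
    simp only [NNReal.val_eq_coe] at h4
    linarith
  have hle : ∀ z ∈ closedBall 0 ρ, q₁ z ≤ q₂ z := by
    intro z hz
    rcases eq_or_ne z 0 with rfl | h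
    · exact h0
    · exact (hlt z hz h).le
  -- Composition with the retraction makes the slopes globally Lipschitz and bounded and changes
  -- nothing on the source. Only 0 is retracted to 0, so strict inequality off the origin survives.
  obtain ⟨e, he⟩ := exists_straightensGraphs_of_lipschitzWith (B := Real.toNNReal
    (max (|q₁ 0| + K * ρ) (|q₂ 0| + K * ρ))) (hlip q₁ hq₁) (hlip q₂ hq₂)
    (fun z => (hbd q₁ hq₁ z).trans ((le_max_left _ _).trans (Real.le_coe_toNNReal _)))
    (fun z => (hbd q₂ hq₂ z).trans ((le_max_right _ _).trans (Real.le_coe_toNNReal _)))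
    (fun z hz => hlt _ (clampSquare_mem hρ.le z) (clampSquare_ne_zero hρ hz))
    (fun z => hle _ (clampSquare_mem hρ.le z))
    (inter_mem hU (closedBall_mem_nhds 0 hρ))
  have heq : ∀ (q : ℝ × ℝ → ℝ), ∀ z ∈ e.source, (q ∘ clampSquare ρ) z = q z := by
    intro q z hz
    rw [Function.comp_apply, clampSquare_eq (he.subset hz).2]
  have hright : ∀ q : ℝ × ℝ → ℝ, (∀ s ∈ Icc 0 ρ, q (s, 0) = 0) →
      ∀ s ∈ Icc (0 : ℝ) 1, (q ∘ clampSquare ρ) (s, 0) = 0 := by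
    intro q hq s hs
    have : clampSquare ρ (s, 0) = (min ρ s, 0) := by
      have h1 : 0 ≤ min ρ s := le_min hρ.le hs.1
      refine Prod.ext (max_eq_right (by linarith)) ?_
      simp [clampSquare, hρ.le]
    rw [Function.comp_apply, this]
    exact hq _ ⟨le_min hρ.le hs.1, min_le_left _ _⟩
  have hleft : ∀ q : ℝ × ℝ → ℝ, (∀ s ∈ Icc (-ρ) 0, q (s, 0) = 0) →
      ∀ s ∈ Icc (-1 : ℝ) 0, (q ∘ clampSquare ρ) (s, 0) = 0 := by
    intro q hq s hs
    have : clampSquare ρ (s, 0) = (max (-ρ) s, 0) := by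
      refine Prod.ext ?_ ?_
      · simp only [clampSquare]
        rw [min_eq_right (by linarith [hs.2])]
      · simp [clampSquare, hρ.le]
    rw [Function.comp_apply, this]
    exact hq _ ⟨le_max_left _ _, max_le (by linarith) hs.2⟩
  refine ⟨e, he.zero_mem, fun z hz => (he.subset hz).1, he.map_zero, ?_, ?_, he.order_right,
    he.order_left, fun h => he.axis_right₁ (hright q₁ h), fun h => he.axis_left₁ (hleft q₁ h),
    fun h => he.axis_right₂ (hright q₂ h), fun h => he.axis_left₂ (hleft q₂ h)⟩
  · intro S hS z hz z' hz'
    rw [← he.leaf₁ S hS z hz z' hz']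
    exact sameLeaf_congr fun x hx => by rw [heq q₁ x (hS hx)]
  · intro S hS z hz z' hz'
    rw [← he.leaf₂ S hS z hz z' hz']
    exact sameLeaf_congr fun x hx => by rw [heq q₂ x (hS hx)]

end NetHomeo

/-! ### From graphs to vector fields: shear, exchange of axes, net patterns. -/

section Transport

open Set Filter Metric
open scoped NNReal

theorem SameLeaf.map {l l' : ℝ × ℝ → ℝ × ℝ} (T : (ℝ × ℝ) →L[ℝ] (ℝ × ℝ)) {S : Set (ℝ × ℝ)}
    (hl : ∀ z ∈ S, T (l z) = l' (T z)) {z z' : ℝ × ℝ} (h : SameLeaf l S z z') :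
    SameLeaf l' (T '' S) (T z) (T z') := by
  obtain ⟨γ, t₁, h0, hT, hγ⟩ := h
  refine ⟨fun t => T (γ t), t₁, congrArg T h0, congrArg T hT, fun t ht =>
    ⟨mem_image_of_mem T (hγ t ht).1, ?_⟩⟩
  rw [← hl _ (hγ t ht).1]
  exact T.hasFDerivAt.comp_hasDerivWithinAt t (hγ t ht).2

theorem sameLeaf_map_iff {l l' : ℝ × ℝ → ℝ × ℝ} (T : (ℝ × ℝ) ≃L[ℝ] (ℝ × ℝ)) {S : Set (ℝ × ℝ)}
    (hl : ∀ z ∈ S, T (l z) = l' (T z)) {z z' : ℝ × ℝ} :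
    SameLeaf l S z z' ↔ SameLeaf l' (T '' S) (T z) (T z') := by
  refine ⟨fun h => SameLeaf.map (T : (ℝ × ℝ) →L[ℝ] (ℝ × ℝ)) hl h, fun h => ?_⟩
  have := SameLeaf.map (l := l') (l' := l) (T.symm : (ℝ × ℝ) →L[ℝ] (ℝ × ℝ)) (S := T '' S) ?_ h
  · have hi : (T.symm : (ℝ × ℝ) →L[ℝ] (ℝ × ℝ)) '' (T '' S) = S := by
      rw [image_image]; simp
    rw [hi] at this
    simpa using this
  · rintro _ ⟨x, hx, rfl⟩
    simp [← hl x hx]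

/-- The shear `(u, w) ↦ (u + c w, w)`. -/
def shear (c : ℝ) : (ℝ × ℝ) ≃L[ℝ] (ℝ × ℝ) :=
  ContinuousLinearEquiv.equivOfInverse
    ((ContinuousLinearMap.fst ℝ ℝ ℝ + c • ContinuousLinearMap.snd ℝ ℝ ℝ).prod
      (ContinuousLinearMap.snd ℝ ℝ ℝ))
    ((ContinuousLinearMap.fst ℝ ℝ ℝ - c • ContinuousLinearMap.snd ℝ ℝ ℝ).prod
      (ContinuousLinearMap.snd ℝ ℝ ℝ))
    (fun z => by ext <;> simp) (fun z => by ext <;> simp)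

@[simp] theorem shear_apply (c : ℝ) (z : ℝ × ℝ) : shear c z = (z.1 + c * z.2, z.2) := rfl

@[simp] theorem shear_symm_apply (c : ℝ) (z : ℝ × ℝ) :
    (shear c).symm z = (z.1 - c * z.2, z.2) := rfl

/-- The data of a homeomorphism that straightens the foliations generated by `m₁`
(to vertical lines) and `m₂` (to horizontal lines); `u + c w` is a time for both fields. -/
structure Straightens (m₁ m₂ : ℝ × ℝ → ℝ × ℝ) (U : Set (ℝ × ℝ)) (c : ℝ)
    (e : OpenPartialHomeomorph (ℝ × ℝ) (ℝ × ℝ)) : Prop where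
  zero_mem : (0 : ℝ × ℝ) ∈ e.source
  subset : e.source ⊆ U
  map_zero : e 0 = 0
  leaf₁ : ∀ S ⊆ e.source, ∀ z ∈ S, ∀ z' ∈ S, SameLeaf m₁ S z z' ↔
    SameLeaf (fun _ => (0, 1)) (e '' S) (e z) (e z')
  leaf₂ : ∀ S ⊆ e.source, ∀ z ∈ S, ∀ z' ∈ S, SameLeaf m₂ S z z' ↔
    SameLeaf (fun _ => (1, 0)) (e '' S) (e z) (e z')
  order_right : ∀ z ∈ e.source, 0 ≤ z.1 + c * z.2 → (e z).2 ≤ (e z).1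
  order_left : ∀ z ∈ e.source, z.1 + c * z.2 ≤ 0 → (e z).1 ≤ (e z).2
  axis_right₁ : (∀ s, 0 ≤ s → (s, 0) ∈ U → (m₁ (s, 0)).2 = 0) →
    ∀ z ∈ e.source, 0 ≤ z.1 + c * z.2 → (0 < z.2 ↔ 0 < (e z).1)
  axis_left₁ : (∀ s ≤ 0, (s, 0) ∈ U → (m₁ (s, 0)).2 = 0) →
    ∀ z ∈ e.source, z.1 + c * z.2 ≤ 0 → (0 < z.2 ↔ 0 < (e z).1)
  axis_right₂ : (∀ s, 0 ≤ s → (s, 0) ∈ U → (m₂ (s, 0)).2 = 0) →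
    ∀ z ∈ e.source, 0 ≤ z.1 + c * z.2 → (0 < z.2 ↔ 0 < (e z).2)
  axis_left₂ : (∀ s ≤ 0, (s, 0) ∈ U → (m₂ (s, 0)).2 = 0) →
    ∀ z ∈ e.source, z.1 + c * z.2 ≤ 0 → (0 < z.2 ↔ 0 < (e z).2)

/-- In the coordinates (u + c w, w) the normalization makes each field (1, q), with q its second
component. The freedom in c serves the biregular case, where a solution direction may be parallel to
the w-axis. The shear preserves w and fixes the axis w = 0 pointwise, so the statements on signs and
half axes carry over. -/
theorem exists_straightens {m₁ m₂ : ℝ × ℝ → ℝ × ℝ} {U : Set (ℝ × ℝ)} (hU : U ∈ 𝓝 0) {c : ℝ}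
    (hm₁ : ∀ z ∈ U, (m₁ z).1 + c * (m₁ z).2 = 1) (hm₂ : ∀ z ∈ U, (m₂ z).1 + c * (m₂ z).2 = 1)
    (hL₁ : ∃ K, ∃ t ∈ 𝓝 (0 : ℝ × ℝ), LipschitzOnWith K (fun z => (m₁ z).2) t)
    (hL₂ : ∃ K, ∃ t ∈ 𝓝 (0 : ℝ × ℝ), LipschitzOnWith K (fun z => (m₂ z).2) t)
    (hlt : ∀ z ∈ U, z ≠ 0 → (m₁ z).2 < (m₂ z).2) (h0 : (m₁ 0).2 ≤ (m₂ 0).2) :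
    ∃ e, Straightens m₁ m₂ U c e := by
  obtain ⟨K₁, t₁, ht₁, hL₁⟩ := hL₁
  obtain ⟨K₂, t₂, ht₂, hL₂⟩ := hL₂
  set T := shear c with hT
  have hnhds : ∀ s ∈ 𝓝 (0 : ℝ × ℝ), T.symm ⁻¹' s ∈ 𝓝 (0 : ℝ × ℝ) := by
    intro s hs
    refine T.symm.continuous.continuousAt.preimage_mem_nhds ?_
    rwa [_root_.map_zero]
  obtain ⟨ρ, hρ, hρs⟩ := Metric.nhds_basis_closedBall.mem_iff.1
    (hnhds _ (inter_mem hU (inter_mem ht₁ ht₂)))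
  have hlip : ∀ (m : ℝ × ℝ → ℝ × ℝ) (K : ℝ≥0) (t : Set (ℝ × ℝ)),
      LipschitzOnWith K (fun z => (m z).2) t → (∀ z ∈ closedBall 0 ρ, T.symm z ∈ t) →
      LipschitzOnWith (K * ‖(T.symm : (ℝ × ℝ) →L[ℝ] (ℝ × ℝ))‖₊) (fun z => (m (T.symm z)).2)
        (closedBall 0 ρ) := fun m K t hm ht =>
    hm.comp ((T.symm : (ℝ × ℝ) →L[ℝ] (ℝ × ℝ)).lipschitz.lipschitzOnWith) ht
  have l₁ := (hlip m₁ K₁ t₁ hL₁ fun z hz => (hρs hz).2.1).weaken (le_max_left _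
    (K₂ * ‖(T.symm : (ℝ × ℝ) →L[ℝ] (ℝ × ℝ))‖₊))
  have l₂ := (hlip m₂ K₂ t₂ hL₂ fun z hz => (hρs hz).2.2).weaken (le_max_right
    (K₁ * ‖(T.symm : (ℝ × ℝ) →L[ℝ] (ℝ × ℝ))‖₊) _)
  obtain ⟨e, he⟩ := exists_straightensGraphs hρ l₁ l₂
    (fun z hz hz0 => hlt _ (hρs hz).1 (by simpa using hz0))
    (by simpa only [_root_.map_zero] using h0) (hnhds U hU)
  have hsrc : (T.toHomeomorph.transOpenPartialHomeomorph e).source = T ⁻¹' e.source := rfl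
  have happ : ∀ z, (T.toHomeomorph.transOpenPartialHomeomorph e) z = e (T z) := fun _ => rfl
  have hsub : ∀ z ∈ T ⁻¹' e.source, z ∈ U := by
    intro z hz
    have := he.subset hz
    simpa only [mem_preimage, ContinuousLinearEquiv.symm_apply_apply] using this
  have hfield : ∀ m : ℝ × ℝ → ℝ × ℝ, (∀ z ∈ U, (m z).1 + c * (m z).2 = 1) →
      ∀ z ∈ U, T (m z) = (fun x => ((1 : ℝ), (m (T.symm x)).2)) (T z) := by
    intro m hm z hz
    simp only [ContinuousLinearEquiv.symm_apply_apply]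
    rw [hT, shear_apply, hm z hz]
  have hleaf : ∀ m : ℝ × ℝ → ℝ × ℝ, (∀ z ∈ U, (m z).1 + c * (m z).2 = 1) →
      ∀ S ⊆ T ⁻¹' e.source, ∀ z z' : ℝ × ℝ, SameLeaf m S z z' ↔
        SameLeaf (fun x => ((1 : ℝ), (m (T.symm x)).2)) (T '' S) (T z) (T z') := by
    intro m hm S hS z z'
    exact sameLeaf_map_iff T fun x hx => hfield m hm x (hsub x (hS hx))
  have himg : ∀ S, (T.toHomeomorph.transOpenPartialHomeomorph e) '' S = e '' (T '' S) := by
    intro S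
    rw [image_image]
    rfl
  have hax : ∀ m : ℝ × ℝ → ℝ × ℝ, ∀ s : ℝ, (m (T.symm (s, 0))).2 = (m (s, 0)).2 := by
    intro m s
    rw [hT, shear_symm_apply]
    simp
  have hmemU : ∀ s : ℝ, |s| ≤ ρ → (s, (0 : ℝ)) ∈ U := by
    intro s hs
    have : (s, (0 : ℝ)) ∈ closedBall (0 : ℝ × ℝ) ρ := by
      rw [mem_closedBall_zero_iff, Prod.norm_def]
      exact max_le hs (by simpa using hρ.le)
    have := (hρs this).1
    rw [hT, shear_symm_apply] at this
    simpa using this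
  refine ⟨T.toHomeomorph.transOpenPartialHomeomorph e, ?_, ?_, ?_, ?_, ?_, ?_, ?_, ?_, ?_, ?_, ?_⟩
  · rw [hsrc, mem_preimage, _root_.map_zero]
    exact he.zero_mem
  · rw [hsrc]; exact hsub
  · rw [happ, _root_.map_zero, he.map_zero]
  · intro S hS z hz z' hz'
    rw [hleaf m₁ hm₁ S hS, himg, happ, happ]
    exact he.leaf₁ _ (image_subset_iff.2 hS) _ (mem_image_of_mem T hz) _ (mem_image_of_mem T hz')
  · intro S hS z hz z' hz'
    rw [hleaf m₂ hm₂ S hS, himg, happ, happ]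
    exact he.leaf₂ _ (image_subset_iff.2 hS) _ (mem_image_of_mem T hz) _ (mem_image_of_mem T hz')
  · exact fun z hz h => he.order_right (T z) hz h
  · exact fun z hz h => he.order_left (T z) hz h
  · intro h z hz hz0
    exact he.axis_right₁ (fun s hs => by
      rw [hax]; exact h s hs.1 (hmemU s (abs_le.2 ⟨by linarith [hs.1], hs.2⟩))) (T z) hz hz0
  · intro h z hz hz0
    exact he.axis_left₁ (fun s hs => by
      rw [hax]; exact h s hs.2 (hmemU s (abs_le.2 ⟨hs.1, by linarith [hs.2]⟩))) (T z) hz hz0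
  · intro h z hz hz0
    exact he.axis_right₂ (fun s hs => by
      rw [hax]; exact h s hs.1 (hmemU s (abs_le.2 ⟨by linarith [hs.1], hs.2⟩))) (T z) hz hz0
  · intro h z hz hz0
    exact he.axis_left₂ (fun s hs => by
      rw [hax]; exact h s hs.2 (hmemU s (abs_le.2 ⟨hs.1, by linarith [hs.2]⟩))) (T z) hz hz0

theorem sameLeaf_vertical_iff_swap {V : Set (ℝ × ℝ)} {x x' : ℝ × ℝ} :
    SameLeaf (fun _ => (0, 1)) V x x' ↔
      SameLeaf (fun _ => (1, 0)) (Prod.swap '' V) x.swap x'.swap := by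
  rw [sameLeaf_vertical_iff, sameLeaf_horizontal_iff]
  simp [image_swap_eq_preimage_swap]

theorem sameLeaf_horizontal_iff_swap {V : Set (ℝ × ℝ)} {x x' : ℝ × ℝ} :
    SameLeaf (fun _ => (1, 0)) V x x' ↔
      SameLeaf (fun _ => (0, 1)) (Prod.swap '' V) x.swap x'.swap := by
  rw [sameLeaf_vertical_iff, sameLeaf_horizontal_iff]
  simp [image_swap_eq_preimage_swap]

theorem IsExtendedPrincipalNet.mono {k : WithTop ℕ∞} {αc : S3 → ℝ} {p : E3} {h : ℝ × ℝ → ℝ}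
    {S S' : Set (ℝ × ℝ)} {l₁ l₂ : ℝ × ℝ → ℝ × ℝ} (hS : S' ⊆ S)
    (hl : IsExtendedPrincipalNet k αc p h S l₁ l₂) : IsExtendedPrincipalNet k αc p h S' l₁ l₂ :=
  ⟨fun n hn => ⟨(hl.smooth n hn).1.mono hS, (hl.smooth n hn).2.mono hS⟩,
    fun z hz => hl.transversal z (hS hz), fun z hz => hl.directions z (hS hz),
    fun z hz => hl.principal z (hS hz)⟩

theorem Straightens.hasNetPattern {k : WithTop ℕ∞} {αc : S3 → ℝ} {p : E3} {h : ℝ × ℝ → ℝ}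
    {m₁ m₂ : ℝ × ℝ → ℝ × ℝ} {U Z R : Set (ℝ × ℝ)} {c : ℝ}
    {e : OpenPartialHomeomorph (ℝ × ℝ) (ℝ × ℝ)} (he : Straightens m₁ m₂ U c e)
    (hnet : IsExtendedPrincipalNet k αc p h (U \ Z) m₂ m₁)
    (hR : ∀ z ∈ e.source, 0 < z.2 ↔ e z ∈ R) : HasNetPattern k αc p h Z R :=
  ⟨e, m₂, m₁, he.zero_mem, he.map_zero, hR, hnet.mono (sdiff_subset_sdiff_left he.subset),
    fun z hz z' hz' => ⟨he.leaf₂ _ sdiff_subset z hz z' hz', he.leaf₁ _ sdiff_subset z hz z' hz'⟩⟩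

/-- Serves the case in which `m₁` is the minimal field: it is straightened to vertical lines, so the
axes of the target must be exchanged. -/
theorem Straightens.hasNetPattern_swap {k : WithTop ℕ∞} {αc : S3 → ℝ} {p : E3} {h : ℝ × ℝ → ℝ}
    {m₁ m₂ : ℝ × ℝ → ℝ × ℝ} {U Z R : Set (ℝ × ℝ)} {c : ℝ}
    {e : OpenPartialHomeomorph (ℝ × ℝ) (ℝ × ℝ)} (he : Straightens m₁ m₂ U c e)
    (hnet : IsExtendedPrincipalNet k αc p h (U \ Z) m₁ m₂)
    (hR : ∀ z ∈ e.source, 0 < z.2 ↔ (e z).swap ∈ R) : HasNetPattern k αc p h Z R := by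
  have happ : ∀ z, (e.transHomeomorph (Homeomorph.prodComm ℝ ℝ)) z = (e z).swap := fun _ => rfl
  have himg : ∀ S, (e.transHomeomorph (Homeomorph.prodComm ℝ ℝ)) '' S = Prod.swap '' (e '' S) := by
    intro S
    rw [image_image]
    rfl
  refine ⟨e.transHomeomorph (Homeomorph.prodComm ℝ ℝ), m₁, m₂, he.zero_mem, ?_, hR,
    hnet.mono (sdiff_subset_sdiff_left he.subset), fun z hz z' hz' => ⟨?_, ?_⟩⟩
  · rw [happ, he.map_zero]; rfl
  · rw [himg, happ, happ, ← sameLeaf_vertical_iff_swap]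
    exact he.leaf₁ _ sdiff_subset z hz z' hz'
  · rw [himg, happ, happ, ← sameLeaf_horizontal_iff_swap]
    exact he.leaf₂ _ sdiff_subset z hz z' hz'

end Transport

/-! ### The orthonormal frame τ, ν, p and the local equation of the zero set. -/

section Frame

open Set Filter Metric

theorem pt_ne_zero {x : E3} (hx : x ≠ 0) (w : ℝ) : pt x w ≠ 0 := by
  intro h
  apply hx
  ext i
  fin_cases i
  · simpa [pt] using congrArg (fun y : E4 => y 0) h
  · simpa [pt] using congrArg (fun y : E4 => y 1) h
  · simpa [pt] using congrArg (fun y : E4 => y 2) h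

theorem smul_pt (t : ℝ) (x : E3) (w : ℝ) : t • pt x w = pt (t • x) (t * w) := by
  ext i
  fin_cases i <;> simp [pt]

theorem contDiff_pt {n : WithTop ℕ∞} {E : Type*} [NormedAddCommGroup E] [NormedSpace ℝ E]
    {f : E → E3} {g : E → ℝ} (hf : ContDiff ℝ n f) (hg : ContDiff ℝ n g) :
    ContDiff ℝ n fun x => pt (f x) (g x) := by
  rw [contDiff_euclidean] at hf ⊢
  intro i
  fin_cases i
  · simpa [pt] using hf 0
  · simpa [pt] using hf 1
  · simpa [pt] using hf 2
  · simpa [pt] using hg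

theorem radial_smul {t : ℝ} (ht : 0 < t) (X : E4) : radial (t • X) = radial X := by
  by_cases hX : X = 0
  · simp [hX]
  · have htX : t • X ≠ 0 := smul_ne_zero ht.ne' hX
    apply Subtype.ext
    simp only [radial, hX, htX, dif_neg, not_false_eq_true]
    rw [norm_smul, Real.norm_of_nonneg ht.le, smul_smul, mul_inv, mul_comm t⁻¹, mul_assoc,
      inv_mul_cancel₀ ht.ne', mul_one]

theorem radial_pt_eq {x : E3} {w r : ℝ} (hr : 0 < r) :
    radial (pt x w) = radial (pt (r⁻¹ • x) (w / r)) := by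
  rw [← radial_smul (inv_pos.2 hr) (pt x w), smul_pt, div_eq_inv_mul]

theorem contMDiff_radial_comp {n : WithTop ℕ∞} {E : Type*} [NormedAddCommGroup E] [NormedSpace ℝ E]
    {f : E → E4} (hf : ContDiff ℝ n f) (h0 : ∀ x, f x ≠ 0) :
    ContMDiff 𝓘(ℝ, E) (𝓡 3) n fun x => radial (f x) := by
  have h1 : ContDiff ℝ n fun x => ‖f x‖⁻¹ • f x :=
    ((hf.norm ℝ h0).inv fun x => norm_ne_zero_iff.2 (h0 x)).smul hf
  have hmem : ∀ x, ‖f x‖⁻¹ • f x ∈ sphere (0 : E4) 1 := by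
    intro x
    simp [norm_smul, norm_ne_zero_iff.2 (h0 x)]
  have : Fact (Module.finrank ℝ E4 = 3 + 1) := ⟨by simp⟩
  have h2 := ContMDiff.codRestrict_sphere (n := 3) h1.contMDiff hmem
  have h3 : (fun x => radial (f x)) = codRestrict _ _ hmem := by
    funext x
    apply Subtype.ext
    simp [radial, h0 x]
  rw [h3]
  exact h2

theorem norm_eq_one_of_mem_endLocus {αc : S3 → ℝ} {p : E3} (hp : p ∈ endLocus αc) : ‖p‖ = 1 := by
  obtain ⟨s, -, h1, h2⟩ := hp
  refine tendsto_nhds_unique h2.norm ?_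
  refine tendsto_const_nhds.congr' ?_
  filter_upwards [h1.eventually_gt_atTop 0] with n hn
  rw [norm_smul, norm_inv, norm_norm, inv_mul_cancel₀ hn.ne']

theorem inner_cross_self_left (x y : E3) : inner ℝ x (cross x y) = 0 := by
  simp [cross, PiLp.inner_apply, Fin.sum_univ_three, cross_apply]
  ring

theorem inner_cross_self_right (x y : E3) : inner ℝ y (cross x y) = 0 := by
  simp [cross, PiLp.inner_apply, Fin.sum_univ_three, cross_apply]
  ring

theorem inner_cross_cross (x y : E3) : inner ℝ (cross x y) (cross x y) =
    inner ℝ x x * inner ℝ y y - inner ℝ x y * inner ℝ x y := by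
  simp only [cross, PiLp.inner_apply, Fin.sum_univ_three, cross_apply]
  simp
  ring

theorem cross_cross_self (x y : E3) : cross x (cross x y) =
    (inner ℝ x y : ℝ) • x - (inner ℝ x x : ℝ) • y := by
  ext i
  fin_cases i <;>
  · simp [cross, PiLp.inner_apply, Fin.sum_univ_three, cross_apply, -inner_self_eq_norm_sq_to_K]
    ring

theorem cross_smul (c : ℝ) (x y : E3) : cross x (c • y) = c • cross x y := by
  simp [cross]

variable {αc : S3 → ℝ} {p : E3}

/-- `equatorFn` is constant on rays, so its derivative in the radial direction vanishes. -/
theorem inner_gradient_equatorFn_self (hp : IsRegularEndPoint αc p) :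
    inner ℝ (gradient (equatorFn αc) p) p = 0 := by
  have hd : DifferentiableAt ℝ (equatorFn αc) p := by
    by_contra h
    exact hp.2 (gradient_eq_zero_of_not_differentiableAt h)
  have h1 : HasDerivAt (fun t : ℝ => equatorFn αc (p + t • p))
      (inner ℝ (gradient (equatorFn αc) p) p) 0 := by
    have h2 : HasDerivAt (fun t : ℝ => p + t • p) p 0 := by
      simpa using ((hasDerivAt_id (0 : ℝ)).smul_const p).const_add p
    have h3 := hd.hasGradientAt.hasFDerivAt
    exact HasFDerivAt.comp_hasDerivAt_of_eq (0 : ℝ) h3 h2 (by simp)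
  have h4 : HasDerivAt (fun t : ℝ => equatorFn αc (p + t • p)) 0 0 := by
    refine (hasDerivAt_const (0 : ℝ) (equatorFn αc p)).congr_of_eventuallyEq ?_
    filter_upwards [lt_mem_nhds (show (-1 : ℝ) < 0 by norm_num)] with t ht
    have h5 : p + t • p = (1 + t) • p := by rw [add_smul, one_smul]
    have h6 := smul_pt (1 + t) p 0
    rw [mul_zero] at h6
    simp only [equatorFn]
    rw [h5, ← h6, radial_smul (by linarith)]
  exact h1.unique h4

theorem inner_p_p (hp : IsRegularEndPoint αc p) : inner ℝ p p = (1 : ℝ) := by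
  rw [real_inner_self_eq_norm_sq, norm_eq_one_of_mem_endLocus hp.1, one_pow]

theorem inner_p_normalVec (hp : IsRegularEndPoint αc p) : inner ℝ p (normalVec αc p) = (0 : ℝ) := by
  rw [normalVec, inner_smul_right, real_inner_comm, inner_gradient_equatorFn_self hp, mul_zero]

theorem inner_normalVec_self (hp : IsRegularEndPoint αc p) :
    inner ℝ (normalVec αc p) (normalVec αc p) = (1 : ℝ) := by
  have h := norm_ne_zero_iff.2 hp.2
  rw [real_inner_self_eq_norm_sq, normalVec, norm_smul, norm_inv, norm_norm, inv_mul_cancel₀ h,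
    one_pow]

theorem inner_p_tangentVec : inner ℝ p (tangentVec αc p) = (0 : ℝ) :=
  inner_cross_self_left _ _

theorem inner_normalVec_tangentVec : inner ℝ (normalVec αc p) (tangentVec αc p) = (0 : ℝ) :=
  inner_cross_self_right _ _

theorem inner_tangentVec_self (hp : IsRegularEndPoint αc p) :
    inner ℝ (tangentVec αc p) (tangentVec αc p) = (1 : ℝ) := by
  rw [tangentVec, inner_cross_cross, inner_p_p hp, inner_normalVec_self hp, inner_p_normalVec hp]
  norm_num

/-- Origin of the minus sign in the geodesic curvature -a. -/
theorem cross_p_tangentVec (hp : IsRegularEndPoint αc p) :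
    cross p (tangentVec αc p) = -normalVec αc p := by
  rw [tangentVec, cross_cross_self, inner_p_normalVec hp, inner_p_p hp]
  simp

theorem orthonormal_frame (hp : IsRegularEndPoint αc p) :
    Orthonormal ℝ ![tangentVec αc p, normalVec αc p, p] := by
  rw [orthonormal_iff_ite]
  intro i j
  fin_cases i <;> fin_cases j <;>
    simp [inner_p_p hp, inner_p_normalVec hp, inner_p_tangentVec, inner_normalVec_tangentVec,
      real_inner_comm p, real_inner_comm (normalVec αc p) (tangentVec αc p),
      inner_normalVec_self hp, inner_tangentVec_self hp, -inner_self_eq_norm_sq_to_K]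

/-- The orthonormal frame `τ, ν, p`. -/
noncomputable def frame (hp : IsRegularEndPoint αc p) : OrthonormalBasis (Fin 3) ℝ E3 :=
  OrthonormalBasis.mk (orthonormal_frame hp) (by
    rw [top_le_iff]
    exact (orthonormal_frame hp).linearIndependent.span_eq_top_of_card_eq_finrank (by simp))

theorem eq_frame_sum (hp : IsRegularEndPoint αc p) (x : E3) :
    x = (inner ℝ (tangentVec αc p) x : ℝ) • tangentVec αc p +
      (inner ℝ (normalVec αc p) x : ℝ) • normalVec αc p + (inner ℝ p x : ℝ) • p := by
  have := (frame hp).sum_repr' x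
  simp only [frame, OrthonormalBasis.coe_mk, Fin.sum_univ_three, Matrix.cons_val_zero,
    Matrix.cons_val_one, Matrix.cons_val] at this
  exact this.symm

theorem inner_frame (hp : IsRegularEndPoint αc p) (a b c a' b' c' : ℝ) :
    inner ℝ (a • tangentVec αc p + b • normalVec αc p + c • p)
      (a' • tangentVec αc p + b' • normalVec αc p + c' • p) = a * a' + b * b' + c * c' := by
  simp only [inner_add_left, inner_add_right, real_inner_smul_left, real_inner_smul_right]
  rw [inner_tangentVec_self hp, inner_normalVec_self hp, inner_p_p hp, inner_p_normalVec hp,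
    inner_p_tangentVec, inner_normalVec_tangentVec, real_inner_comm p (tangentVec αc p),
    real_inner_comm p (normalVec αc p), real_inner_comm (normalVec αc p) (tangentVec αc p),
    inner_p_normalVec hp, inner_p_tangentVec, inner_normalVec_tangentVec]
  ring

/-- The function `αᶜ` in the coordinates `(u, v, w)` of the tangent space at `(p, 0)`. -/
noncomputable def localFn (αc : S3 → ℝ) (p : E3) (X : ℝ × ℝ × ℝ) : ℝ :=
  αc (radial (pt (p + X.1 • tangentVec αc p + X.2.1 • normalVec αc p) X.2.2))

theorem inner_p_add (hp : IsRegularEndPoint αc p) (u v : ℝ) :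
    inner ℝ p (p + u • tangentVec αc p + v • normalVec αc p) = (1 : ℝ) := by
  simp only [inner_add_right, real_inner_smul_right]
  rw [inner_p_p hp, inner_p_normalVec hp, inner_p_tangentVec]
  ring

theorem add_ne_zero_frame (hp : IsRegularEndPoint αc p) (u v : ℝ) :
    p + u • tangentVec αc p + v • normalVec αc p ≠ 0 := by
  intro h
  have := inner_p_add hp u v
  rw [h, inner_zero_right] at this
  exact zero_ne_one this

theorem contDiff_localFn {k : WithTop ℕ∞} (hα : ContMDiff (𝓡 3) 𝓘(ℝ, ℝ) k αc)
    (hp : IsRegularEndPoint αc p) : ContDiff ℝ k (localFn αc p) := by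
  rw [← contMDiff_iff_contDiff]
  refine hα.comp (contMDiff_radial_comp (contDiff_pt (by fun_prop) (by fun_prop)) ?_)
  exact fun X => pt_ne_zero (add_ne_zero_frame hp _ _) _

/-- The point of the tangent space that is projected to `x`, as a combination of the frame. -/
theorem inv_smul_eq_frame (hp : IsRegularEndPoint αc p) {x : E3} (hx : 0 < (inner ℝ p x : ℝ)) :
    (inner ℝ p x : ℝ)⁻¹ • x = p + (inner ℝ (tangentVec αc p) x / inner ℝ p x : ℝ) •
      tangentVec αc p + (inner ℝ (normalVec αc p) x / inner ℝ p x : ℝ) • normalVec αc p := by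
  conv_lhs => rw [eq_frame_sum hp x]
  simp only [smul_add, smul_smul]
  rw [← eq_frame_sum hp x, inv_mul_cancel₀ hx.ne', one_smul, div_eq_inv_mul, div_eq_inv_mul]
  abel

theorem radial_pt_eq_localFn (hp : IsRegularEndPoint αc p) {x : E3}
    (hx : 0 < (inner ℝ p x : ℝ)) (w : ℝ) : αc (radial (pt x w)) =
      localFn αc p (inner ℝ (tangentVec αc p) x / inner ℝ p x,
        inner ℝ (normalVec αc p) x / inner ℝ p x, w / inner ℝ p x) := by
  rw [localFn, radial_pt_eq hx, inv_smul_eq_frame hp hx]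

/-- On the plane w = 0 the derivative of `localFn` at 0 is the pairing with the gradient of
`equatorFn`, and that gradient is a positive multiple of ν. -/
theorem hasFDerivAt_localFn_zero {k : WithTop ℕ∞} (hk : 1 ≤ k)
    (hα : ContMDiff (𝓡 3) 𝓘(ℝ, ℝ) k αc) (hp : IsRegularEndPoint αc p) :
    fderiv ℝ (localFn αc p) 0 (1, 0, 0) = 0 ∧
      0 < fderiv ℝ (localFn αc p) 0 (0, 1, 0) := by
  have hd : DifferentiableAt ℝ (equatorFn αc) p := by
    by_contra h
    exact hp.2 (gradient_eq_zero_of_not_differentiableAt h)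
  have hF : DifferentiableAt ℝ (localFn αc p) 0 :=
    (contDiff_localFn hα hp).differentiable (by positivity) 0
  have key : ∀ a b : ℝ, fderiv ℝ (localFn αc p) 0 (a, b, 0) = inner ℝ (gradient (equatorFn αc) p)
      (a • tangentVec αc p + b • normalVec αc p) := by
    intro a b
    have h1 : HasDerivAt (fun t : ℝ => localFn αc p (t • (a, b, 0)))
        (fderiv ℝ (localFn αc p) 0 (a, b, 0)) 0 := by
      have h2 : HasDerivAt (fun t : ℝ => t • ((a, b, 0) : ℝ × ℝ × ℝ)) (a, b, 0) 0 := by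
        simpa using (hasDerivAt_id (0 : ℝ)).smul_const ((a, b, 0) : ℝ × ℝ × ℝ)
      exact HasFDerivAt.comp_hasDerivAt_of_eq (0 : ℝ) hF.hasFDerivAt h2 (by simp)
    have h3 : HasDerivAt (fun t : ℝ => localFn αc p (t • (a, b, 0)))
        (inner ℝ (gradient (equatorFn αc) p)
          (a • tangentVec αc p + b • normalVec αc p)) 0 := by
      have h2 : HasDerivAt (fun t : ℝ => p + t • (a • tangentVec αc p + b • normalVec αc p))
          (a • tangentVec αc p + b • normalVec αc p) 0 := by
        simpa using ((hasDerivAt_id (0 : ℝ)).smul_const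
          (a • tangentVec αc p + b • normalVec αc p)).const_add p
      have h4 := HasFDerivAt.comp_hasDerivAt_of_eq (0 : ℝ) hd.hasGradientAt.hasFDerivAt h2 (by simp)
      simp only [InnerProductSpace.toDual_apply_apply] at h4
      have h5 : (fun t : ℝ => localFn αc p (t • (a, b, 0))) = equatorFn αc ∘
          fun t => p + t • (a • tangentVec αc p + b • normalVec αc p) := by
        funext t
        simp [localFn, equatorFn, smul_add, smul_smul, add_assoc]
      rw [h5]
      exact h4
    exact h1.unique h3
  have hg : gradient (equatorFn αc) p = ‖gradient (equatorFn αc) p‖ • normalVec αc p := by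
    rw [normalVec, smul_smul, mul_inv_cancel₀ (norm_ne_zero_iff.2 hp.2), one_smul]
  constructor
  · rw [key, hg]
    simp [inner_smul_left, inner_normalVec_tangentVec]
  · rw [key, hg]
    simp only [zero_smul, one_smul, zero_add, real_inner_smul_left, inner_normalVec_self hp]
    simpa using hp.2

end Frame

/-! ### The end locus as a regular curve. -/

section EndLocus

open Set Filter Metric

variable {αc : S3 → ℝ} {p : E3} {k : WithTop ℕ∞} {h : ℝ × ℝ → ℝ}

theorem affineFn_eq_localFn (hp : IsRegularEndPoint αc p) {q : E3} (hq : 0 < (inner ℝ p q : ℝ)) :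
    affineFn αc q = localFn αc p (inner ℝ (tangentVec αc p) q / inner ℝ p q,
        inner ℝ (normalVec αc p) q / inner ℝ p q, 1 / inner ℝ p q) :=
  radial_pt_eq_localFn hp hq 1

/-- A point q of the surface with ⟨p, q⟩ > 0 has local coordinates (⟨τ, q⟩, ⟨ν, q⟩, 1) / ⟨p, q⟩.
When q goes to infinity in the direction x, the last coordinate tends to 0 and the first two to
those of x; continuity does the rest. -/
theorem localFn_eq_zero_of_mem_endLocus (hα : Continuous (localFn αc p))
    (hp : IsRegularEndPoint αc p) {x : E3} (hx : x ∈ endLocus αc) (hpx : 0 < (inner ℝ p x : ℝ)) :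
    localFn αc p (inner ℝ (tangentVec αc p) x / inner ℝ p x,
        inner ℝ (normalVec αc p) x / inner ℝ p x, 0) = 0 := by
  obtain ⟨s, hs, hinf, hlim⟩ := hx
  have hpos : ∀ᶠ n in atTop, 0 < (inner ℝ p (‖s n‖⁻¹ • s n) : ℝ) :=
    ((tendsto_const_nhds (x := p)).inner hlim).eventually_const_lt hpx
  have hcoord : ∀ y : E3, Tendsto (fun n => (inner ℝ y (‖s n‖⁻¹ • s n) : ℝ) /
      inner ℝ p (‖s n‖⁻¹ • s n)) atTop (𝓝 (inner ℝ y x / inner ℝ p x)) := fun y =>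
    ((tendsto_const_nhds (x := y)).inner hlim).div ((tendsto_const_nhds (x := p)).inner hlim)
      hpx.ne'
  have hw : Tendsto (fun n => ‖s n‖⁻¹ / (inner ℝ p (‖s n‖⁻¹ • s n) : ℝ)) atTop (𝓝 0) := by
    have := hinf.inv_tendsto_atTop.div ((tendsto_const_nhds (x := p)).inner hlim) hpx.ne'
    rw [zero_div] at this
    exact this
  have ht := (hα.tendsto _).comp ((hcoord (tangentVec αc p)).prodMk_nhds
    ((hcoord (normalVec αc p)).prodMk_nhds hw))
  refine tendsto_nhds_unique ht (tendsto_const_nhds.congr' ?_)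
  filter_upwards [hpos, hinf.eventually_gt_atTop 0] with n hn hn0
  have hn' : 0 < (inner ℝ p (s n) : ℝ) := by
    rw [real_inner_smul_right] at hn
    exact pos_of_mul_pos_right hn (inv_pos.2 hn0).le
  have h1 := hs n
  rw [surface, mem_ofPred_eq, affineFn_eq_localFn hp hn'] at h1
  rw [← h1, Function.comp_apply]
  simp only [real_inner_smul_right]
  have e : ‖s n‖⁻¹ ≠ 0 := (inv_pos.2 hn0).ne'
  rw [mul_div_mul_left _ _ e, mul_div_mul_left _ _ e]
  congr 3
  field_simp

theorem inner_tangentVec_p : inner ℝ (tangentVec αc p) p = (0 : ℝ) := by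
  rw [real_inner_comm]; exact inner_p_tangentVec

theorem inner_normalVec_p (hp : IsRegularEndPoint αc p) :
    inner ℝ (normalVec αc p) p = (0 : ℝ) := by
  rw [real_inner_comm]; exact inner_p_normalVec hp

theorem inner_tangentVec_normalVec :
    inner ℝ (tangentVec αc p) (normalVec αc p) = (0 : ℝ) := by
  rw [real_inner_comm]; exact inner_normalVec_tangentVec

theorem localFn_zero (hα : Continuous (localFn αc p)) (hp : IsRegularEndPoint αc p) :
    localFn αc p 0 = 0 := by
  have := localFn_eq_zero_of_mem_endLocus hα hp hp.1 (by rw [inner_p_p hp]; exact one_pos)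
  rwa [inner_tangentVec_p, inner_normalVec_p hp, zero_div] at this

theorem IsEndChart.exists_nhds (hh : IsEndChart k αc p h) :
    ∃ G : Set (ℝ × ℝ × ℝ), IsOpen G ∧ (0 : ℝ × ℝ × ℝ) ∈ G ∧
      ∀ X ∈ G, localFn αc p X = 0 ↔ X.2.1 = h (X.1, X.2.2) := by
  obtain ⟨G, h1, h2, h3⟩ := _root_.eventually_nhds_iff.1 hh.graph
  exact ⟨G, h2, h3, fun X hX => h1 X hX⟩

theorem IsEndChart.map_zero (hh : IsEndChart k αc p h) (hα : Continuous (localFn αc p))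
    (hp : IsRegularEndPoint αc p) : h 0 = 0 := by
  obtain ⟨G, -, h0, hG⟩ := hh.exists_nhds
  exact ((hG 0 h0).1 (localFn_zero hα hp)).symm

/-- The chart domain: `h` is smooth and its graph is contained in the zero set. -/
theorem IsEndChart.exists_domain (hh : IsEndChart k αc p h) (hα : Continuous (localFn αc p))
    (hp : IsRegularEndPoint αc p) : ∃ Ω : Set (ℝ × ℝ), IsOpen Ω ∧ (0 : ℝ × ℝ) ∈ Ω ∧
      ContDiffOn ℝ k h Ω ∧ ∀ z ∈ Ω, localFn αc p (z.1, h z, z.2) = 0 := by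
  obtain ⟨G, hGo, hG0, hG⟩ := hh.exists_nhds
  obtain ⟨W, hWo, hW0, hW⟩ := hh.smooth
  have hc : ContinuousOn (fun z : ℝ × ℝ => (z.1, h z, z.2)) W :=
    continuousOn_fst.prodMk (hW.continuousOn.prodMk continuousOn_snd)
  refine ⟨W ∩ (fun z : ℝ × ℝ => (z.1, h z, z.2)) ⁻¹' G, hc.isOpen_inter_preimage hWo hGo,
    ⟨hW0, ?_⟩, hW.mono inter_subset_left, fun z hz => (hG _ hz.2).2 rfl⟩
  rw [mem_preimage, hh.map_zero hα hp]
  exact hG0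

theorem endCurve_zero (hp : IsRegularEndPoint αc p) (h0 : h 0 = 0) : endCurve αc p h 0 = p := by
  have h1 : h ((0 : ℝ), (0 : ℝ)) = 0 := h0
  simp [endCurve, h1, norm_eq_one_of_mem_endLocus hp.1]

theorem inner_endCurve (hp : IsRegularEndPoint αc p) (u : ℝ) :
    0 < (inner ℝ p (endCurve αc p h u) : ℝ) ∧
    (inner ℝ (tangentVec αc p) (endCurve αc p h u) : ℝ) / inner ℝ p (endCurve αc p h u) = u ∧
    (inner ℝ (normalVec αc p) (endCurve αc p h u) : ℝ) / inner ℝ p (endCurve αc p h u) =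
      h (u, 0) := by
  have hn : 0 < ‖p + u • tangentVec αc p + h (u, 0) • normalVec αc p‖⁻¹ :=
    inv_pos.2 (norm_pos_iff.2 (add_ne_zero_frame hp _ _))
  have h1 : (inner ℝ p (endCurve αc p h u) : ℝ) =
      ‖p + u • tangentVec αc p + h (u, 0) • normalVec αc p‖⁻¹ := by
    rw [endCurve, real_inner_smul_right, inner_p_add hp, mul_one]
  have h2 : (inner ℝ (tangentVec αc p) (endCurve αc p h u) : ℝ) =
      ‖p + u • tangentVec αc p + h (u, 0) • normalVec αc p‖⁻¹ * u := by
    rw [endCurve, real_inner_smul_right]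
    simp only [inner_add_right, real_inner_smul_right, inner_tangentVec_p,
      inner_tangentVec_self hp, inner_tangentVec_normalVec]
    ring
  have h3 : (inner ℝ (normalVec αc p) (endCurve αc p h u) : ℝ) =
      ‖p + u • tangentVec αc p + h (u, 0) • normalVec αc p‖⁻¹ * h (u, 0) := by
    rw [endCurve, real_inner_smul_right]
    simp only [inner_add_right, real_inner_smul_right, inner_normalVec_p hp,
      inner_normalVec_tangentVec, inner_normalVec_self hp]
    ring
  rw [h1, h2, h3]
  exact ⟨hn, mul_div_cancel_left₀ _ hn.ne', mul_div_cancel_left₀ _ hn.ne'⟩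

theorem eq_endCurve (hp : IsRegularEndPoint αc p) {x : E3} (hx1 : ‖x‖ = 1)
    (hx : 0 < (inner ℝ p x : ℝ)) (hxh : (inner ℝ (normalVec αc p) x : ℝ) / inner ℝ p x =
      h (inner ℝ (tangentVec αc p) x / inner ℝ p x, 0)) :
    endCurve αc p h (inner ℝ (tangentVec αc p) x / inner ℝ p x) = x := by
  rw [endCurve, ← hxh, ← inv_smul_eq_frame hp hx, norm_smul, hx1, mul_one, norm_inv,
    Real.norm_of_nonneg hx.le, inv_inv, smul_smul, mul_inv_cancel₀ hx.ne', one_smul]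

/-- The points w⁻¹ (p + u τ + h(u, w) ν) lie on the surface, have norm at least w⁻¹, and their
directions converge as w → 0. The sequence w = 1 / (n + N + 1) is shifted by N so that (u, w)
remains in Ω. -/
theorem endCurve_mem_endLocus (hp : IsRegularEndPoint αc p) {Ω : Set (ℝ × ℝ)} (hΩo : IsOpen Ω)
    (hΩ : ContinuousOn h Ω) (hΩz : ∀ z ∈ Ω, localFn αc p (z.1, h z, z.2) = 0) {u : ℝ}
    (hu : (u, (0 : ℝ)) ∈ Ω) : endCurve αc p h u ∈ endLocus αc := by
  have hw : Tendsto (fun n : ℕ => (1 : ℝ) / (n + 1)) atTop (𝓝 0) :=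
    tendsto_one_div_add_atTop_nhds_zero_nat
  have hz : Tendsto (fun n : ℕ => (u, (1 : ℝ) / (n + 1))) atTop (𝓝 (u, 0)) :=
    tendsto_const_nhds.prodMk_nhds hw
  obtain ⟨N, hN⟩ := eventually_atTop.1 (hz.eventually (hΩo.mem_nhds hu))
  have hshift := tendsto_add_atTop_nat N
  set w : ℕ → ℝ := fun n => 1 / ((n + N : ℕ) + 1) with hwdef
  have hwpos : ∀ n, 0 < w n := fun n => by rw [hwdef]; positivity
  have hzw : Tendsto (fun n => (u, w n)) atTop (𝓝 (u, 0)) := hz.comp hshift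
  set x : ℕ → E3 := fun n => p + u • tangentVec αc p + h (u, w n) • normalVec αc p with hx
  have hxlim : Tendsto x atTop (𝓝 (p + u • tangentVec αc p + h (u, 0) • normalVec αc p)) := by
    have := (hΩ.continuousAt (hΩo.mem_nhds hu)).tendsto.comp hzw
    exact tendsto_const_nhds.add (this.smul_const _)
  have hxp : ∀ n, inner ℝ p (x n) = (1 : ℝ) := fun n => inner_p_add hp _ _
  have hnorm : ∀ n, ‖(w n)⁻¹ • x n‖ = (w n)⁻¹ * ‖x n‖ := fun n => by
    rw [norm_smul, Real.norm_of_nonneg (inv_pos.2 (hwpos n)).le]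
  refine ⟨fun n => (w n)⁻¹ • x n, fun n => ?_, ?_, ?_⟩
  · have hip : inner ℝ p ((w n)⁻¹ • x n) = (w n)⁻¹ := by
      rw [real_inner_smul_right, hxp, mul_one]
    have hi := (inv_pos.2 (hwpos n))
    rw [surface, mem_ofPred_eq, affineFn_eq_localFn hp (by rw [hip]; exact hi), hip,
      real_inner_smul_right, real_inner_smul_right, mul_div_cancel_left₀ _ hi.ne',
      mul_div_cancel_left₀ _ hi.ne', one_div, inv_inv]
    have := hΩz _ (hN (n + N) (Nat.le_add_left _ _))
    convert this using 2
    refine Prod.ext ?_ (Prod.ext ?_ rfl)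
    · simp only [hx, inner_add_right, real_inner_smul_right, inner_tangentVec_p,
        inner_tangentVec_self hp, inner_tangentVec_normalVec]
      ring
    · simp only [hx, inner_add_right, real_inner_smul_right, inner_normalVec_p hp,
        inner_normalVec_tangentVec, inner_normalVec_self hp]
      rw [hwdef]
      ring
  · have hge : ∀ n : ℕ, (n : ℝ) ≤ ‖(w n)⁻¹ • x n‖ := by
      intro n
      have h1 : 1 ≤ ‖x n‖ := by
        have := real_inner_le_norm p (x n)
        rwa [hxp, norm_eq_one_of_mem_endLocus hp.1, one_mul] at this
      have h2 : (w n)⁻¹ = n + N + 1 := by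
        rw [hwdef]; simp
      rw [hnorm, h2]
      have : (0 : ℝ) ≤ N := Nat.cast_nonneg N
      have : (0 : ℝ) ≤ n := Nat.cast_nonneg n
      nlinarith
    exact tendsto_atTop_mono hge tendsto_natCast_atTop_atTop
  · have : ∀ n, ‖(w n)⁻¹ • x n‖⁻¹ • (w n)⁻¹ • x n = ‖x n‖⁻¹ • x n := by
      intro n
      rw [hnorm, smul_smul, mul_inv, inv_inv, mul_comm (w n), mul_assoc,
        mul_inv_cancel₀ (hwpos n).ne', mul_one]
    simp only [this]
    exact (hxlim.norm.inv₀ (norm_ne_zero_iff.2 (add_ne_zero_frame hp _ _))).smul hxlim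

theorem contDiffOn_endCurve (hp : IsRegularEndPoint αc p) {Ω : Set (ℝ × ℝ)} {I : Set ℝ}
    (hΩ : ContDiffOn ℝ k h Ω) (hI : ∀ u ∈ I, (u, (0 : ℝ)) ∈ Ω) :
    ContDiffOn ℝ k (endCurve αc p h) I := by
  have h1 : ContDiffOn ℝ k (fun u : ℝ => h (u, 0)) I :=
    hΩ.comp (by fun_prop : ContDiff ℝ k fun u : ℝ => (u, (0 : ℝ))).contDiffOn hI
  have h2 : ContDiffOn ℝ k (fun u : ℝ => p + u • tangentVec αc p + h (u, 0) • normalVec αc p) I :=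
    (by fun_prop : ContDiff ℝ k fun u : ℝ => p + u • tangentVec αc p).contDiffOn.add
      (h1.smul contDiffOn_const)
  exact ((h2.norm ℝ fun u _ => add_ne_zero_frame hp _ _).inv fun u _ =>
    norm_ne_zero_iff.2 (add_ne_zero_frame hp _ _)).smul h2

/-- Near a regular end point the end locus is the curve `v = h(u, 0)`. -/
theorem exists_endLocus_eq_endCurve (hα : Continuous (localFn αc p)) (hk : 1 ≤ k)
    (hp : IsRegularEndPoint αc p) (hh : IsEndChart k αc p h) :
    ∃ ε : ℝ, 0 < ε ∧ ∃ U : Set E3, IsOpen U ∧ p ∈ U ∧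
      endLocus αc ∩ U = endCurve αc p h '' Set.Ioo (-ε) ε ∧
      Set.InjOn (endCurve αc p h) (Set.Ioo (-ε) ε) ∧
      ContDiffOn ℝ k (endCurve αc p h) (Set.Ioo (-ε) ε) ∧
      ∀ u ∈ Set.Ioo (-ε) ε, deriv (endCurve αc p h) u ≠ 0 := by
  obtain ⟨Ω, hΩo, hΩ0, hΩ, hΩz⟩ := hh.exists_domain hα hp
  obtain ⟨G, hGo, hG0, hG⟩ := hh.exists_nhds
  have hhu : ContinuousAt (fun u : ℝ => h (u, 0)) 0 :=
    ContinuousAt.comp (f := fun u : ℝ => (u, (0 : ℝ))) (g := h)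
      (hΩ.continuousOn.continuousAt (hΩo.mem_nhds hΩ0)) (by fun_prop)
  have hev : ∀ᶠ u : ℝ in 𝓝 0, (u, (0 : ℝ)) ∈ Ω ∧ (u, h (u, 0), (0 : ℝ)) ∈ G := by
    refine Filter.Eventually.and ?_ ?_
    · exact (by fun_prop : Continuous fun u : ℝ => (u, (0 : ℝ))).continuousAt.eventually
        (hΩo.mem_nhds hΩ0)
    · have hc : ContinuousAt (fun u : ℝ => (u, h (u, 0), (0 : ℝ))) 0 :=
        continuousAt_id.prodMk (hhu.prodMk continuousAt_const)
      refine hc.eventually (hGo.mem_nhds ?_)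
      have : h ((0 : ℝ), (0 : ℝ)) = 0 := hh.map_zero hα hp
      simp only [this]
      exact hG0
  obtain ⟨ε, hε, hεs⟩ := Metric.eventually_nhds_iff_ball.1 hev
  rw [Real.ball_eq_Ioo, zero_sub, zero_add] at hεs
  set V : Set E3 := {x | 0 < (inner ℝ p x : ℝ)} with hV
  have hVo : IsOpen V := isOpen_lt continuous_const (by fun_prop)
  set g : E3 → ℝ × ℝ × ℝ := fun x => (inner ℝ (tangentVec αc p) x / inner ℝ p x,
    inner ℝ (normalVec αc p) x / inner ℝ p x, 0) with hg
  have hgc : ContinuousOn g V := by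
    have : ∀ y : E3, ContinuousOn (fun x : E3 => (inner ℝ y x : ℝ) / inner ℝ p x) V := fun y =>
      ContinuousOn.div (by fun_prop) (by fun_prop) fun x hx => (ne_of_gt hx)
    exact (this _).prodMk ((this _).prodMk continuousOn_const)
  have hGε : IsOpen (G ∩ {X : ℝ × ℝ × ℝ | X.1 ∈ Ioo (-ε) ε}) :=
    hGo.inter (isOpen_Ioo.preimage continuous_fst)
  have hd : ContDiffOn ℝ k (endCurve αc p h) (Ioo (-ε) ε) :=
    contDiffOn_endCurve hp hΩ fun u hu => (hεs u hu).1
  -- U consists of the x on the side of p whose central projection to the tangent plane lies in the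
  -- chart neighborhood, with |u| < ε.
  refine ⟨ε, hε, V ∩ g ⁻¹' (G ∩ {X : ℝ × ℝ × ℝ | X.1 ∈ Ioo (-ε) ε}),
    hgc.isOpen_inter_preimage hVo hGε, ⟨?_, ?_⟩, ?_, ?_, hd, ?_⟩
  · rw [hV, mem_ofPred_eq, inner_p_p hp]; exact one_pos
  · have hg0 : g p = 0 := by
      simp only [hg, inner_tangentVec_p, inner_normalVec_p hp, zero_div]
      rfl
    rw [mem_preimage, hg0]
    exact ⟨hG0, by simpa using hε⟩
  · ext x
    constructor
    · rintro ⟨hx, hxV, hxG, hxε⟩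
      refine ⟨_, hxε, eq_endCurve hp (norm_eq_one_of_mem_endLocus hx) hxV ?_⟩
      exact (hG _ hxG).1 (localFn_eq_zero_of_mem_endLocus hα hp hx hxV)
    · rintro ⟨u, hu, rfl⟩
      obtain ⟨h1, h2, h3⟩ := inner_endCurve (h := h) hp u
      refine ⟨endCurve_mem_endLocus hp hΩo hΩ.continuousOn hΩz (hεs u hu).1, h1, ?_⟩
      rw [mem_preimage, hg]
      simp only [h2, h3]
      exact ⟨(hεs u hu).2, hu⟩
  · intro u _ u' _ huu'
    rw [← (inner_endCurve (h := h) hp u).2.1, ← (inner_endCurve (h := h) hp u').2.1, huu']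
  -- The parameter u is the quotient of the τ- and p-components of the curve; a vanishing derivative
  -- of the curve would give this quotient derivative 0 instead of 1.
  · intro u hu h0
    have hdu : HasDerivAt (endCurve αc p h) 0 u := by
      rw [← h0]
      exact ((hd.differentiableOn (by positivity)).differentiableAt
        (isOpen_Ioo.mem_nhds hu)).hasDerivAt
    have h1 : ∀ y : E3, HasDerivAt (fun t => (inner ℝ y (endCurve αc p h t) : ℝ)) 0 u := by
      intro y
      have := (hasDerivAt_const u y).inner ℝ hdu
      simpa using this
    have h2 := (h1 (tangentVec αc p)).div (h1 p) (inner_endCurve (h := h) hp u).1.ne'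
    have h3 : (fun t => (inner ℝ (tangentVec αc p) (endCurve αc p h t) : ℝ)) /
        (fun t => inner ℝ p (endCurve αc p h t)) = id := by
      funext t
      exact (inner_endCurve (h := h) hp t).2.1
    rw [h3] at h2
    have := h2.unique (hasDerivAt_id u)
    simp at this

end EndLocus

/-! ### Partial derivatives in the chart. -/

section Calculus

open Set Filter Metric

theorem _root_.ContDiffOn.du {f : ℝ × ℝ → ℝ} {Ω : Set (ℝ × ℝ)} {m n : WithTop ℕ∞}
    (hf : ContDiffOn ℝ m f Ω) (hΩ : IsOpen Ω) (hn : n + 1 ≤ m) : ContDiffOn ℝ n (du f) Ω :=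
  (hf.fderiv_of_isOpen hΩ hn).clm_apply contDiffOn_const

theorem _root_.ContDiffOn.dw {f : ℝ × ℝ → ℝ} {Ω : Set (ℝ × ℝ)} {m n : WithTop ℕ∞}
    (hf : ContDiffOn ℝ m f Ω) (hΩ : IsOpen Ω) (hn : n + 1 ≤ m) : ContDiffOn ℝ n (dw f) Ω :=
  (hf.fderiv_of_isOpen hΩ hn).clm_apply contDiffOn_const

theorem fderiv_apply_eq (f : ℝ × ℝ → ℝ) (z v : ℝ × ℝ) :
    fderiv ℝ f z v = v.1 * du f z + v.2 * dw f z := by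
  have : v = v.1 • ((1, 0) : ℝ × ℝ) + v.2 • ((0, 1) : ℝ × ℝ) := by ext <;> simp
  conv_lhs => rw [this]
  rw [map_add, map_smul, map_smul]
  rfl

theorem du_dw_comm {f : ℝ × ℝ → ℝ} {Ω : Set (ℝ × ℝ)} (hf : ContDiffOn ℝ 2 f Ω) (hΩ : IsOpen Ω)
    {z : ℝ × ℝ} (hz : z ∈ Ω) : du (dw f) z = dw (du f) z := by
  have hc : ContDiffAt ℝ 2 f z := hf.contDiffAt (hΩ.mem_nhds hz)
  have hs : IsSymmSndFDerivAt ℝ f z := hc.isSymmSndFDerivAt (by simp)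
  have hd : DifferentiableAt ℝ (fderiv ℝ f) z :=
    (hc.fderiv_right (m := 1) (by norm_num)).differentiableAt (by norm_num)
  have key : ∀ v w : ℝ × ℝ, fderiv ℝ (fun x => fderiv ℝ f x v) z w =
      fderiv ℝ (fderiv ℝ f) z w v := by
    intro v w
    rw [fderiv_clm_apply hd (differentiableAt_const v)]
    simp
  have h1 : du (dw f) z = fderiv ℝ (fderiv ℝ f) z (1, 0) (0, 1) := key (0, 1) (1, 0)
  have h2 : dw (du f) z = fderiv ℝ (fderiv ℝ f) z (0, 1) (1, 0) := key (1, 0) (0, 1)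
  rw [h1, h2]
  exact hs _ _

theorem hasDerivAt_axis {f : ℝ × ℝ → ℝ} {u : ℝ} (hf : DifferentiableAt ℝ f (u, 0)) :
    HasDerivAt (fun t : ℝ => f (t, 0)) (du f (u, 0)) u :=
  HasFDerivAt.comp_hasDerivAt u hf.hasFDerivAt
    ((hasDerivAt_id u).prodMk (hasDerivAt_const u (0 : ℝ)))

end Calculus

/-! ### Geodesic curvature of the end locus. -/

section Curvature

open Set Filter Metric

variable {αc : S3 → ℝ} {p : E3} {k : WithTop ℕ∞} {h : ℝ × ℝ → ℝ}

/-- Differentiate `localFn` along (u, h(u, 0), 0), where it vanishes: its τ-derivative at 0 is zero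
and its ν-derivative is not. -/
theorem du_zero (hk : 1 ≤ k) (hα : ContMDiff (𝓡 3) 𝓘(ℝ, ℝ) k αc) (hp : IsRegularEndPoint αc p)
    (h0 : h 0 = 0) {Ω : Set (ℝ × ℝ)} (hΩo : IsOpen Ω) (hΩ0 : (0 : ℝ × ℝ) ∈ Ω)
    (hΩ : ContDiffOn ℝ k h Ω) (hΩz : ∀ z ∈ Ω, localFn αc p (z.1, h z, z.2) = 0) :
    du h 0 = 0 := by
  have hk0 : k ≠ 0 := by positivity
  have hd : DifferentiableAt ℝ h ((0 : ℝ), (0 : ℝ)) :=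
    (hΩ.differentiableOn hk0).differentiableAt (hΩo.mem_nhds hΩ0)
  have h1 := hasDerivAt_axis hd
  have h2 : HasDerivAt (fun t : ℝ => (t, h (t, 0), (0 : ℝ))) (1, du h (0, 0), 0) 0 :=
    (hasDerivAt_id 0).prodMk (h1.prodMk (hasDerivAt_const _ _))
  have hF : DifferentiableAt ℝ (localFn αc p) 0 := (contDiff_localFn hα hp).differentiable hk0 0
  have h3 := HasFDerivAt.comp_hasDerivAt_of_eq (0 : ℝ) hF.hasFDerivAt h2
    (by simp only [Prod.mk_zero_zero, h0])
  have h4 : HasDerivAt (localFn αc p ∘ fun t : ℝ => (t, h (t, 0), (0 : ℝ))) 0 0 := by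
    refine (hasDerivAt_const (0 : ℝ) (0 : ℝ)).congr_of_eventuallyEq ?_
    have : ∀ᶠ u : ℝ in 𝓝 0, (u, (0 : ℝ)) ∈ Ω :=
      (by fun_prop : Continuous fun u : ℝ => (u, (0 : ℝ))).continuousAt.eventually
        (hΩo.mem_nhds hΩ0)
    exact this.mono fun u hu => hΩz (u, 0) hu
  have h5 := h3.unique h4
  obtain ⟨e1, e2⟩ := hasFDerivAt_localFn_zero hk hα hp
  have e3 : ((1 : ℝ), du h (0, 0), (0 : ℝ)) = (1, 0, 0) + du h (0, 0) • ((0 : ℝ), (1 : ℝ), (0 : ℝ)) := by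
    simp
  rw [e3, map_add, map_smul, e1, zero_add, smul_eq_mul] at h5
  exact (mul_eq_zero.1 h5).resolve_right e2.ne'

/-- Geodesic curvature of a curve in the sphere that projects to the graph of `H`. -/
theorem geodesicCurvature_eq (hp : IsRegularEndPoint αc p) {c : ℝ → E3} (hc : ContDiffAt ℝ 2 c 0)
    (hc0 : c 0 = p) {r : ℝ} (hr : 0 < r) (hcr : deriv c 0 = r • tangentVec αc p) {H H' : ℝ → ℝ}
    {a : ℝ} (hH : ∀ᶠ u in 𝓝 0, HasDerivAt H (H' u) u) (hH' : HasDerivAt H' a 0) (hH0 : H 0 = 0)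
    (hH'0 : H' 0 = 0)
    (hgraph : ∀ᶠ t in 𝓝 0, (inner ℝ (normalVec αc p) (c t) : ℝ) / inner ℝ p (c t) =
      H (inner ℝ (tangentVec αc p) (c t) / inner ℝ p (c t))) :
    geodesicCurvature c 0 = -a := by
  have hcd : ∀ᶠ t in 𝓝 0, HasDerivAt c (deriv c t) t := by
    filter_upwards [hc.eventually (by simp)] with t ht
    exact (ht.differentiableAt (by simp)).hasDerivAt
  have hcd2 : HasDerivAt (deriv c) (deriv (deriv c) 0) 0 := by
    have h1 := (hc.fderiv_right (m := 1) (by norm_num)).differentiableAt (by simp)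
    have h2 : DifferentiableAt ℝ (fun t => fderiv ℝ c t 1) 0 :=
      h1.clm_apply (differentiableAt_const _)
    exact h2.hasDerivAt
  have hin : ∀ (y : E3) {f : ℝ → E3} {f' : E3} {t : ℝ}, HasDerivAt f f' t →
      HasDerivAt (fun t => (inner ℝ y (f t) : ℝ)) (inner ℝ y f') t := by
    intro y f f' t hf
    simpa using (hasDerivAt_const t y).inner ℝ hf
  set P : ℝ → ℝ := fun t => inner ℝ p (c t) with hP
  set S : ℝ → ℝ := fun t => inner ℝ (tangentVec αc p) (c t) with hS
  set N : ℝ → ℝ := fun t => inner ℝ (normalVec αc p) (c t) with hN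
  have hP0 : P 0 = 1 := by simp only [hP, hc0]; exact inner_p_p hp
  have hS0 : S 0 = 0 := by simp only [hS, hc0]; exact inner_tangentVec_p
  set P' : ℝ → ℝ := fun t => inner ℝ p (deriv c t) with hP'
  set S' : ℝ → ℝ := fun t => inner ℝ (tangentVec αc p) (deriv c t) with hS'
  have hP'0 : P' 0 = 0 := by
    simp only [hP', hcr]; rw [real_inner_smul_right, inner_p_tangentVec, mul_zero]
  have hS'0 : S' 0 = r := by
    simp only [hS', hcr]; rw [real_inner_smul_right, inner_tangentVec_self hp, mul_one]
  have hPpos : ∀ᶠ t in 𝓝 0, P t ≠ 0 := by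
    have : ContinuousAt P 0 := (hin p hcd.self_of_nhds).continuousAt
    exact this.eventually_ne (by rw [hP0]; exact one_ne_zero)
  set σ : ℝ → ℝ := fun t => S t / P t with hσ
  set σ' : ℝ → ℝ := fun t => (S' t * P t - S t * P' t) / P t ^ 2 with hσ'
  have hσd : ∀ᶠ t in 𝓝 0, HasDerivAt σ (σ' t) t := by
    filter_upwards [hcd, hPpos] with t h1 h2
    exact (hin (tangentVec αc p) h1).div (hin p h1) h2
  have hσ0 : σ 0 = 0 := by simp [hσ, hS0]
  have hσ'0 : σ' 0 = r := by simp [hσ', hP0, hS'0, hS0]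
  have hσ'd : ∃ s, HasDerivAt σ' s 0 := by
    have a1 := hin (tangentVec αc p) hcd2
    have a2 := hin p hcd2
    have a3 := hin (tangentVec αc p) hcd.self_of_nhds
    have a4 := hin p hcd.self_of_nhds
    exact ⟨_, ((a1.mul a4).sub (a3.mul a2)).div (a4.fun_pow 2) (pow_ne_zero 2 hPpos.self_of_nhds)⟩
  obtain ⟨s, hσ'd⟩ := hσ'd
  have hσt : Tendsto σ (𝓝 0) (𝓝 0) := by
    have := hσd.self_of_nhds.continuousAt.tendsto
    rwa [hσ0] at this
  -- N = P · H(S / P) is differentiated twice at 0. As H = H' = 0, P = 1, P' = 0 and σ' = r there,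
  -- only a r² is left.
  have hNeq : N =ᶠ[𝓝 0] fun t => P t * H (σ t) := by
    filter_upwards [hgraph, hPpos] with t h1 h2
    have h3 : N t / P t = H (σ t) := h1
    rw [← h3]
    field_simp
  have hNd : (fun t => (inner ℝ (normalVec αc p) (deriv c t) : ℝ)) =ᶠ[𝓝 0]
      fun t => P' t * H (σ t) + P t * (H' (σ t) * σ' t) := by
    filter_upwards [hcd, hσd, hσt.eventually hH, hNeq.eventuallyEq_nhds] with t h1 h2 h3 h4
    have e1 := ((hin p h1).mul (h3.comp t h2)).congr_of_eventuallyEq h4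
    exact (hin (normalVec αc p) h1).unique e1
  have hHσ : HasDerivAt (fun t => H (σ t)) (H' (σ 0) * σ' 0) 0 :=
    HasDerivAt.comp 0 (by rw [hσ0]; exact hH.self_of_nhds) hσd.self_of_nhds
  have hH'σ : HasDerivAt (fun t => H' (σ t)) (a * σ' 0) 0 :=
    HasDerivAt.comp 0 (by rw [hσ0]; exact hH') hσd.self_of_nhds
  have hmain := ((hin p hcd2).mul hHσ).add
    ((hin p hcd.self_of_nhds).mul (hH'σ.mul hσ'd))
  have hfin := (hin (normalVec αc p) hcd2).unique (hmain.congr_of_eventuallyEq hNd)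
  have hfin' : inner ℝ (normalVec αc p) (deriv (deriv c) 0) = a * r * r := by
    rw [hfin]
    change (_ : ℝ) * H (σ 0) + P' 0 * _ + (P' 0 * _ + P 0 * (a * σ' 0 * σ' 0 + H' (σ 0) * s)) = _
    rw [hσ0, hH0, hH'0, hP'0, hP0, hσ'0]
    ring
  have hτn : ‖tangentVec αc p‖ = 1 := by
    have := inner_tangentVec_self hp
    rw [real_inner_self_eq_norm_sq] at this
    nlinarith [norm_nonneg (tangentVec αc p)]
  rw [geodesicCurvature, hc0, hcr, cross_smul, cross_p_tangentVec hp, real_inner_smul_left,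
    inner_neg_left, hfin', norm_smul, hτn, mul_one, Real.norm_of_nonneg hr.le]
  field_simp

/-- Every admissible curve satisfies v = h(u, 0) near p, so its curvature does not depend on the
choice; `endCurve` shows that an admissible curve exists. -/
theorem endLocusHasGeodesicCurvature_iff (hk : 3 ≤ k) (hα : ContMDiff (𝓡 3) 𝓘(ℝ, ℝ) k αc)
    (hp : IsRegularEndPoint αc p) (hh : IsEndChart k αc p h) (κ : ℝ) :
    EndLocusHasGeodesicCurvature αc p κ ↔ κ = -coeffA h := by
  have hk1 : 1 ≤ k := le_trans (by norm_num) hk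
  have hk2 : 2 ≤ k := le_trans (by norm_num) hk
  have hαc : Continuous (localFn αc p) := (contDiff_localFn hα hp).continuous
  obtain ⟨Ω, hΩo, hΩ0, hΩ, hΩz⟩ := hh.exists_domain hαc hp
  obtain ⟨G, hGo, hG0, hG⟩ := hh.exists_nhds
  have h0 := hh.map_zero hαc hp
  have hu0 := du_zero hk1 hα hp h0 hΩo hΩ0 hΩ hΩz
  have hax : ∀ᶠ u : ℝ in 𝓝 0, (u, (0 : ℝ)) ∈ Ω :=
    (by fun_prop : Continuous fun u : ℝ => (u, (0 : ℝ))).continuousAt.eventually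
      (hΩo.mem_nhds hΩ0)
  have hH : ∀ᶠ u : ℝ in 𝓝 0, HasDerivAt (fun u => h (u, 0)) (du h (u, 0)) u := by
    filter_upwards [hax] with u hu
    exact hasDerivAt_axis ((hΩ.differentiableOn (by positivity)).differentiableAt
      (hΩo.mem_nhds hu))
  have hH' : HasDerivAt (fun u => du h (u, 0)) (coeffA h) 0 := by
    have h1 : ContDiffOn ℝ 1 (du h) Ω := hΩ.du hΩo (le_trans (by norm_num) hk2)
    exact hasDerivAt_axis (u := 0) ((h1.differentiableOn (by simp)).differentiableAt
      (hΩo.mem_nhds hΩ0))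
  have key : ∀ c : ℝ → E3, ContDiffAt ℝ 2 c 0 → c 0 = p → (∀ᶠ t in 𝓝 0, c t ∈ endLocus αc) →
      ∀ r : ℝ, 0 < r → deriv c 0 = r • tangentVec αc p → geodesicCurvature c 0 = -coeffA h := by
    intro c hc hc0 hcE r hr hcr
    refine geodesicCurvature_eq hp hc hc0 hr hcr hH hH' h0 hu0 ?_
    have hcc : ContinuousAt c 0 := hc.continuousAt
    have hin : ∀ y : E3, ContinuousAt (fun t => (inner ℝ y (c t) : ℝ)) 0 := fun y =>
      continuousAt_const.inner hcc
    have hpos : ∀ᶠ t in 𝓝 0, 0 < (inner ℝ p (c t) : ℝ) := by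
      refine (hin p).eventually_const_lt ?_
      simp only [hc0]
      rw [inner_p_p hp]
      exact one_pos
    have hne : (inner ℝ p (c 0) : ℝ) ≠ 0 := by rw [hc0, inner_p_p hp]; exact one_ne_zero
    have hg : ContinuousAt (fun t => ((inner ℝ (tangentVec αc p) (c t) : ℝ) / inner ℝ p (c t),
        (inner ℝ (normalVec αc p) (c t) : ℝ) / inner ℝ p (c t), (0 : ℝ))) 0 :=
      ((hin _).div (hin _) hne).prodMk (((hin _).div (hin _) hne).prodMk continuousAt_const)
    have hmem := hg.eventually (hGo.mem_nhds (by
      simp only [hc0, inner_tangentVec_p, inner_normalVec_p hp, zero_div]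
      exact hG0))
    filter_upwards [hcE, hpos, hmem] with t h1 h2 h3
    exact (hG _ h3).1 (localFn_eq_zero_of_mem_endLocus hαc hp h1 h2)
  constructor
  · rintro ⟨c, hc, hc0, hcE, ⟨r, hr, hcr⟩, hκ⟩
    rw [← hκ]
    exact key c hc hc0 hcE r hr hcr
  · rintro rfl
    obtain ⟨ε, hε, hεs⟩ := Metric.eventually_nhds_iff_ball.1 hax
    have hcd : ContDiffAt ℝ 2 (endCurve αc p h) 0 :=
      ((contDiffOn_endCurve hp hΩ hεs).contDiffAt (ball_mem_nhds 0 hε)).of_le hk2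
    have hE : ∀ᶠ t in 𝓝 0, endCurve αc p h t ∈ endLocus αc := by
      filter_upwards [hax] with t ht
      exact endCurve_mem_endLocus hp hΩo hΩ.continuousOn hΩz ht
    have hder : deriv (endCurve αc p h) 0 = (1 : ℝ) • tangentVec αc p := by
      have hx : HasDerivAt (fun u : ℝ => p + u • tangentVec αc p + h (u, 0) • normalVec αc p)
          (tangentVec αc p) 0 := by
        have h1 := (((hasDerivAt_id (0 : ℝ)).smul_const (tangentVec αc p)).const_add p).add
          (hH.self_of_nhds.smul_const (normalVec αc p))
        have h2 : du h ((0 : ℝ), (0 : ℝ)) = 0 := hu0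
        rw [h2, zero_smul, one_smul, add_zero] at h1
        exact h1
      have hx0 : p + (0 : ℝ) • tangentVec αc p + h (0, 0) • normalVec αc p = p := by
        have : h ((0 : ℝ), (0 : ℝ)) = 0 := h0
        rw [this]; simp
      -- The squared norm has derivative 2⟨p, τ⟩ = 0 at 0, so normalization does not affect the
      -- velocity there.
      have hn : HasDerivAt (fun u : ℝ => ‖p + u • tangentVec αc p +
          h (u, 0) • normalVec αc p‖⁻¹) 0 0 := by
        have h1 := hx.norm_sq
        rw [hx0, inner_p_tangentVec, mul_zero] at h1
        have h2 : HasDerivAt (fun u : ℝ => (√(‖p + u • tangentVec αc p +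
          h (u, 0) • normalVec αc p‖ ^ 2))⁻¹) _ 0 := (h1.sqrt (by
            rw [hx0, norm_eq_one_of_mem_endLocus hp.1]; norm_num)).inv (by
            rw [hx0, norm_eq_one_of_mem_endLocus hp.1]; norm_num)
        simpa [Real.sqrt_sq (norm_nonneg _)] using h2
      have h3 := hn.smul hx
      rw [hx0, norm_eq_one_of_mem_endLocus hp.1, zero_smul, add_zero, inv_one] at h3
      exact h3.deriv
    exact ⟨endCurve αc p h, hcd, endCurve_zero hp h0, hE, ⟨1, one_pos, hder⟩,
      key _ hcd (endCurve_zero hp h0) hE 1 one_pos hder⟩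

theorem isBiregularEndPoint_iff (hk : 3 ≤ k) (hα : ContMDiff (𝓡 3) 𝓘(ℝ, ℝ) k αc)
    (hp : IsRegularEndPoint αc p) (hh : IsEndChart k αc p h) :
    IsBiregularEndPoint αc p ↔ coeffA h ≠ 0 := by
  simp [IsBiregularEndPoint, hp, endLocusHasGeodesicCurvature_iff hk hα hp hh]

theorem isInflexionEndPoint_iff (hk : 3 ≤ k) (hα : ContMDiff (𝓡 3) 𝓘(ℝ, ℝ) k αc)
    (hp : IsRegularEndPoint αc p) (hh : IsEndChart k αc p h) :
    IsInflexionEndPoint αc p ↔ coeffA h = 0 := by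
  simp [IsInflexionEndPoint, hp, endLocusHasGeodesicCurvature_iff hk hα hp hh]

end Curvature

/-! ### Solution directions of the extended equation are principal. -/

section Principal

open Set Filter Metric

variable {αc : S3 → ℝ} {p : E3} {k : WithTop ℕ∞} {h : ℝ × ℝ → ℝ}

theorem hasFDerivAt_div_snd {f : ℝ × ℝ → ℝ} {f' : (ℝ × ℝ) →L[ℝ] ℝ} {z : ℝ × ℝ}
    (hf : HasFDerivAt f f' z) (hz : z.2 ≠ 0) :
    HasFDerivAt (fun z => f z / z.2)
      ((z.2 ^ 2)⁻¹ • (z.2 • f' - f z • ContinuousLinearMap.snd ℝ ℝ ℝ)) z := by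
  have h1 : HasFDerivAt (fun z : ℝ × ℝ => z.2⁻¹)
      (-(z.2 ^ 2)⁻¹ • ContinuousLinearMap.snd ℝ ℝ ℝ) z :=
    (hasDerivAt_inv hz).comp_hasFDerivAt z hasFDerivAt_snd
  have h2 := hf.mul h1
  refine (h2.congr_fderiv ?_).congr_of_eventuallyEq (Eventually.of_forall fun x => ?_)
  · ext <;> simp <;> field_simp
    ring
  · exact div_eq_mul_inv _ _

/-- The derivative of the chart, in the frame `τ, ν, p`. -/
theorem hasFDerivAt_chart {z : ℝ × ℝ} (hd : DifferentiableAt ℝ h z) (hz : z.2 ≠ 0) :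
    ∃ T : (ℝ × ℝ) →L[ℝ] E3, HasFDerivAt (chart αc p h) T z ∧ ∀ v : ℝ × ℝ,
      T v = ((z.2 * v.1 - z.1 * v.2) / z.2 ^ 2) • tangentVec αc p +
        ((z.2 * (v.1 * du h z + v.2 * dw h z) - h z * v.2) / z.2 ^ 2) • normalVec αc p +
        (-v.2 / z.2 ^ 2) • p := by
  have h1 := ((hasFDerivAt_div_snd (hasFDerivAt_fst (𝕜 := ℝ) (p := z)) hz).smul_const
    (tangentVec αc p)).add ((hasFDerivAt_div_snd hd.hasFDerivAt hz).smul_const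
    (normalVec αc p)) |>.add ((hasFDerivAt_div_snd (hasFDerivAt_const (1 : ℝ) z) hz).smul_const p)
  refine ⟨_, h1, fun v => ?_⟩
  have e := fderiv_apply_eq h z v
  simp only [_root_.add_apply, ContinuousLinearMap.smulRight_apply,
    _root_.smul_apply, _root_.sub_apply, ContinuousLinearMap.coe_fst',
    ContinuousLinearMap.coe_snd', _root_.zero_apply, e, smul_eq_mul]
  congr 1
  · congr 1 <;> congr 1 <;> rw [div_eq_inv_mul]
  · congr 1
    rw [div_eq_inv_mul]
    ring

/-- The normal vector of the surface in the chart. -/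
noncomputable def normalFn (αc : S3 → ℝ) (p : E3) (h : ℝ × ℝ → ℝ) (z : ℝ × ℝ) : E3 :=
  (-du h z) • tangentVec αc p + (1 : ℝ) • normalVec αc p +
    (z.2 * dw h z - h z + z.1 * du h z) • p

theorem hasFDerivAt_normalFn {z : ℝ × ℝ} (hd : DifferentiableAt ℝ h z)
    (hdu : DifferentiableAt ℝ (du h) z) (hdw : DifferentiableAt ℝ (dw h) z) :
    ∃ T : (ℝ × ℝ) →L[ℝ] E3, HasFDerivAt (normalFn αc p h) T z ∧ ∀ v : ℝ × ℝ,
      T v = (-fderiv ℝ (du h) z v) • tangentVec αc p + (0 : ℝ) • normalVec αc p +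
        (z.2 * fderiv ℝ (dw h) z v + z.1 * fderiv ℝ (du h) z v) • p := by
  have h1 := ((hdu.hasFDerivAt.neg.smul_const (tangentVec αc p)).add_const
    ((1 : ℝ) • normalVec αc p)).add
    (((((hasFDerivAt_snd (𝕜 := ℝ) (p := z)).mul hdw.hasFDerivAt).sub hd.hasFDerivAt).add
    ((hasFDerivAt_fst (𝕜 := ℝ) (p := z)).mul hdu.hasFDerivAt)).smul_const p)
  refine ⟨_, h1, fun v => ?_⟩
  have e := fderiv_apply_eq h z v
  simp only [_root_.add_apply, ContinuousLinearMap.smulRight_apply,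
    _root_.smul_apply, _root_.sub_apply, ContinuousLinearMap.coe_fst',
    ContinuousLinearMap.coe_snd', _root_.neg_apply, e, smul_eq_mul, zero_smul,
    add_zero]
  congr 2
  ring

theorem gradient_eq_frame_sum (hp : IsRegularEndPoint αc p) (f : E3 → ℝ) (x : E3) :
    gradient f x = (fderiv ℝ f x (tangentVec αc p)) • tangentVec αc p +
      (fderiv ℝ f x (normalVec αc p)) • normalVec αc p + (fderiv ℝ f x p) • p := by
  have key : ∀ y : E3, (inner ℝ y (gradient f x) : ℝ) = fderiv ℝ f x y := by
    intro y
    rw [real_inner_comm, gradient, InnerProductSpace.toDual_symm_apply]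
  rw [eq_frame_sum hp (gradient f x)]
  simp only [key]

theorem inner_gradient_eq (f : E3 → ℝ) (x y : E3) :
    (inner ℝ (gradient f x) y : ℝ) = fderiv ℝ f x y := by
  rw [gradient, InnerProductSpace.toDual_symm_apply]

theorem contDiffAt_affineFn (hα : ContMDiff (𝓡 3) 𝓘(ℝ, ℝ) k αc) (hp : IsRegularEndPoint αc p)
    {q : E3} (hq : 0 < (inner ℝ p q : ℝ)) : ContDiffAt ℝ k (affineFn αc) q := by
  have h1 : ContDiffAt ℝ k (fun q : E3 => localFn αc p (inner ℝ (tangentVec αc p) q / inner ℝ p q,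
        inner ℝ (normalVec αc p) q / inner ℝ p q, 1 / inner ℝ p q)) q := by
    have hin : ∀ y : E3, ContDiffAt ℝ k (fun q : E3 => (inner ℝ y q : ℝ)) q := fun y =>
      contDiffAt_const.inner ℝ contDiffAt_id
    exact (contDiff_localFn hα hp).contDiffAt.comp q (((hin _).div (hin _) hq.ne').prodMk
      (((hin _).div (hin _) hq.ne').prodMk (contDiffAt_const.div (hin _) hq.ne')))
  refine h1.congr_of_eventuallyEq ?_
  have : ContinuousAt (fun q : E3 => (inner ℝ p q : ℝ)) q := by fun_prop
  filter_upwards [this.eventually_const_lt hq] with x hx using affineFn_eq_localFn hp hx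

theorem inner_p_chart (hp : IsRegularEndPoint αc p) (z : ℝ × ℝ) :
    inner ℝ p (chart αc p h z) = 1 / z.2 := by
  simp only [chart, inner_add_right, real_inner_smul_right]
  rw [inner_p_p hp, inner_p_normalVec hp, inner_p_tangentVec]
  ring

theorem inner_tangentVec_chart (hp : IsRegularEndPoint αc p) (z : ℝ × ℝ) :
    inner ℝ (tangentVec αc p) (chart αc p h z) = z.1 / z.2 := by
  simp only [chart, inner_add_right, real_inner_smul_right]
  rw [inner_tangentVec_p, inner_tangentVec_normalVec, inner_tangentVec_self hp]
  ring

theorem inner_normalVec_chart (hp : IsRegularEndPoint αc p) (z : ℝ × ℝ) :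
    inner ℝ (normalVec αc p) (chart αc p h z) = h z / z.2 := by
  simp only [chart, inner_add_right, real_inner_smul_right]
  rw [inner_normalVec_p hp, inner_normalVec_self hp, inner_normalVec_tangentVec]
  ring

theorem affineFn_chart_add (hp : IsRegularEndPoint αc p) {z : ℝ × ℝ} (hz : 0 < z.2) (t : ℝ) :
    affineFn αc (chart αc p h z + t • normalVec αc p) =
      localFn αc p (z.1, h z + z.2 * t, z.2) := by
  have h1 : inner ℝ p (chart αc p h z + t • normalVec αc p) = 1 / z.2 := by
    rw [inner_add_right, inner_p_chart hp, real_inner_smul_right, inner_p_normalVec hp]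
    ring
  rw [affineFn_eq_localFn hp (by rw [h1]; positivity), h1, inner_add_right, inner_add_right,
    inner_tangentVec_chart hp, inner_normalVec_chart hp, real_inner_smul_right,
    real_inner_smul_right, inner_tangentVec_normalVec, inner_normalVec_self hp]
  congr 3
  · field_simp; ring
  · field_simp
  · rw [one_div_one_div]

/-- A vector orthogonal to the tangent plane of the chart is a multiple of the normal. -/
theorem eq_smul_normalFn (hp : IsRegularEndPoint αc p) {z : ℝ × ℝ} (hz : z.2 ≠ 0)
    {T : (ℝ × ℝ) →L[ℝ] E3} (hT : ∀ v : ℝ × ℝ,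
      T v = ((z.2 * v.1 - z.1 * v.2) / z.2 ^ 2) • tangentVec αc p +
        ((z.2 * (v.1 * du h z + v.2 * dw h z) - h z * v.2) / z.2 ^ 2) • normalVec αc p +
        (-v.2 / z.2 ^ 2) • p) {Y : E3} (hY : ∀ v, (inner ℝ Y (T v) : ℝ) = 0) :
    Y = (inner ℝ (normalVec αc p) Y : ℝ) • normalFn αc p h z := by
  have e1 := hY (1, 0)
  have e2 := hY (0, 1)
  have hYs := eq_frame_sum hp Y
  set y₁ : ℝ := inner ℝ (tangentVec αc p) Y
  set y₂ : ℝ := inner ℝ (normalVec αc p) Y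
  set y₃ : ℝ := inner ℝ p Y
  rw [hT, hYs, inner_frame hp] at e1 e2
  simp only [mul_one, mul_zero, sub_zero, zero_add, add_zero, one_mul, zero_mul, neg_zero,
    zero_div, zero_sub] at e1 e2
  have f1 : y₁ = -du h z * y₂ := by
    field_simp at e1
    linarith
  have f2 : y₃ = (z.2 * dw h z - h z + z.1 * du h z) * y₂ := by
    field_simp at e2
    rw [f1] at e2
    linarith
  rw [hYs, normalFn, f1, f2]
  simp only [smul_add, smul_smul]
  congr 1
  · congr 1
    · rw [mul_comm]
    · rw [mul_one]
  · rw [mul_comm]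

theorem normalFn_ne_zero (hp : IsRegularEndPoint αc p) (z : ℝ × ℝ) : normalFn αc p h z ≠ 0 := by
  intro h0
  have h1 : inner ℝ (normalVec αc p) (normalFn αc p h z) = (1 : ℝ) := by
    simp only [normalFn, inner_add_right, real_inner_smul_right]
    rw [inner_normalVec_p hp, inner_normalVec_self hp, inner_normalVec_tangentVec]
    ring
  rw [h0, inner_zero_right] at h1
  exact zero_ne_one h1

/-- `w⁴` times the first fundamental form of the chart. -/
noncomputable def firstForm (h : ℝ × ℝ → ℝ) (z v : ℝ × ℝ) : ℝ :=
  z.2 ^ 2 * (1 + du h z ^ 2) * v.1 ^ 2 +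
    2 * (z.2 * (du h z * (z.2 * dw h z - h z) - z.1)) * (v.1 * v.2) +
    (1 + z.1 ^ 2 + (z.2 * dw h z - h z) ^ 2) * v.2 ^ 2

/-- A positive multiple of the second fundamental form of the chart. -/
noncomputable def secondForm (h : ℝ × ℝ → ℝ) (z v : ℝ × ℝ) : ℝ :=
  du (du h) z * v.1 ^ 2 + 2 * dw (du h) z * (v.1 * v.2) + dw (dw h) z * v.2 ^ 2

theorem firstForm_pos {z v : ℝ × ℝ} (hz : z.2 ≠ 0) (hv : v ≠ 0) : 0 < firstForm h z v := by
  -- The squared components of w² times the image of v under the derivative of the chart.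
  have e : firstForm h z v = (z.2 * v.1 - z.1 * v.2) ^ 2 +
      (z.2 * v.1 * du h z + (z.2 * dw h z - h z) * v.2) ^ 2 + v.2 ^ 2 := by
    simp only [firstForm]; ring
  rw [e]
  rcases eq_or_ne v.2 0 with h2 | h2
  · have h1 : v.1 ≠ 0 := fun h1 => hv (Prod.ext h1 h2)
    have : 0 < (z.2 * v.1) ^ 2 := by positivity
    rw [h2]
    simp only [mul_zero, sub_zero]
    positivity
  · positivity

/-- The principal curvature in the direction `v`. -/
noncomputable def chartCurvature (αc : S3 → ℝ) (p : E3) (h : ℝ × ℝ → ℝ) (z v : ℝ × ℝ) : ℝ :=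
  z.2 ^ 3 * ‖normalFn αc p h z‖⁻¹ * (secondForm h z v / firstForm h z v)

/-- Up to positive factors for w > 0, this is the determinant of the covectors I(v, ·) and II(v, ·);
its vanishing makes them proportional, which is the principal condition on v. -/
theorem eqForm_eq (z v : ℝ × ℝ) : eqForm h z v =
    (v.1 * dw (du h) z + v.2 * dw (dw h) z) * (z.2 ^ 2 * (1 + du h z ^ 2) * v.1 +
      z.2 * (du h z * (z.2 * dw h z - h z) - z.1) * v.2) -
    (v.1 * du (du h) z + v.2 * dw (du h) z) *
      (z.2 * (du h z * (z.2 * dw h z - h z) - z.1) * v.1 +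
      (1 + z.1 ^ 2 + (z.2 * dw h z - h z) ^ 2) * v.2) := by
  simp only [eqForm, eqL, eqM, eqN]
  ring

/-- With T the derivative of the chart, the vector Y = DN(T v) + κ T v is orthogonal to every
tangent vector, by the proportionality of the two forms at v, and to the normal, because |N| = 1.
Hence Y = 0. -/
theorem exists_nhds_isPrincipalVector (hk : 3 ≤ k) (hα : ContMDiff (𝓡 3) 𝓘(ℝ, ℝ) k αc)
    (hp : IsRegularEndPoint αc p) (hh : IsEndChart k αc p h) : ∃ U ∈ 𝓝 (0 : ℝ × ℝ),
      ∀ z ∈ U, 0 < z.2 → ∀ v : ℝ × ℝ, v ≠ 0 → eqForm h z v = 0 →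
        IsPrincipalVector αc (chart αc p h z) (chartCurvature αc p h z v)
          (fderiv ℝ (chart αc p h) z v) := by
  have hk1 : 1 ≤ k := le_trans (by norm_num) hk
  have hk2 : 2 ≤ k := le_trans (by norm_num) hk
  have hk0 : k ≠ 0 := by positivity
  have hαs := contDiff_localFn hα hp
  obtain ⟨Ω, hΩo, hΩ0, hΩ, hΩz⟩ := hh.exists_domain hαs.continuous hp
  have h0 := hh.map_zero hαs.continuous hp
  have hev : ∀ᶠ z in 𝓝 (0 : ℝ × ℝ), z ∈ Ω ∧
      0 < fderiv ℝ (localFn αc p) (z.1, h z, z.2) (0, 1, 0) := by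
    refine Filter.Eventually.and (hΩo.mem_nhds hΩ0) ?_
    have hc : ContinuousAt (fun z : ℝ × ℝ => (z.1, h z, z.2)) 0 :=
      continuousAt_fst.prodMk ((hΩ.continuousOn.continuousAt (hΩo.mem_nhds hΩ0)).prodMk
        continuousAt_snd)
    have hc' : Continuous (fun X => fderiv ℝ (localFn αc p) X (0, 1, 0)) :=
      (hαs.continuous_fderiv hk0).clm_apply continuous_const
    refine (ContinuousAt.comp (f := fun z : ℝ × ℝ => (z.1, h z, z.2))
      (g := fun X => fderiv ℝ (localFn αc p) X (0, 1, 0)) hc'.continuousAt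
      hc).eventually_const_lt ?_
    have : (((0 : ℝ × ℝ).1, h 0, (0 : ℝ × ℝ).2) : ℝ × ℝ × ℝ) = 0 := by rw [h0]; rfl
    simp only [Function.comp_apply]
    rw [this]
    exact (hasFDerivAt_localFn_zero hk1 hα hp).2
  obtain ⟨U, hU, hUo, hU0⟩ := _root_.eventually_nhds_iff.1 hev
  have hUΩ : U ⊆ Ω := fun z hz => (hU z hz).1
  have hdiff : ∀ z ∈ U, DifferentiableAt ℝ h z ∧ DifferentiableAt ℝ (du h) z ∧
      DifferentiableAt ℝ (dw h) z := by
    intro z hz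
    have hm := hΩo.mem_nhds (hUΩ hz)
    have hle : (1 : WithTop ℕ∞) + 1 ≤ k := le_trans (by norm_num) hk2
    exact ⟨(hΩ.differentiableOn hk0).differentiableAt hm,
      ((hΩ.du hΩo hle).differentiableOn one_ne_zero).differentiableAt hm,
      ((hΩ.dw hΩo hle).differentiableOn one_ne_zero).differentiableAt hm⟩
  have hsurf : ∀ z ∈ U, 0 < z.2 → affineFn αc (chart αc p h z) = 0 := by
    intro z hz hz2
    have := affineFn_chart_add (h := h) hp hz2 0
    rw [zero_smul, add_zero, mul_zero, add_zero] at this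
    rw [this]
    exact hΩz z (hUΩ hz)
  have hq : ∀ z : ℝ × ℝ, 0 < z.2 → 0 < (inner ℝ p (chart αc p h z) : ℝ) := by
    intro z hz
    rw [inner_p_chart hp]
    positivity
  set U' : Set (ℝ × ℝ) := U ∩ {z | 0 < z.2} with hU'
  have hU'o : IsOpen U' := hUo.inter (isOpen_lt continuous_const continuous_snd)
  -- The function α vanishes along the chart, so its gradient is normal to it. The ν-component is w
  -- times the v-derivative of `localFn`, which is positive near 0; thus the Gauss map is the
  -- normalized `normalFn`, with the right sign.
  have hgrad : ∀ z ∈ U', ∃ g : ℝ, 0 < g ∧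
      gradient (affineFn αc) (chart αc p h z) = g • normalFn αc p h z := by
    rintro z ⟨hz, hz2⟩
    obtain ⟨T, hTd, hT⟩ := hasFDerivAt_chart (αc := αc) (p := p) (hdiff z hz).1 (ne_of_gt hz2)
    have hA : DifferentiableAt ℝ (affineFn αc) (chart αc p h z) :=
      (contDiffAt_affineFn hα hp (hq z hz2)).differentiableAt hk0
    refine ⟨_, ?_, eq_smul_normalFn hp (ne_of_gt hz2) hT fun v => ?_⟩
    · rw [real_inner_comm, inner_gradient_eq]
      have d1 : HasDerivAt (fun t : ℝ => affineFn αc (chart αc p h z + t • normalVec αc p))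
          (fderiv ℝ (affineFn αc) (chart αc p h z) (normalVec αc p)) 0 := by
        have d2 : HasDerivAt (fun t : ℝ => chart αc p h z + t • normalVec αc p)
            (normalVec αc p) 0 := by
          simpa using ((hasDerivAt_id (0 : ℝ)).smul_const (normalVec αc p)).const_add
            (chart αc p h z)
        exact HasFDerivAt.comp_hasDerivAt_of_eq (0 : ℝ) hA.hasFDerivAt d2 (by simp)
      have d3 : HasDerivAt (fun t : ℝ => localFn αc p (z.1, h z + z.2 * t, z.2))
          (fderiv ℝ (localFn αc p) (z.1, h z, z.2) (0, z.2, 0)) 0 := by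
        have d4 : HasDerivAt (fun t : ℝ => (z.1, h z + z.2 * t, z.2)) (0, z.2, 0) 0 := by
          refine (hasDerivAt_const _ _).prodMk (HasDerivAt.prodMk ?_ (hasDerivAt_const _ _))
          simpa using ((hasDerivAt_id (0 : ℝ)).const_mul z.2).const_add (h z)
        exact HasFDerivAt.comp_hasDerivAt_of_eq (0 : ℝ)
          ((hαs.differentiable hk0) (z.1, h z, z.2)).hasFDerivAt d4 (by simp)
      have d5 : (fun t : ℝ => affineFn αc (chart αc p h z + t • normalVec αc p)) =
          fun t : ℝ => localFn αc p (z.1, h z + z.2 * t, z.2) :=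
        funext fun t => affineFn_chart_add hp hz2 t
      rw [d5] at d1
      rw [d1.unique d3]
      have e : ((0 : ℝ), z.2, (0 : ℝ)) = z.2 • ((0 : ℝ), (1 : ℝ), (0 : ℝ)) := by simp
      rw [e, map_smul, smul_eq_mul]
      exact mul_pos hz2 (hU z hz).2
    · rw [inner_gradient_eq]
      have c1 : HasFDerivAt (affineFn αc ∘ chart αc p h) _ z := hA.hasFDerivAt.comp z hTd
      have c2 : HasFDerivAt (affineFn αc ∘ chart αc p h) (0 : (ℝ × ℝ) →L[ℝ] ℝ) z := by
        refine (hasFDerivAt_const (0 : ℝ) z).congr_of_eventuallyEq ?_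
        filter_upwards [hU'o.mem_nhds ⟨hz, hz2⟩] with x hx using hsurf x hx.1 hx.2
      exact congrArg (fun S : (ℝ × ℝ) →L[ℝ] ℝ => S v) (c1.unique c2)
  have hgauss : ∀ z ∈ U', gaussMap αc (chart αc p h z) =
      ‖normalFn αc p h z‖⁻¹ • normalFn αc p h z := by
    intro z hz
    obtain ⟨g, hg, hgz⟩ := hgrad z hz
    rw [gaussMap, hgz, norm_smul, Real.norm_of_nonneg hg.le, smul_smul, mul_inv, mul_comm g⁻¹,
      mul_assoc, inv_mul_cancel₀ hg.ne', mul_one]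
  refine ⟨U, hUo.mem_nhds hU0, fun z hz hz2 v hv hzv => ?_⟩
  have hz2' : z.2 ≠ 0 := ne_of_gt hz2
  obtain ⟨hd, hdu, hdw⟩ := hdiff z hz
  obtain ⟨T, hTd, hT⟩ := hasFDerivAt_chart (αc := αc) (p := p) hd hz2'
  obtain ⟨S, hSd, hS⟩ := hasFDerivAt_normalFn (αc := αc) (p := p) hd hdu hdw
  obtain ⟨g, hg, hgz⟩ := hgrad z ⟨hz, hz2⟩
  have hn0 := normalFn_ne_zero (h := h) hp z
  have hG0 : gradient (affineFn αc) (chart αc p h z) ≠ 0 := by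
    rw [hgz]; exact smul_ne_zero hg.ne' hn0
  have hnT : ∀ x, (inner ℝ (normalFn αc p h z) (T x) : ℝ) = 0 := by
    intro x
    rw [normalFn, hT, inner_frame hp]
    field_simp
    ring
  have hTv : T v ≠ 0 := by
    intro hTv
    have e : (inner ℝ (T v) (T v) : ℝ) = firstForm h z v / z.2 ^ 4 := by
      rw [hT, inner_frame hp, firstForm]
      field_simp
      ring
    rw [hTv, inner_zero_right] at e
    have := firstForm_pos (h := h) hz2' hv
    have : 0 < firstForm h z v / z.2 ^ 4 := by positivity
    linarith
  rw [hTd.fderiv]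
  refine ⟨hsurf z hz hz2, hG0, hTv, ?_, ?_⟩
  · rw [hgz, real_inner_smul_left, hnT, mul_zero]
  -- the unit normal along the chart
  set c : ℝ × ℝ → ℝ := fun x => ‖normalFn αc p h x‖⁻¹ with hc
  have hcd : DifferentiableAt ℝ c z :=
    (hSd.differentiableAt.norm ℝ hn0).inv (norm_ne_zero_iff.2 hn0)
  have hNd : HasFDerivAt (fun x => c x • normalFn αc p h x) _ z := hcd.hasFDerivAt.smul hSd
  have hgd : DifferentiableAt ℝ (gaussMap αc) (chart αc p h z) := by
    have h2 : ContDiffAt ℝ 2 (affineFn αc) (chart αc p h z) :=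
      (contDiffAt_affineFn hα hp (hq z hz2)).of_le hk2
    have h3 : DifferentiableAt ℝ (fderiv ℝ (affineFn αc)) (chart αc p h z) :=
      (h2.fderiv_right (m := 1) (by norm_num)).differentiableAt one_ne_zero
    have h4 : DifferentiableAt ℝ (gradient (affineFn αc)) (chart αc p h z) := by
      have h5 : ∀ y : E3, DifferentiableAt ℝ (fun x => fderiv ℝ (affineFn αc) x y)
          (chart αc p h z) := fun y => h3.clm_apply (differentiableAt_const y)
      rw [show gradient (affineFn αc) = _ from funext (gradient_eq_frame_sum hp (affineFn αc))]
      exact (((h5 _).smul_const _).add ((h5 _).smul_const _)).add ((h5 _).smul_const _)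
    exact ((h4.norm ℝ hG0).inv (norm_ne_zero_iff.2 hG0)).smul h4
  have hcomp : HasFDerivAt (fun x => c x • normalFn αc p h x)
      ((fderiv ℝ (gaussMap αc) (chart αc p h z)).comp T) z := by
    refine (hgd.hasFDerivAt.comp z hTd).congr_of_eventuallyEq ?_
    filter_upwards [hU'o.mem_nhds ⟨hz, hz2⟩] with x hx using (hgauss x hx).symm
  have hDN := congrArg (fun L : (ℝ × ℝ) →L[ℝ] E3 => L v) (hcomp.unique hNd)
  simp only [ContinuousLinearMap.comp_apply, _root_.add_apply,
    _root_.smul_apply, ContinuousLinearMap.smulRight_apply] at hDN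
  -- Differentiate the constant squared norm of the unit normal along the chart.
  have hunit : (inner ℝ (normalFn αc p h z)
      (fderiv ℝ (gaussMap αc) (chart αc p h z) (T v)) : ℝ) = 0 := by
    have u1 := hNd.norm_sq
    have u2 : (fun x => ‖c x • normalFn αc p h x‖ ^ 2) = fun _ => (1 : ℝ) := by
      funext x
      have := norm_ne_zero_iff.2 (normalFn_ne_zero (h := h) hp x)
      rw [hc, norm_smul, norm_inv, norm_norm, inv_mul_cancel₀ this, one_pow]
    rw [u2] at u1
    have u3 := congrArg (fun L : (ℝ × ℝ) →L[ℝ] ℝ => L v) (u1.unique (hasFDerivAt_const 1 z))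
    simp only [_root_.smul_apply, ContinuousLinearMap.comp_apply,
      innerSL_apply_apply, _root_.add_apply, ContinuousLinearMap.smulRight_apply,
      _root_.zero_apply] at u3
    rw [← hDN, real_inner_smul_left] at u3
    have hc0 : c z ≠ 0 := inv_ne_zero (norm_ne_zero_iff.2 hn0)
    simpa [hc0] using u3
  set κ := chartCurvature αc p h z v with hκ
  set Y := fderiv ℝ (gaussMap αc) (chart αc p h z) (T v) + κ • T v with hY
  have hcomm : du (dw h) z = dw (du h) z := du_dw_comm (hΩ.of_le hk2) hΩo (hUΩ hz)
  have hI := firstForm_pos (h := h) hz2' hv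
  have hYT : ∀ x, (inner ℝ Y (T x) : ℝ) = 0 := by
    intro x
    rw [hY, hDN, inner_add_left, inner_add_left, real_inner_smul_left, real_inner_smul_left,
      real_inner_smul_left, hnT, mul_zero, add_zero, hS, hT, hT, inner_frame hp, inner_frame hp,
      fderiv_apply_eq, fderiv_apply_eq, hcomm, hκ, chartCurvature]
    simp only [hc]
    set n := ‖normalFn αc p h z‖⁻¹
    have e := hzv
    rw [eqForm_eq] at e
    set A := v.1 * du (du h) z + v.2 * dw (du h) z with hA
    set B := v.1 * dw (du h) z + v.2 * dw (dw h) z with hB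
    have hII : secondForm h z v = A * v.1 + B * v.2 := by
      rw [secondForm, hA, hB]; ring
    rw [hII]
    have hI' : firstForm h z v = (z.2 ^ 2 * (1 + du h z ^ 2) * v.1 +
      z.2 * (du h z * (z.2 * dw h z - h z) - z.1) * v.2) * v.1 +
      (z.2 * (du h z * (z.2 * dw h z - h z) - z.1) * v.1 +
      (1 + z.1 ^ 2 + (z.2 * dw h z - h z) ^ 2) * v.2) * v.2 := by
      rw [firstForm]; ring
    set Q₁ := z.2 ^ 2 * (1 + du h z ^ 2) * v.1 +
      z.2 * (du h z * (z.2 * dw h z - h z) - z.1) * v.2 with hQ₁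
    set Q₂ := z.2 * (du h z * (z.2 * dw h z - h z) - z.1) * v.1 +
      (1 + z.1 ^ 2 + (z.2 * dw h z - h z) ^ 2) * v.2 with hQ₂
    -- The equation says B Q₁ = A Q₂, so (A, B) = ρ (Q₁, Q₂) with ρ the quotient of the second form
    -- by the first at v.
    have g1 : (A * v.1 + B * v.2) / firstForm h z v * Q₁ = A := by
      rw [div_mul_eq_mul_div, div_eq_iff hI.ne', hI']
      linear_combination v.2 * e
    have g2 : (A * v.1 + B * v.2) / firstForm h z v * Q₂ = B := by
      rw [div_mul_eq_mul_div, div_eq_iff hI.ne', hI']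
      linear_combination -v.1 * e
    set ρ := (A * v.1 + B * v.2) / firstForm h z v
    have e1 : -A * ((z.2 * x.1 - z.1 * x.2) / z.2 ^ 2) +
        0 * ((z.2 * (x.1 * du h z + x.2 * dw h z) - h z * x.2) / z.2 ^ 2) +
        (z.2 * B + z.1 * A) * (-x.2 / z.2 ^ 2) = -(A * x.1 + B * x.2) / z.2 := by
      field_simp
      ring
    rw [e1]
    have e2 : (z.2 * v.1 - z.1 * v.2) / z.2 ^ 2 * ((z.2 * x.1 - z.1 * x.2) / z.2 ^ 2) +
        (z.2 * (v.1 * du h z + v.2 * dw h z) - h z * v.2) / z.2 ^ 2 *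
          ((z.2 * (x.1 * du h z + x.2 * dw h z) - h z * x.2) / z.2 ^ 2) +
        -v.2 / z.2 ^ 2 * (-x.2 / z.2 ^ 2) = (Q₁ * x.1 + Q₂ * x.2) / z.2 ^ 4 := by
      rw [hQ₁, hQ₂]
      field_simp
      ring
    rw [e2]
    have e3 : z.2 ^ 3 * n * ρ * ((Q₁ * x.1 + Q₂ * x.2) / z.2 ^ 4) =
        n * ((ρ * Q₁ * x.1 + ρ * Q₂ * x.2) / z.2) := by
      field_simp
    rw [e3, g1, g2]
    ring
  have hYn := eq_smul_normalFn hp hz2' hT hYT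
  have hY0 : Y = 0 := by
    have e1 : (inner ℝ (normalFn αc p h z) Y : ℝ) = 0 := by
      rw [hY, inner_add_right, hunit, real_inner_smul_right, hnT, mul_zero, add_zero]
    rw [hYn, real_inner_smul_right, real_inner_self_eq_norm_sq] at e1
    have e2 : (inner ℝ (normalVec αc p) Y : ℝ) = 0 :=
      (mul_eq_zero.1 e1).resolve_right (pow_ne_zero 2 (norm_ne_zero_iff.2 hn0))
    rw [hYn, e2, zero_smul]
  rw [neg_smul]
  exact eq_neg_of_add_eq_zero_left hY0

end Principal

/-! ### Recognizing the net and ordering it by curvature. -/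

section Criterion

open Set Filter Metric
open scoped NNReal

variable {αc : S3 → ℝ} {p : E3} {k : WithTop ℕ∞} {h : ℝ × ℝ → ℝ}

/-- The determinant of two vectors. -/
def wedge (v v' : ℝ × ℝ) : ℝ := v.1 * v'.2 - v.2 * v'.1

/-- Twice the polar form of the quadratic form of the extended equation. -/
noncomputable def polar (h : ℝ × ℝ → ℝ) (z v v' : ℝ × ℝ) : ℝ :=
  2 * (eqL h z * (v.2 * v'.2)) + eqM h z * (v.1 * v'.2 + v.2 * v'.1) +
    2 * (eqN h z * (v.1 * v'.1))

theorem wedge_swap (v v' : ℝ × ℝ) : wedge v' v = -wedge v v' := by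
  simp only [wedge]; ring

theorem polar_comm (z v v' : ℝ × ℝ) : polar h z v' v = polar h z v v' := by
  simp only [polar]; ring

/-- Compares the curvatures of two solution directions. The right side is unchanged when one of the
vectors changes sign, so it depends on the directions only, up to a positive factor. -/
theorem secondForm_mul_sub (z v v' : ℝ × ℝ) :
    secondForm h z v' * firstForm h z v - secondForm h z v * firstForm h z v' =
      wedge v v' * polar h z v v' := by
  simp only [secondForm, firstForm, wedge, polar, eqL, eqM, eqN]
  ring

theorem linearIndependent_pair_of_wedge {v v' : ℝ × ℝ} (hw : wedge v v' ≠ 0) :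
    LinearIndependent ℝ ![v, v'] := by
  rw [LinearIndependent.pair_iff]
  intro s t hst
  have h1 : s * v.1 + t * v'.1 = 0 := congrArg Prod.fst hst
  have h2 : s * v.2 + t * v'.2 = 0 := congrArg Prod.snd hst
  constructor
  · have : s * wedge v v' = 0 := by
      rw [wedge]; linear_combination v'.2 * h1 - v'.1 * h2
    exact (mul_eq_zero.1 this).resolve_right hw
  · have : t * wedge v v' = 0 := by
      rw [wedge]; linear_combination v.1 * h2 - v.2 * h1
    exact (mul_eq_zero.1 this).resolve_right hw

/-- In the basis l₁, l₂ the form is x y times the polar value, so its zeros are the two coordinate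
lines. -/
theorem eqForm_eq_zero_iff {z l₁ l₂ : ℝ × ℝ} (h₁ : eqForm h z l₁ = 0) (h₂ : eqForm h z l₂ = 0)
    (hw : wedge l₁ l₂ ≠ 0) (hp : polar h z l₁ l₂ ≠ 0) (v : ℝ × ℝ) :
    eqForm h z v = 0 ↔ v ∈ Submodule.span ℝ {l₁} ∨ v ∈ Submodule.span ℝ {l₂} := by
  simp only [Submodule.mem_span_singleton]
  constructor
  · intro hv
    set x := wedge v l₂ / wedge l₁ l₂ with hx
    set y := wedge l₁ v / wedge l₁ l₂ with hy
    have e1 : v.1 = x * l₁.1 + y * l₂.1 := by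
      rw [hx, hy]
      field_simp
      simp only [wedge]; ring
    have e2 : v.2 = x * l₁.2 + y * l₂.2 := by
      rw [hx, hy]
      field_simp
      simp only [wedge]; ring
    have e3 : eqForm h z v = x ^ 2 * eqForm h z l₁ + y ^ 2 * eqForm h z l₂ +
        x * y * polar h z l₁ l₂ := by
      simp only [eqForm, polar, e1, e2]; ring
    rw [hv, h₁, h₂, mul_zero, mul_zero, zero_add, zero_add, eq_comm, mul_eq_zero,
      mul_eq_zero] at e3
    rcases e3.resolve_right hp with h0 | h0
    · right
      refine ⟨y, Prod.ext ?_ ?_⟩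
      · simp [e1, h0]
      · simp [e2, h0]
    · left
      refine ⟨x, Prod.ext ?_ ?_⟩
      · simp [e1, h0]
      · simp [e2, h0]
  · have key : ∀ (l : ℝ × ℝ) (x : ℝ), eqForm h z l = 0 → eqForm h z (x • l) = 0 := by
      intro l x hl
      have : eqForm h z (x • l) = x ^ 2 * eqForm h z l := by
        simp only [eqForm, Prod.smul_fst, Prod.smul_snd, smul_eq_mul]; ring
      rw [this, hl, mul_zero]
    rintro (⟨x, rfl⟩ | ⟨x, rfl⟩)
    · exact key _ _ h₁
    · exact key _ _ h₂

/-- Criterion for a pair of fields to be the extended principal net, ordered by curvature. -/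
theorem isExtendedPrincipalNet_of {S : Set (ℝ × ℝ)} {l₁ l₂ : ℝ × ℝ → ℝ × ℝ}
    (hp : IsRegularEndPoint αc p)
    (hS : ∀ z ∈ S, 0 < z.2 → ∀ v : ℝ × ℝ, v ≠ 0 → eqForm h z v = 0 →
        IsPrincipalVector αc (chart αc p h z) (chartCurvature αc p h z v)
          (fderiv ℝ (chart αc p h) z v))
    (hs : ∀ n : WithTop ℕ∞, n + 2 ≤ k → ContDiffOn ℝ n l₁ S ∧ ContDiffOn ℝ n l₂ S)
    (h₁ : ∀ z ∈ S, eqForm h z (l₁ z) = 0) (h₂ : ∀ z ∈ S, eqForm h z (l₂ z) = 0)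
    (hpos : ∀ z ∈ S, 0 < wedge (l₁ z) (l₂ z) * polar h z (l₁ z) (l₂ z)) :
    IsExtendedPrincipalNet k αc p h S l₁ l₂ := by
  have hw : ∀ z ∈ S, wedge (l₁ z) (l₂ z) ≠ 0 := fun z hz h0 => by
    have := hpos z hz
    rw [h0, zero_mul] at this
    exact lt_irrefl _ this
  have hpo : ∀ z ∈ S, polar h z (l₁ z) (l₂ z) ≠ 0 := fun z hz h0 => by
    have := hpos z hz
    rw [h0, mul_zero] at this
    exact lt_irrefl _ this
  refine ⟨hs, fun z hz => linearIndependent_pair_of_wedge (hw z hz), fun z hz v =>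
    eqForm_eq_zero_iff (h₁ z hz) (h₂ z hz) (hw z hz) (hpo z hz) v, fun z hz hz2 => ?_⟩
  have n1 : l₁ z ≠ 0 := fun h0 => hw z hz (by rw [h0]; simp [wedge])
  have n2 : l₂ z ≠ 0 := fun h0 => hw z hz (by rw [h0]; simp [wedge])
  refine ⟨_, _, ?_, hS z hz hz2 _ n1 (h₁ z hz), hS z hz hz2 _ n2 (h₂ z hz)⟩
  have f1 := firstForm_pos (h := h) (ne_of_gt hz2) n1
  have f2 := firstForm_pos (h := h) (ne_of_gt hz2) n2
  have := hpos z hz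
  rw [← secondForm_mul_sub] at this
  have hn := norm_pos_iff.2 (normalFn_ne_zero (h := h) hp z)
  refine mul_lt_mul_of_pos_left ?_ (by positivity)
  rw [div_lt_div_iff₀ f1 f2]
  linarith

end Criterion

/-! ### Regularity and values at the end point of L, M, N. -/

section Coefficients

open Set Filter Metric

variable {k n : WithTop ℕ∞} {h : ℝ × ℝ → ℝ} {Ω : Set (ℝ × ℝ)}

theorem two_le_of_add_two_le (hn : n + 2 ≤ k) : (n + 1) + 1 ≤ k := by
  rwa [add_assoc, one_add_one_eq_two]

theorem contDiffOn_eqL (hΩ : ContDiffOn ℝ k h Ω) (hΩo : IsOpen Ω) (hn : n + 2 ≤ k) :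
    ContDiffOn ℝ n (eqL h) Ω := by
  have h1 := two_le_of_add_two_le hn
  have a0 : ContDiffOn ℝ n h Ω := hΩ.of_le (le_self_add.trans hn)
  have a1 : ContDiffOn ℝ (n + 1) (du h) Ω := hΩ.du hΩo h1
  have a2 : ContDiffOn ℝ (n + 1) (dw h) Ω := hΩ.dw hΩo h1
  have b1 : ContDiffOn ℝ n (du h) Ω := a1.of_le le_self_add
  have b2 : ContDiffOn ℝ n (dw h) Ω := a2.of_le le_self_add
  have c1 : ContDiffOn ℝ n (dw (du h)) Ω := a1.dw hΩo le_rfl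
  have c2 : ContDiffOn ℝ n (dw (dw h)) Ω := a2.dw hΩo le_rfl
  unfold eqL
  fun_prop

theorem contDiffOn_eqM (hΩ : ContDiffOn ℝ k h Ω) (hΩo : IsOpen Ω) (hn : n + 2 ≤ k) :
    ContDiffOn ℝ n (eqM h) Ω := by
  have h1 := two_le_of_add_two_le hn
  have a0 : ContDiffOn ℝ n h Ω := hΩ.of_le (le_self_add.trans hn)
  have a1 : ContDiffOn ℝ (n + 1) (du h) Ω := hΩ.du hΩo h1
  have a2 : ContDiffOn ℝ (n + 1) (dw h) Ω := hΩ.dw hΩo h1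
  have b1 : ContDiffOn ℝ n (du h) Ω := a1.of_le le_self_add
  have b2 : ContDiffOn ℝ n (dw h) Ω := a2.of_le le_self_add
  have c1 : ContDiffOn ℝ n (du (du h)) Ω := a1.du hΩo le_rfl
  have c2 : ContDiffOn ℝ n (dw (dw h)) Ω := a2.dw hΩo le_rfl
  unfold eqM
  fun_prop

/-- The coefficient `N` divided by `w`. -/
noncomputable def eqN₁ (h : ℝ × ℝ → ℝ) (z : ℝ × ℝ) : ℝ :=
  z.2 * ((1 + du h z ^ 2) * dw (du h) z)
    - (du h z * (z.2 * dw h z - h z) - z.1) * du (du h) z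

theorem eqN_eq (z : ℝ × ℝ) : eqN h z = z.2 * eqN₁ h z := by
  simp only [eqN, eqN₁]; ring

theorem contDiffOn_eqN₁ (hΩ : ContDiffOn ℝ k h Ω) (hΩo : IsOpen Ω) (hn : n + 2 ≤ k) :
    ContDiffOn ℝ n (eqN₁ h) Ω := by
  have h1 := two_le_of_add_two_le hn
  have a0 : ContDiffOn ℝ n h Ω := hΩ.of_le (le_self_add.trans hn)
  have a1 : ContDiffOn ℝ (n + 1) (du h) Ω := hΩ.du hΩo h1
  have a2 : ContDiffOn ℝ (n + 1) (dw h) Ω := hΩ.dw hΩo h1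
  have b1 : ContDiffOn ℝ n (du h) Ω := a1.of_le le_self_add
  have b2 : ContDiffOn ℝ n (dw h) Ω := a2.of_le le_self_add
  have c1 : ContDiffOn ℝ n (du (du h)) Ω := a1.du hΩo le_rfl
  have c2 : ContDiffOn ℝ n (dw (du h)) Ω := a1.dw hΩo le_rfl
  unfold eqN₁
  fun_prop

theorem contDiffOn_eqN (hΩ : ContDiffOn ℝ k h Ω) (hΩo : IsOpen Ω) (hn : n + 2 ≤ k) :
    ContDiffOn ℝ n (eqN h) Ω := by
  have h1 := contDiffOn_eqN₁ hΩ hΩo hn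
  have : ContDiffOn ℝ n (fun z : ℝ × ℝ => z.2 * eqN₁ h z) Ω := by fun_prop
  exact this.congr fun z _ => eqN_eq z

theorem eqL_zero (h0 : h 0 = 0) : eqL h 0 = -coeffB h := by
  simp [eqL, coeffB, h0]

theorem eqM_zero (h0 : h 0 = 0) : eqM h 0 = -coeffA h := by
  simp [eqM, coeffA, h0]

theorem eqN_axis (s : ℝ) : eqN h (s, 0) = 0 := by
  simp [eqN]

end Coefficients

/-! ### Biregular end points. -/

section Biregular

open Set Filter Metric
open scoped NNReal

variable {αc : S3 → ℝ} {p : E3} {k : WithTop ℕ∞} {h : ℝ × ℝ → ℝ}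

/-- At 0 the form is -dw (b dw + a du), with distinct directions (1, 0) and (-b/a, 1). Nearby they
are spanned by (P, -N) and (-L, P), where P² - M P + L N = 0 and P(0) = -a; these fields are nonzero
even where L or N vanishes. The first is tangent to w = 0 because N = 0 there. -/
theorem hasBiregularPattern (hk : 3 ≤ k) (hα : ContMDiff (𝓡 3) 𝓘(ℝ, ℝ) k αc)
    (hp : IsRegularEndPoint αc p) (hh : IsEndChart k αc p h) (ha : coeffA h ≠ 0) :
    HasBiregularPattern k αc p h := by
  have hαc : Continuous (localFn αc p) := (contDiff_localFn hα hp).continuous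
  obtain ⟨Ω, hΩo, hΩ0, hΩ, -⟩ := hh.exists_domain hαc hp
  have h0 := hh.map_zero hαc hp
  obtain ⟨V, hV, hVp⟩ := exists_nhds_isPrincipalVector hk hα hp hh
  set a := coeffA h with hadef
  set b := coeffB h with hbdef
  set s : ℝ := a / |a| with hs
  have ha' : |a| ≠ 0 := abs_ne_zero.2 ha
  have hsa : s * |a| = a := div_mul_cancel₀ a ha'
  have hs2 : s ^ 2 = 1 := by rw [hs, div_pow, sq_abs, div_self (pow_ne_zero 2 ha)]
  -- Both (1, 0) and (-b/a, 1) satisfy u + c w = 1 for this c, so u + c w is a time for both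
  -- foliations; the fields below are normalized accordingly.
  set c : ℝ := b / a + 1 with hc
  set D : ℝ × ℝ → ℝ := fun z => eqM h z ^ 2 - 4 * eqL h z * eqN h z with hD
  -- The sign s of a selects the root with P(0) = -a; the other one vanishes at 0.
  set P : ℝ × ℝ → ℝ := fun z => (eqM h z - s * √(D z)) / 2 with hP
  have hL0 : eqL h 0 = -b := eqL_zero h0
  have hM0 : eqM h 0 = -a := eqM_zero h0
  have hN0 : eqN h 0 = 0 := eqN_axis 0
  have hD0 : D 0 = a ^ 2 := by simp only [hD, hL0, hM0, hN0]; ring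
  have hP0 : P 0 = -a := by
    simp only [hP, hD0, hM0, Real.sqrt_sq_eq_abs, hsa]; ring
  have hk3 : (1 : WithTop ℕ∞) + 2 ≤ k := by
    rw [show (1 : WithTop ℕ∞) + 2 = 3 by norm_num]; exact hk
  have hLc := (contDiffOn_eqL hΩ hΩo hk3).continuousOn.continuousAt (hΩo.mem_nhds hΩ0)
  have hMc := (contDiffOn_eqM hΩ hΩo hk3).continuousOn.continuousAt (hΩo.mem_nhds hΩ0)
  have hNc := (contDiffOn_eqN hΩ hΩo hk3).continuousOn.continuousAt (hΩo.mem_nhds hΩ0)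
  have hDc : ContinuousAt D 0 := (hMc.pow 2).sub ((continuousAt_const.mul hLc).mul hNc)
  have hPc : ContinuousAt P 0 :=
    (hMc.sub (continuousAt_const.mul hDc.sqrt)).div_const 2
  set A : ℝ × ℝ → ℝ × ℝ := fun z => ((P z - c * eqN h z)⁻¹ * P z, (P z - c * eqN h z)⁻¹ * -eqN h z)
    with hA
  set B : ℝ × ℝ → ℝ × ℝ := fun z => ((c * P z - eqL h z)⁻¹ * -eqL h z, (c * P z - eqL h z)⁻¹ * P z)
    with hB
  have hdA0 : P 0 - c * eqN h 0 = -a := by rw [hP0, hN0]; ring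
  have hdB0 : c * P 0 - eqL h 0 = -a := by rw [hP0, hL0, hc]; field_simp; ring
  have hna : -a ≠ 0 := neg_ne_zero.2 ha
  have hA0 : A 0 = (1, 0) := by
    simp only [hA, hdA0]
    rw [hP0, hN0, inv_mul_cancel₀ hna, neg_zero, mul_zero]
  have hB0 : B 0 = (-b / a, 1) := by
    simp only [hB, hdB0]
    rw [hP0, hL0, inv_mul_cancel₀ hna]
    refine Prod.ext ?_ rfl
    simp only
    field_simp
  have hdAc : ContinuousAt (fun z => P z - c * eqN h z) 0 := hPc.sub (continuousAt_const.mul hNc)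
  have hdBc : ContinuousAt (fun z => c * P z - eqL h z) 0 := (continuousAt_const.mul hPc).sub hLc
  have hA2c : ContinuousAt A 0 := by
    have := hdAc.inv₀ (by rw [hdA0]; exact hna)
    exact (this.mul hPc).prodMk (this.mul hNc.neg)
  have hB2c : ContinuousAt B 0 := by
    have := hdBc.inv₀ (by rw [hdB0]; exact hna)
    exact (this.mul hLc.neg).prodMk (this.mul hPc)
  have hwpc : ContinuousAt (fun z => wedge (A z) (B z) * polar h z (A z) (B z)) 0 := by
    have a1 := continuousAt_fst.comp hA2c
    have a2 := continuousAt_snd.comp hA2c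
    have b1 := continuousAt_fst.comp hB2c
    have b2 := continuousAt_snd.comp hB2c
    refine ((a1.mul b2).sub (a2.mul b1)).mul (((continuousAt_const.mul (hLc.mul (a2.mul b2))).add
      (hMc.mul ((a1.mul b2).add (a2.mul b1)))).add (continuousAt_const.mul (hNc.mul (a1.mul b1))))
  have hwp0 : wedge (A 0) (B 0) * polar h 0 (A 0) (B 0) = -a := by
    rw [hA0, hB0, wedge, polar, hM0, hN0, hL0]
    ring
  have hev : ∀ᶠ z in 𝓝 (0 : ℝ × ℝ), z ∈ Ω ∧ z ∈ V ∧ 0 < D z ∧ P z - c * eqN h z ≠ 0 ∧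
      c * P z - eqL h z ≠ 0 ∧ (A z).2 < (B z).2 ∧
      0 < (wedge (A z) (B z) * polar h z (A z) (B z)) * (-a) := by
    refine Filter.Eventually.and (hΩo.mem_nhds hΩ0) (Filter.Eventually.and hV
      (Filter.Eventually.and ?_ (Filter.Eventually.and ?_ (Filter.Eventually.and ?_
      (Filter.Eventually.and ?_ ?_)))))
    · exact hDc.eventually_const_lt (by rw [hD0]; positivity)
    · exact hdAc.eventually_ne (by rw [hdA0]; exact hna)
    · exact hdBc.eventually_ne (by rw [hdB0]; exact hna)
    · refine Filter.Tendsto.eventually_lt (continuousAt_snd.comp hA2c) (continuousAt_snd.comp hB2c) ?_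
      simp [hA0, hB0]
    · refine (hwpc.mul (continuousAt_const (y := -a))).eventually_const_lt ?_
      have h1 : 0 < -a * -a := by nlinarith [sq_pos_of_ne_zero ha]
      exact h1.trans_eq (congrArg (· * -a) hwp0).symm
  obtain ⟨U, hU, hUo, hU0⟩ := _root_.eventually_nhds_iff.1 hev
  have hUΩ : U ⊆ Ω := fun z hz => (hU z hz).1
  have hsm : ∀ n : WithTop ℕ∞, n + 2 ≤ k → ContDiffOn ℝ n A U ∧ ContDiffOn ℝ n B U := by
    intro n hn
    have l1 := (contDiffOn_eqL hΩ hΩo hn).mono hUΩ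
    have m1 := (contDiffOn_eqM hΩ hΩo hn).mono hUΩ
    have n1 := (contDiffOn_eqN hΩ hΩo hn).mono hUΩ
    have d1 : ContDiffOn ℝ n D U := (m1.pow 2).sub ((contDiffOn_const.mul l1).mul n1)
    have p1 : ContDiffOn ℝ n P U :=
      (m1.sub (contDiffOn_const.mul (d1.sqrt fun z hz => (hU z hz).2.2.1.ne'))).div_const 2
    have dA : ContDiffOn ℝ n (fun z => (P z - c * eqN h z)⁻¹) U :=
      (p1.sub (contDiffOn_const.mul n1)).inv fun z hz => (hU z hz).2.2.2.1
    have dB : ContDiffOn ℝ n (fun z => (c * P z - eqL h z)⁻¹) U :=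
      ((contDiffOn_const.mul p1).sub l1).inv fun z hz => (hU z hz).2.2.2.2.1
    exact ⟨(dA.mul p1).prodMk (dA.mul n1.neg), (dB.mul l1.neg).prodMk (dB.mul p1)⟩
  have hroot : ∀ z ∈ U, P z ^ 2 - eqM h z * P z + eqL h z * eqN h z = 0 := by
    intro z hz
    have hq := Real.sq_sqrt (hU z hz).2.2.1.le
    simp only [hP]
    have hD' : D z = eqM h z ^ 2 - 4 * eqL h z * eqN h z := rfl
    linear_combination (√(D z) ^ 2 / 4) * hs2 + hq / 4 + hD' / 4
  have eA : ∀ z ∈ U, eqForm h z (A z) = 0 := by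
    intro z hz
    simp only [eqForm, hA]
    linear_combination ((P z - c * eqN h z)⁻¹) ^ 2 * eqN h z * hroot z hz
  have eB : ∀ z ∈ U, eqForm h z (B z) = 0 := by
    intro z hz
    simp only [eqForm, hB]
    linear_combination ((c * P z - eqL h z)⁻¹) ^ 2 * eqL h z * hroot z hz
  have tA : ∀ z ∈ U, (A z).1 + c * (A z).2 = 1 := by
    intro z hz
    have := (hU z hz).2.2.2.1
    simp only [hA]
    field_simp
    ring
  have tB : ∀ z ∈ U, (B z).1 + c * (B z).2 = 1 := by
    intro z hz
    have := (hU z hz).2.2.2.2.1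
    simp only [hB]
    field_simp
    ring
  have hUn : U ∈ 𝓝 (0 : ℝ × ℝ) := hUo.mem_nhds hU0
  obtain ⟨sA, sB⟩ := hsm 1 hk3
  have LA := (contDiff_snd.contDiffAt.comp (0 : ℝ × ℝ) (sA.contDiffAt hUn)).exists_lipschitzOnWith
  have LB := (contDiff_snd.contDiffAt.comp (0 : ℝ × ℝ) (sB.contDiffAt hUn)).exists_lipschitzOnWith
  obtain ⟨e, he⟩ := exists_straightens hUn tA tB LA LB (fun z hz _ => (hU z hz).2.2.2.2.2.1)
    (hU 0 hU0).2.2.2.2.2.1.le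
  have hax : ∀ z ∈ e.source, 0 < z.2 ↔ 0 < (e z).1 := by
    intro z hz
    have hzero : ∀ s : ℝ, (A (s, 0)).2 = 0 := fun s => by simp [hA, eqN_axis]
    rcases le_total 0 (z.1 + c * z.2) with h1 | h1
    · exact he.axis_right₁ (fun s _ _ => hzero s) z hz h1
    · exact he.axis_left₁ (fun s _ _ => hzero s) z hz h1
  have hUV : ∀ z ∈ U \ ∅, 0 < z.2 → ∀ v : ℝ × ℝ, v ≠ 0 → eqForm h z v = 0 →
        IsPrincipalVector αc (chart αc p h z) (chartCurvature αc p h z v)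
          (fderiv ℝ (chart αc p h) z v) := fun z hz => hVp z (hU z hz.1).2.1
  -- The product of `wedge` and `polar` has the sign of -a. Hence A, which has the end curve as a
  -- leaf, is the minimal field for a < 0 and the maximal one for a > 0.
  rcases lt_or_gt_of_ne ha with hlt | hgt
  · left
    refine he.hasNetPattern_swap (isExtendedPrincipalNet_of hp hUV
      (fun n hn => ⟨(hsm n hn).1.mono sdiff_subset, (hsm n hn).2.mono sdiff_subset⟩)
      (fun z hz => eA z hz.1) (fun z hz => eB z hz.1) fun z hz => ?_) hax
    have := (hU z hz.1).2.2.2.2.2.2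
    exact pos_of_mul_pos_left this (by linarith)
  · right
    refine he.hasNetPattern (isExtendedPrincipalNet_of hp hUV
      (fun n hn => ⟨(hsm n hn).2.mono sdiff_subset, (hsm n hn).1.mono sdiff_subset⟩)
      (fun z hz => eB z hz.1) (fun z hz => eA z hz.1) fun z hz => ?_) hax
    have := (hU z hz.1).2.2.2.2.2.2
    rw [wedge_swap, polar_comm]
    nlinarith

end Biregular

/-! ### Square root of a discriminant with a nondegenerate minimum. -/

section Discriminant

open Set Filter Metric
open scoped NNReal

/-- The product with a factor that vanishes at the point needs only continuity of the other one. -/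
theorem hasFDerivAt_mul_of_eq_zero {V : Type*} [NormedAddCommGroup V] [NormedSpace ℝ V]
    {f g : V → ℝ} {g' : V →L[ℝ] ℝ} {x : V} {y : ℝ} (hf : ContinuousAt f x) (hfx : f x = y)
    (hg : HasFDerivAt g g' x) (hgx : g x = 0) :
    HasFDerivAt (fun z => f z * g z) (y • g') x := by
  subst hfx
  have h1 : HasFDerivAt (fun z => f x * g z) (f x • g') x := hg.const_mul (f x)
  have h2 : HasFDerivAt (fun z => (f z - f x) * g z) (0 : V →L[ℝ] ℝ) x := by
    refine HasFDerivAt.of_isLittleO ?_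
    have e1 : (fun z => f z - f x) =o[𝓝 x] (fun _ => (1 : ℝ)) :=
      (Asymptotics.isLittleO_one_iff ℝ).2 (by simpa using hf.sub_const (f x))
    have e2 : g =O[𝓝 x] fun z => z - x := by simpa [hgx] using hg.isBigO_sub
    have e3 := e1.mul_isBigO e2.norm_right
    simp only [one_mul] at e3
    simpa [hgx] using e3.norm_right
  have h3 := h1.add h2
  rw [add_zero] at h3
  refine h3.congr_of_eventuallyEq (Eventually.of_forall fun z => ?_)
  simp only [_root_.Pi.add_apply]
  ring

/-- The left side of the expansion is g'(z)² + w² + o(|z|²), and g'(z)² + w² is definite because g'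
does not vanish on (1, 0). -/
theorem exists_le_sq_sub {g n : ℝ × ℝ → ℝ} {g' : ℝ × ℝ →L[ℝ] ℝ} (hg : HasFDerivAt g g' 0)
    (hn : HasFDerivAt n (-ContinuousLinearMap.snd ℝ ℝ ℝ) 0) (hg0 : g 0 = 0) (hn0 : n 0 = 0)
    (hg' : g' (1, 0) ≠ 0) :
    ∃ c : ℝ, 0 < c ∧ ∀ᶠ z in 𝓝 (0 : ℝ × ℝ), (c * ‖z‖) ^ 2 ≤ g z ^ 2 - z.2 * n z := by
  have hT : (LinearMap.ker ((g'.prod (ContinuousLinearMap.snd ℝ ℝ ℝ) :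
      ℝ × ℝ →L[ℝ] ℝ × ℝ) : ℝ × ℝ →ₗ[ℝ] ℝ × ℝ)) = ⊥ := by
    rw [LinearMap.ker_eq_bot']
    rintro ⟨u, w⟩ hz
    have h2 : w = 0 := congrArg Prod.snd hz
    have h1 : g' (u, w) = 0 := congrArg Prod.fst hz
    subst h2
    have : g' (u, 0) = u * g' (1, 0) := by
      rw [← smul_eq_mul, ← map_smul]; simp
    rw [this] at h1
    rw [(mul_eq_zero.1 h1).resolve_right hg']
    rfl
  obtain ⟨K, hK, hKa⟩ := LinearMap.exists_antilipschitzWith _ hT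
  have hlow : ∀ z : ℝ × ℝ, ‖z‖ ^ 2 ≤ K ^ 2 * ((g' z) ^ 2 + z.2 ^ 2) := by
    intro z
    have h1 := hKa.le_mul_dist z 0
    rw [map_zero, dist_zero_right, dist_zero_right] at h1
    have h2 : ‖(g' z, z.2)‖ ^ 2 ≤ (g' z) ^ 2 + z.2 ^ 2 := by
      rw [Prod.norm_def]
      have h1 : ‖g' z‖ ^ 2 = (g' z) ^ 2 := sq_abs _
      have h2 : ‖z.2‖ ^ 2 = z.2 ^ 2 := sq_abs _
      rcases max_choice ‖g' z‖ ‖z.2‖ with h | h <;> simp only [h] <;>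
        nlinarith [sq_nonneg (g' z), sq_nonneg z.2]
    calc ‖z‖ ^ 2 ≤ (K * ‖(g' z, z.2)‖) ^ 2 := pow_le_pow_left₀ (norm_nonneg _) h1 2
      _ = K ^ 2 * ‖(g' z, z.2)‖ ^ 2 := by ring
      _ ≤ _ := by gcongr
  have hKpos : (0 : ℝ) < K := hK
  have e1 : (fun z => g z - g' z) =o[𝓝 0] (fun z : ℝ × ℝ => z) := by
    simpa [hg0] using hg.isLittleO
  have e2 : (fun z => n z + z.2) =o[𝓝 0] (fun z : ℝ × ℝ => z) := by
    simpa [hn0] using hn.isLittleO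
  have e3 : (fun z => g z + g' z) =O[𝓝 0] (fun z : ℝ × ℝ => z) := by
    have := hg.isBigO_sub
    simp only [hg0, sub_zero] at this
    exact this.add (g'.isBigO_id _)
  have e4 : (fun z : ℝ × ℝ => z.2) =O[𝓝 0] (fun z : ℝ × ℝ => z) :=
    (ContinuousLinearMap.snd ℝ ℝ ℝ).isBigO_id _
  have e5 := (e1.norm_right.mul_isBigO e3.norm_right).sub (e4.norm_right.mul_isLittleO e2.norm_right)
  have hε : (0 : ℝ) < (2 * (K : ℝ) ^ 2)⁻¹ := by positivity
  -- The error is at most |z|² / (2K²), hence at most half of the definite form; the other half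
  -- gives the bound.
  refine ⟨(2 * (K : ℝ))⁻¹, by positivity, (e5.bound hε).mono fun z hz => ?_⟩
  have h1 := hlow z
  rw [Real.norm_eq_abs, norm_mul, norm_norm] at hz
  have h2 := (abs_le.1 hz).1
  have h3 : (K : ℝ) ^ 2 * (2 * (K : ℝ) ^ 2)⁻¹ = 1 / 2 := by field_simp
  have h4 : ‖z‖ ^ 2 * (2 * (K : ℝ) ^ 2)⁻¹ ≤ 1 / 2 * ((g' z) ^ 2 + z.2 ^ 2) := by
    calc ‖z‖ ^ 2 * (2 * (K : ℝ) ^ 2)⁻¹ ≤ K ^ 2 * ((g' z) ^ 2 + z.2 ^ 2) * (2 * (K : ℝ) ^ 2)⁻¹ := by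
          gcongr
      _ = _ := by rw [← h3]; ring
  have h5 : ((2 * (K : ℝ))⁻¹ * ‖z‖) ^ 2 = 1 / 2 * (‖z‖ ^ 2 * (2 * (K : ℝ) ^ 2)⁻¹) := by
    field_simp
  have h6 : 0 ≤ ‖z‖ ^ 2 * (2 * (K : ℝ) ^ 2)⁻¹ := by positivity
  rw [h5]
  nlinarith

/-- Write √f - √f' = (f - f') / (√f + √f'): the factor |z| + |z'| of the numerator cancels against
the denominator, which is at least c (|z| + |z'|). So the root is Lipschitz across its zero, and
solutions through the singular point remain unique. -/
theorem lipschitzOnWith_sqrt_of_le {f : ℝ × ℝ → ℝ} {t : Set (ℝ × ℝ)} {c C : ℝ≥0} (hc : 0 < c)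
    (hlow : ∀ z ∈ t, (c * ‖z‖) ^ 2 ≤ f z)
    (hf : ∀ z ∈ t, ∀ z' ∈ t, |f z - f z'| ≤ C * (‖z‖ + ‖z'‖) * ‖z - z'‖) :
    LipschitzOnWith (C / c) (fun z => √(f z)) t := by
  refine LipschitzOnWith.of_dist_le_mul fun z hz z' hz' => ?_
  rw [Real.dist_eq, dist_eq_norm]
  have hc' : (0 : ℝ) < c := hc
  have key : ∀ z ∈ t, c * ‖z‖ ≤ √(f z) := fun z hz => Real.le_sqrt_of_sq_le (hlow z hz)
  have k1 := key z hz
  have k2 := key z' hz'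
  rcases (add_nonneg (norm_nonneg z) (norm_nonneg z')).eq_or_lt with h0 | hpos
  · have hz0 : z = 0 := norm_eq_zero.1 (by linarith [norm_nonneg z, norm_nonneg z'])
    have hz0' : z' = 0 := norm_eq_zero.1 (by linarith [norm_nonneg z, norm_nonneg z'])
    simp [hz0, hz0']
  · have f0 : 0 ≤ f z := (sq_nonneg _).trans (hlow z hz)
    have f0' : 0 ≤ f z' := (sq_nonneg _).trans (hlow z' hz')
    have h1 : |√(f z) - √(f z')| * (√(f z) + √(f z')) = |f z - f z'| := by
      rw [← abs_of_nonneg (add_nonneg (Real.sqrt_nonneg (f z)) (Real.sqrt_nonneg (f z'))),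
        ← abs_mul]
      congr 1
      linear_combination Real.sq_sqrt f0 - Real.sq_sqrt f0'
    have h2 : |√(f z) - √(f z')| * (c * (‖z‖ + ‖z'‖)) ≤ C * (‖z‖ + ‖z'‖) * ‖z - z'‖ := by
      refine le_trans ?_ ((le_of_eq h1).trans (hf z hz z' hz'))
      gcongr
      linarith
    rw [NNReal.coe_div, div_mul_eq_mul_div, le_div_iff₀ hc']
    refine le_of_mul_le_mul_right ?_ hpos
    linarith

theorem abs_sq_sub_sub_le {g n : ℝ × ℝ → ℝ} {t : Set (ℝ × ℝ)} {K K' : ℝ≥0} (h0 : 0 ∈ t)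
    (hg : LipschitzOnWith K g t) (hn : LipschitzOnWith K' n t) (hg0 : g 0 = 0) (hn0 : n 0 = 0)
    {z z' : ℝ × ℝ} (hz : z ∈ t) (hz' : z' ∈ t) :
    |(g z ^ 2 - z.2 * n z) - (g z' ^ 2 - z'.2 * n z')| ≤
      (K ^ 2 + K' : ℝ≥0) * (‖z‖ + ‖z'‖) * ‖z - z'‖ := by
  have a1 := hg.dist_le_mul z hz z' hz'
  have a2 := hg.dist_le_mul z hz 0 h0
  have a3 := hg.dist_le_mul z' hz' 0 h0
  have b1 := hn.dist_le_mul z hz z' hz'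
  have b2 := hn.dist_le_mul z hz 0 h0
  rw [hg0, dist_zero_right, dist_zero_right] at a2 a3
  rw [hn0, dist_zero_right, dist_zero_right] at b2
  rw [dist_eq_norm, dist_eq_norm] at a1 b1
  simp only [Real.norm_eq_abs] at a1 a2 a3 b1 b2
  have w1 : |z.2 - z'.2| ≤ ‖z - z'‖ := norm_snd_le (z - z')
  have w2 : |z'.2| ≤ ‖z'‖ := norm_snd_le z'
  have e : (g z ^ 2 - z.2 * n z) - (g z' ^ 2 - z'.2 * n z') =
    (g z - g z') * (g z + g z') - ((z.2 - z'.2) * n z + z'.2 * (n z - n z')) := by ring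
  have t1 : |(g z - g z') * (g z + g z')| ≤ (K * ‖z - z'‖) * (K * ‖z‖ + K * ‖z'‖) := by
    rw [abs_mul]
    exact mul_le_mul a1 ((abs_add_le _ _).trans (add_le_add a2 a3)) (abs_nonneg _) (by positivity)
  have t2 : |(z.2 - z'.2) * n z| ≤ ‖z - z'‖ * (K' * ‖z‖) := by
    rw [abs_mul]
    exact mul_le_mul w1 b2 (abs_nonneg _) (by positivity)
  have t3 : |z'.2 * (n z - n z')| ≤ ‖z'‖ * (K' * ‖z - z'‖) := by
    rw [abs_mul]
    exact mul_le_mul w2 b1 (abs_nonneg _) (by positivity)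
  rw [e]
  refine (abs_sub _ _).trans ?_
  refine (add_le_add t1 ((abs_add_le _ _).trans (add_le_add t2 t3))).trans (le_of_eq ?_)
  push_cast
  ring

end Discriminant

/-! ### First-order expansions of M and N₁ at an inflexion. -/

section FirstOrder

open Set Filter Metric

variable {k : WithTop ℕ∞} {h : ℝ × ℝ → ℝ} {Ω : Set (ℝ × ℝ)}

theorem one_add_two_le (hk : 3 ≤ k) : (1 : WithTop ℕ∞) + 2 ≤ k := by
  rw [show (1 : WithTop ℕ∞) + 2 = 3 by norm_num]; exact hk

theorem hasFDerivAt_du_du (hk : 3 ≤ k) (hΩ : ContDiffOn ℝ k h Ω) (hΩo : IsOpen Ω)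
    (hΩ0 : (0 : ℝ × ℝ) ∈ Ω) :
    HasFDerivAt (du (du h)) (fderiv ℝ (du (du h)) 0) 0 := by
  have a1 : ContDiffOn ℝ (1 + 1) (du h) Ω := hΩ.du hΩo (two_le_of_add_two_le (one_add_two_le hk))
  have c1 : ContDiffOn ℝ 1 (du (du h)) Ω := a1.du hΩo le_rfl
  exact ((c1.differentiableOn (by norm_num)).differentiableAt (hΩo.mem_nhds hΩ0)).hasFDerivAt

theorem continuousAt_jet (hk : 3 ≤ k) (hΩ : ContDiffOn ℝ k h Ω) (hΩo : IsOpen Ω)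
    (hΩ0 : (0 : ℝ × ℝ) ∈ Ω) :
    ContinuousAt h 0 ∧ ContinuousAt (du h) 0 ∧ ContinuousAt (dw h) 0 ∧
      ContinuousAt (du (du h)) 0 ∧ ContinuousAt (dw (du h)) 0 ∧ ContinuousAt (dw (dw h)) 0 := by
  have hn := hΩo.mem_nhds hΩ0
  have h1 := two_le_of_add_two_le (one_add_two_le hk)
  have a1 : ContDiffOn ℝ (1 + 1) (du h) Ω := hΩ.du hΩo h1
  have a2 : ContDiffOn ℝ (1 + 1) (dw h) Ω := hΩ.dw hΩo h1
  have c1 : ContDiffOn ℝ 1 (du (du h)) Ω := a1.du hΩo le_rfl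
  have c2 : ContDiffOn ℝ 1 (dw (du h)) Ω := a1.dw hΩo le_rfl
  have c3 : ContDiffOn ℝ 1 (dw (dw h)) Ω := a2.dw hΩo le_rfl
  exact ⟨hΩ.continuousOn.continuousAt hn, a1.continuousOn.continuousAt hn,
    a2.continuousOn.continuousAt hn, c1.continuousOn.continuousAt hn,
    c2.continuousOn.continuousAt hn, c3.continuousOn.continuousAt hn⟩

/-- Each product has a factor vanishing at 0: a power of w, or h_uu since a = 0. Only that factor is
differentiated. -/
theorem hasFDerivAt_eqM (hk : 3 ≤ k) (hΩ : ContDiffOn ℝ k h Ω) (hΩo : IsOpen Ω)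
    (hΩ0 : (0 : ℝ × ℝ) ∈ Ω) (h0 : h 0 = 0) (ha : coeffA h = 0) :
    HasFDerivAt (eqM h) (-fderiv ℝ (du (du h)) 0) 0 := by
  obtain ⟨c0, c1, c2, c3, c4, c5⟩ := continuousAt_jet hk hΩ hΩo hΩ0
  have hs : HasFDerivAt (fun z : ℝ × ℝ => z.2) (ContinuousLinearMap.snd ℝ ℝ ℝ) 0 := hasFDerivAt_snd
  have f1 : ContinuousAt (fun z : ℝ × ℝ => z.2 * (1 + du h z ^ 2) * dw (dw h) z) 0 := by fun_prop
  have f2 : ContinuousAt (fun z : ℝ × ℝ => 1 + z.1 ^ 2 + (z.2 * dw h z - h z) ^ 2) 0 := by fun_prop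
  have d1 := hasFDerivAt_mul_of_eq_zero (y := 0) f1 (by simp) hs rfl
  have d2 := hasFDerivAt_mul_of_eq_zero (y := 1) f2 (by simp [h0])
    (hasFDerivAt_du_du hk hΩ hΩo hΩ0) ha
  have d3 := d1.sub d2
  rw [zero_smul, one_smul, zero_sub] at d3
  refine d3.congr_of_eventuallyEq (Eventually.of_forall fun z => ?_)
  simp only [eqM, _root_.Pi.sub_apply]
  ring

theorem eqN₁_zero (hu : du h 0 = 0) : eqN₁ h 0 = 0 := by
  simp [eqN₁, hu]

/-- The part with h_uu is a product of two factors vanishing at 0 and contributes nothing; the rest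
is b w. -/
theorem hasFDerivAt_eqN₁ (hk : 3 ≤ k) (hΩ : ContDiffOn ℝ k h Ω) (hΩo : IsOpen Ω)
    (hΩ0 : (0 : ℝ × ℝ) ∈ Ω) (hu : du h 0 = 0) (ha : coeffA h = 0) :
    HasFDerivAt (eqN₁ h) (coeffB h • ContinuousLinearMap.snd ℝ ℝ ℝ) 0 := by
  obtain ⟨c0, c1, c2, c3, c4, c5⟩ := continuousAt_jet hk hΩ hΩo hΩ0
  have hs : HasFDerivAt (fun z : ℝ × ℝ => z.2) (ContinuousLinearMap.snd ℝ ℝ ℝ) 0 := hasFDerivAt_snd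
  have f1 : ContinuousAt (fun z : ℝ × ℝ => (1 + du h z ^ 2) * dw (du h) z) 0 := by fun_prop
  have f2 : ContinuousAt (fun z : ℝ × ℝ => du h z * (z.2 * dw h z - h z) - z.1) 0 := by fun_prop
  have d1 := hasFDerivAt_mul_of_eq_zero (y := coeffB h) f1 (by simp [hu, coeffB]) hs rfl
  have d2 := hasFDerivAt_mul_of_eq_zero (y := 0) f2 (by simp [hu])
    (hasFDerivAt_du_du hk hΩ hΩo hΩ0) ha
  have d3 := d1.sub d2
  rw [zero_smul, sub_zero] at d3
  refine d3.congr_of_eventuallyEq (Eventually.of_forall fun z => ?_)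
  simp only [eqN₁, _root_.Pi.sub_apply]
  ring

end FirstOrder

/-! ### Inflexion end points with β ≠ 0. -/

section Inflexion

open Set Filter Metric
open scoped NNReal

variable {αc : S3 → ℝ} {p : E3} {k : WithTop ℕ∞} {h : ℝ × ℝ → ℝ}

theorem IsEndChart.du_zero (hk : 3 ≤ k) (hα : ContMDiff (𝓡 3) 𝓘(ℝ, ℝ) k αc)
    (hp : IsRegularEndPoint αc p) (hh : IsEndChart k αc p h) : du h 0 = 0 := by
  have hαc : Continuous (localFn αc p) := (contDiff_localFn hα hp).continuous
  obtain ⟨Ω, hΩo, hΩ0, hΩ, hΩz⟩ := hh.exists_domain hαc hp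
  exact EndPoint.du_zero (le_trans (by norm_num) hk) hα hp (hh.map_zero hαc hp) hΩo hΩ0 hΩ hΩz

theorem hasInflexionPattern (hk : 3 ≤ k) (hα : ContMDiff (𝓡 3) 𝓘(ℝ, ℝ) k αc)
    (hp : IsRegularEndPoint αc p) (hh : IsEndChart k αc p h) (ha : coeffA h = 0)
    (hab : coeffA30 h * coeffB h ≠ 0) :
    (coeffA30 h * coeffB h < 0 → HasHyperbolicInflexionPattern k αc p h) ∧
      (0 < coeffA30 h * coeffB h → HasEllipticInflexionPattern k αc p h) := by
  have hαc : Continuous (localFn αc p) := (contDiff_localFn hα hp).continuous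
  obtain ⟨Ω, hΩo, hΩ0, hΩ, -⟩ := hh.exists_domain hαc hp
  have h0 := hh.map_zero hαc hp
  have hu := hh.du_zero hk hα hp
  obtain ⟨V, hV, hVp⟩ := exists_nhds_isPrincipalVector hk hα hp hh
  have hb : coeffB h ≠ 0 := right_ne_zero_of_mul hab
  have ha3 : coeffA30 h ≠ 0 := left_ne_zero_of_mul hab
  have hk3 := one_add_two_le hk
  have hL0 : eqL h 0 = -coeffB h := eqL_zero h0
  have hLc := (contDiffOn_eqL hΩ hΩo hk3).continuousOn.continuousAt (hΩo.mem_nhds hΩ0)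
  have hM0 : eqM h 0 = 0 := by rw [eqM_zero h0, ha, neg_zero]
  have hN0 : eqN₁ h 0 = 0 := eqN₁_zero hu
  have hL0' : eqL h 0 ≠ 0 := by rw [hL0]; exact neg_ne_zero.2 hb
  set d : ℝ := (2 * coeffB h)⁻¹ * -coeffA30 h with hd
  have hd0 : d ≠ 0 := mul_ne_zero (inv_ne_zero (mul_ne_zero two_ne_zero hb)) (neg_ne_zero.2 ha3)
  -- Since L ≠ 0, the solution slopes dw/du are g ± √E. As M ≈ -a₃₀ u on the axis and L(0) = -b, the
  -- number d is the u-derivative of g at 0.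
  set g : ℝ × ℝ → ℝ := fun z => (-(2 * eqL h z))⁻¹ * eqM h z with hg
  set n : ℝ × ℝ → ℝ := fun z => (eqL h z)⁻¹ * eqN₁ h z with hn
  set E : ℝ × ℝ → ℝ := fun z => g z ^ 2 - z.2 * n z with hE
  have hgd : HasFDerivAt g ((2 * coeffB h)⁻¹ • -fderiv ℝ (du (du h)) 0) 0 := by
    refine hasFDerivAt_mul_of_eq_zero ?_ ?_ (hasFDerivAt_eqM hk hΩ hΩo hΩ0 h0 ha) hM0
    · exact ((continuousAt_const.mul hLc).neg).inv₀ (by simpa using hL0')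
    · rw [hL0]; congr 1; ring
  have hnd : HasFDerivAt n (-ContinuousLinearMap.snd ℝ ℝ ℝ) 0 := by
    have := hasFDerivAt_mul_of_eq_zero (f := fun z => (eqL h z)⁻¹) (y := (-coeffB h)⁻¹)
      (hLc.inv₀ hL0') (by rw [hL0])
      (hasFDerivAt_eqN₁ hk hΩ hΩo hΩ0 hu ha) hN0
    exact this.congr_fderiv (by ext <;> simp [hb])
  have hg0 : g 0 = 0 := by simp only [hg, hM0, mul_zero]
  have hn0 : n 0 = 0 := by simp only [hn, hN0, mul_zero]
  set g' : ℝ × ℝ →L[ℝ] ℝ := (2 * coeffB h)⁻¹ • -fderiv ℝ (du (du h)) 0 with hg'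
  have hgu : g' (1, 0) = d := rfl
  obtain ⟨c, hc, hlow⟩ := exists_le_sq_sub hgd hnd hg0 hn0 (by rw [hgu]; exact hd0)
  have hev1 : ∀ᶠ z in 𝓝 (0 : ℝ × ℝ), z ∈ Ω ∧ 0 < eqL h z * -coeffB h := by
    refine Filter.Eventually.and (hΩo.mem_nhds hΩ0) ?_
    refine (hLc.mul (continuousAt_const (y := -coeffB h))).eventually_const_lt ?_
    have h1 : 0 < -coeffB h * -coeffB h := by nlinarith [sq_pos_of_ne_zero hb]
    exact h1.trans_eq (congrArg (· * -coeffB h) hL0).symm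
  obtain ⟨U₀, hU₀, hU₀o, hU₀0⟩ := _root_.eventually_nhds_iff.1 hev1
  have hLne : ∀ z ∈ U₀, eqL h z ≠ 0 := fun z hz => left_ne_zero_of_mul (hU₀ z hz).2.ne'
  have hsm : ∀ m : WithTop ℕ∞, m + 2 ≤ k → ContDiffOn ℝ m g U₀ ∧ ContDiffOn ℝ m n U₀ := by
    intro m hm
    have hsub : U₀ ⊆ Ω := fun z hz => (hU₀ z hz).1
    have l1 := (contDiffOn_eqL hΩ hΩo hm).mono hsub
    have m1 := (contDiffOn_eqM hΩ hΩo hm).mono hsub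
    have n1 := (contDiffOn_eqN₁ hΩ hΩo hm).mono hsub
    exact ⟨((contDiffOn_const.mul l1).neg.inv fun z hz =>
      neg_ne_zero.2 (mul_ne_zero two_ne_zero (hLne z hz))).mul m1, (l1.inv hLne).mul n1⟩
  have hU₀n := hU₀o.mem_nhds hU₀0
  obtain ⟨K, t, ht, hK⟩ := ((hsm 1 hk3).1.contDiffAt hU₀n).exists_lipschitzOnWith
  obtain ⟨K', t', ht', hK'⟩ := ((hsm 1 hk3).2.contDiffAt hU₀n).exists_lipschitzOnWith
  have hlin : ∀ᶠ z in 𝓝 (0 : ℝ × ℝ), ‖g z - g' z‖ ≤ |d| * ‖z‖ := by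
    have := hgd.isLittleO.bound (abs_pos.2 hd0)
    simpa [hg0] using this
  have hev : ∀ᶠ z in 𝓝 (0 : ℝ × ℝ), z ∈ U₀ ∧ z ∈ V ∧ z ∈ t ∧ z ∈ t' ∧
      (c * ‖z‖) ^ 2 ≤ E z ∧ ‖g z - g' z‖ ≤ |d| * ‖z‖ :=
    Filter.Eventually.and hU₀n (Filter.Eventually.and hV (Filter.Eventually.and ht
      (Filter.Eventually.and ht' (Filter.Eventually.and hlow hlin))))
  obtain ⟨U, hU, hUo, hU0⟩ := _root_.eventually_nhds_iff.1 hev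
  have hUn := hUo.mem_nhds hU0
  have hEpos : ∀ z ∈ U, z ≠ 0 → 0 < E z := fun z hz hz0 =>
    lt_of_lt_of_le (pow_pos (mul_pos hc (norm_pos_iff.2 hz0)) 2) (hU z hz).2.2.2.2.1
  have hEnn : ∀ z ∈ U, 0 ≤ E z := fun z hz => (sq_nonneg _).trans (hU z hz).2.2.2.2.1
  have hgU : LipschitzOnWith K g U := hK.mono fun z hz => (hU z hz).2.2.1
  have hnU : LipschitzOnWith K' n U := hK'.mono fun z hz => (hU z hz).2.2.2.1
  have hsq : LipschitzOnWith ((K ^ 2 + K') / ⟨c, hc.le⟩) (fun z => √(E z)) U :=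
    lipschitzOnWith_sqrt_of_le (c := ⟨c, hc.le⟩) hc (fun z hz => (hU z hz).2.2.2.2.1)
      fun z hz z' hz' => abs_sq_sub_sub_le hU0 hgU hnU hg0 hn0 hz hz'
  set m₁ : ℝ × ℝ → ℝ × ℝ := fun z => (1, g z - √(E z)) with hm₁
  set m₂ : ℝ × ℝ → ℝ × ℝ := fun z => (1, g z + √(E z)) with hm₂
  have hE0 : E 0 = 0 := by simp only [hE, hg0, hn0]; norm_num
  -- Both fields are graphs over u already, so the shear is trivial: c = 0.
  obtain ⟨e, he⟩ := exists_straightens (m₁ := m₁) (m₂ := m₂) (c := 0) hUn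
    (fun z _ => by simp [hm₁]) (fun z _ => by simp [hm₂])
    ⟨_, U, hUn, hgU.sub hsq⟩ ⟨_, U, hUn, hgU.add hsq⟩
    (fun z hz hz0 => by
      have := Real.sqrt_pos.2 (hEpos z hz hz0)
      simp only [hm₁, hm₂]
      linarith) (by simp [hm₁, hm₂, hE0])
  have hMeq : ∀ z ∈ U, eqM h z = -(2 * eqL h z * g z) := by
    intro z hz
    have := hLne z (hU z hz).1
    simp only [hg]
    field_simp
  have hNeq : ∀ z ∈ U, eqN h z = eqL h z * (z.2 * n z) := by
    intro z hz
    have := hLne z (hU z hz).1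
    rw [eqN_eq]
    simp only [hn]
    field_simp
  have hsqE : ∀ z ∈ U, √(E z) ^ 2 = g z ^ 2 - z.2 * n z := fun z hz => Real.sq_sqrt (hEnn z hz)
  have e₁ : ∀ z ∈ U, eqForm h z (m₁ z) = 0 := by
    intro z hz
    simp only [eqForm, hm₁, hMeq z hz, hNeq z hz]
    linear_combination eqL h z * hsqE z hz
  have e₂ : ∀ z ∈ U, eqForm h z (m₂ z) = 0 := by
    intro z hz
    simp only [eqForm, hm₂, hMeq z hz, hNeq z hz]
    linear_combination eqL h z * hsqE z hz
  have hwp : ∀ z ∈ U, wedge (m₁ z) (m₂ z) * polar h z (m₁ z) (m₂ z) =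
      -(8 * eqL h z * (√(E z) ^ 3)) := by
    intro z hz
    simp only [wedge, polar, hm₁, hm₂, hMeq z hz, hNeq z hz]
    linear_combination (4 * √(E z) * eqL h z) * hsqE z hz
  have hs : ∀ m : WithTop ℕ∞, m + 2 ≤ k →
      ContDiffOn ℝ m m₁ (U \ {0}) ∧ ContDiffOn ℝ m m₂ (U \ {0}) := by
    intro m hm
    have hsub : U \ {0} ⊆ U₀ := fun z hz => (hU z hz.1).1
    have g1 := (hsm m hm).1.mono hsub
    have n1 := (hsm m hm).2.mono hsub
    have E1 : ContDiffOn ℝ m E (U \ {0}) := (g1.pow 2).sub (contDiff_snd.contDiffOn.mul n1)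
    have s1 := E1.sqrt fun z hz => (hEpos z hz.1 hz.2).ne'
    exact ⟨contDiffOn_const.prodMk (g1.sub s1), contDiffOn_const.prodMk (g1.add s1)⟩
  have hUV : ∀ z ∈ U \ {0}, 0 < z.2 → ∀ v : ℝ × ℝ, v ≠ 0 → eqForm h z v = 0 →
        IsPrincipalVector αc (chart αc p h z) (chartCurvature αc p h z v)
          (fderiv ℝ (chart αc p h) z v) := fun z hz => hVp z (hU z hz.1).2.1
  -- The sign of L, which is that of -b, decides which field is minimal. Both regions are symmetric
  -- in x and y, so a possible exchange of axes does not alter them.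
  have hpat : ∀ R : Set (ℝ × ℝ), (∀ z ∈ e.source, 0 < z.2 ↔ e z ∈ R) →
      (∀ z, z.swap ∈ R ↔ z ∈ R) → HasNetPattern k αc p h {0} R := by
    intro R hR hsw
    rcases lt_or_gt_of_ne hb with hlt | hgt
    · refine he.hasNetPattern (isExtendedPrincipalNet_of hp hUV (fun m hm => (hs m hm).symm)
        (fun z hz => e₂ z hz.1) (fun z hz => e₁ z hz.1) fun z hz => ?_) hR
      have h1 := Real.sqrt_pos.2 (hEpos z hz.1 hz.2)
      have h2 := pos_of_mul_pos_left (hU₀ z (hU z hz.1).1).2 (by linarith : 0 ≤ -coeffB h)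
      rw [wedge_swap, polar_comm, neg_mul, hwp z hz.1, neg_neg]
      positivity
    · refine he.hasNetPattern_swap (isExtendedPrincipalNet_of hp hUV hs
        (fun z hz => e₁ z hz.1) (fun z hz => e₂ z hz.1) fun z hz => ?_)
        fun z hz => (hR z hz).trans (hsw _).symm
      have h1 := Real.sqrt_pos.2 (hEpos z hz.1 hz.2)
      have h2 : 0 < -eqL h z := by nlinarith [(hU₀ z (hU z hz.1).1).2]
      rw [hwp z hz.1]
      have : 0 < 8 * -eqL h z * (√(E z) ^ 3) := by positivity
      linarith
  -- The deviation of g(s, 0) from d s is at most |d s|, so the two have weakly the same sign.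
  have hax : ∀ s : ℝ, (s, (0 : ℝ)) ∈ U → 0 ≤ g (s, 0) * (d * s) := by
    intro s hs
    have h1 := (hU _ hs).2.2.2.2.2
    have h2 : g' (s, 0) = d * s := by
      rw [← hgu, mul_comm, ← smul_eq_mul, ← map_smul]; simp
    have h3 : ‖((s, 0) : ℝ × ℝ)‖ = |s| := by simp [Prod.norm_def]
    rw [h2, h3, Real.norm_eq_abs, ← abs_mul] at h1
    have h4 : |(g (s, 0) - d * s) * (d * s)| ≤ (d * s) ^ 2 := by
      rw [abs_mul, ← sq_abs (d * s), sq]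
      exact mul_le_mul_of_nonneg_right h1 (abs_nonneg _)
    have := (abs_le.1 h4).1
    nlinarith
  have hEax : ∀ s : ℝ, √(E (s, 0)) = |g (s, 0)| := by
    intro s
    simp only [hE, zero_mul, sub_zero]
    exact Real.sqrt_sq_eq_abs _
  -- On w = 0 the slopes are g ± |g|: the lower one vanishes where g ≥ 0, the upper one where g ≤ 0.
  have z₁ : ∀ s : ℝ, (s, (0 : ℝ)) ∈ U → 0 ≤ d * s → (m₁ (s, 0)).2 = 0 := by
    intro s hs hds
    rcases hds.eq_or_lt with h0' | hpos
    · have : s = 0 := (mul_eq_zero.1 h0'.symm).resolve_left hd0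
      subst this
      have : (m₁ 0).2 = 0 := by simp [hm₁, hg0, hE0]
      exact this
    · simp only [hm₁]
      rw [hEax, abs_of_nonneg (nonneg_of_mul_nonneg_left (hax s hs) hpos), sub_self]
  have z₂ : ∀ s : ℝ, (s, (0 : ℝ)) ∈ U → d * s ≤ 0 → (m₂ (s, 0)).2 = 0 := by
    intro s hs hds
    rcases hds.eq_or_lt with h0' | hneg
    · have : s = 0 := (mul_eq_zero.1 h0').resolve_left hd0
      subst this
      have : (m₂ 0).2 = 0 := by simp [hm₂, hg0, hE0]
      exact this
    · have : g (s, 0) ≤ 0 := by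
        by_contra! hcon
        exact absurd (hax s hs) (not_le.2 (mul_neg_of_pos_of_neg hcon hneg))
      simp only [hm₂]
      rw [hEax, abs_of_nonpos this, add_neg_cancel]
  have hdsign : d * (2 * coeffB h ^ 2) = -(coeffA30 h * coeffB h) := by
    rw [hd]; field_simp
  have hb2 : 0 < 2 * coeffB h ^ 2 := by positivity
  constructor
  · intro hβ
    have hdpos : 0 < d := by
      by_contra! hcon
      nlinarith [mul_nonneg (neg_nonneg.2 hcon) hb2.le]
    -- Here d > 0. For u ≥ 0 the axis is a leaf of `m₁`, so w > 0 means x > 0, and y ≤ x; for u ≤ 0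
    -- it is a leaf of `m₂`, so w > 0 means y > 0, and x ≤ y. In both cases the larger coordinate
    -- decides.
    refine hpat _ (fun z hz => ?_) fun z => or_comm
    rw [mem_ofPred_eq]
    rcases le_total 0 (z.1 + 0 * z.2) with hz1 | hz1
    · have h1 := he.axis_right₁ (fun s hs hsU => z₁ s hsU (by positivity)) z hz hz1
      have h2 := he.order_right z hz hz1
      rw [h1]
      exact ⟨Or.inl, fun h => h.elim id fun h => lt_of_lt_of_le h h2⟩
    · have h1 := he.axis_left₂ (fun s hs hsU =>
        z₂ s hsU (mul_nonpos_of_nonneg_of_nonpos hdpos.le hs)) z hz hz1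
      have h2 := he.order_left z hz hz1
      rw [h1]
      exact ⟨Or.inr, fun h => h.elim (fun h => lt_of_lt_of_le h h2) id⟩
  · intro hβ
    have hdneg : d < 0 := by
      by_contra! hcon
      nlinarith [mul_nonneg hcon hb2.le]
    -- Here d < 0 and the half axes are exchanged, so on each side the smaller coordinate decides.
    refine hpat _ (fun z hz => ?_) fun z => and_comm
    rw [mem_ofPred_eq]
    rcases le_total 0 (z.1 + 0 * z.2) with hz1 | hz1
    · have h1 := he.axis_right₂ (fun s hs hsU =>
        z₂ s hsU (mul_nonpos_of_nonpos_of_nonneg hdneg.le hs)) z hz hz1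
      have h2 := he.order_right z hz hz1
      rw [h1]
      exact ⟨fun h => ⟨lt_of_lt_of_le h h2, h⟩, fun h => h.2⟩
    · have h1 := he.axis_left₁ (fun s hs hsU =>
        z₁ s hsU (mul_nonneg_of_nonpos_of_nonpos hdneg.le hs)) z hz hz1
      have h2 := he.order_left z hz hz1
      rw [h1]
      exact ⟨fun h => ⟨h, lt_of_lt_of_le h h2⟩, fun h => h.1⟩

end Inflexion

/-! ### The Lie–Cartan field at an inflexion. -/

section LieCartan

open Set Filter Metric

variable {αc : S3 → ℝ} {p : E3} {k : WithTop ℕ∞} {h : ℝ × ℝ → ℝ} {Ω : Set (ℝ × ℝ)}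

theorem mem_tangentConeAt_of_hasDerivAt {V : Type*} [NormedAddCommGroup V] [NormedSpace ℝ V]
    {Q : Set V} {γ : ℝ → V} {v : V} (hγ : HasDerivAt γ v 0) (hQ : ∀ᶠ t in 𝓝 0, γ t ∈ Q) :
    v ∈ tangentConeAt ℝ Q (γ 0) := by
  have h1 := hasDerivAt_iff_tendsto_slope_zero.1 hγ
  simp only [zero_add] at h1
  refine mem_tangentConeAt_of_seq (𝓝[≠] (0 : ℝ)) (fun t => t⁻¹) (fun t => γ t - γ 0) ?_ ?_ h1
  · have h2 : Tendsto γ (𝓝[≠] 0) (𝓝 (γ 0)) := hγ.continuousAt.tendsto.mono_left inf_le_left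
    simpa using h2.sub_const (γ 0)
  · exact (hQ.filter_mono inf_le_left).mono fun t ht => by simpa using ht

theorem charpoly_eq_of_apply {A : (ℝ × ℝ × ℝ) →ₗ[ℝ] (ℝ × ℝ × ℝ)} {α β γ δ : ℝ}
    (hA : ∀ v, A v = (α * v.1 + β * v.2.1 + γ * v.2.2, 0, δ * v.2.2)) :
    A.charpoly = Polynomial.X * (Polynomial.X - Polynomial.C α) *
      (Polynomial.X - Polynomial.C δ) := by
  let e : (ℝ × ℝ × ℝ) ≃ₗ[ℝ] (Fin 3 → ℝ) :=
    { toFun := fun v => ![v.1, v.2.1, v.2.2]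
      map_add' := fun v w => by ext i; fin_cases i <;> simp
      map_smul' := fun c v => by ext i; fin_cases i <;> simp
      invFun := fun f => (f 0, f 1, f 2)
      left_inv := fun v => rfl
      right_inv := fun f => by ext i; fin_cases i <;> rfl }
  have he : ∀ v, e v = ![v.1, v.2.1, v.2.2] := fun _ => rfl
  let B := Module.Basis.ofEquivFun e
  have hB : ∀ i, B i = ((Pi.single i 1 : Fin 3 → ℝ) 0, (Pi.single i 1 : Fin 3 → ℝ) 1,
      (Pi.single i 1 : Fin 3 → ℝ) 2) := fun i => by
    rw [Module.Basis.coe_ofEquivFun]; rfl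
  have hM : LinearMap.toMatrix B B A = !![α, β, γ; 0, 0, 0; 0, 0, δ] := by
    ext i j
    rw [LinearMap.toMatrix_apply, hA, hB, Module.Basis.ofEquivFun_repr_apply, he]
    fin_cases i <;> fin_cases j <;> simp
  rw [← LinearMap.charpoly_toMatrix A B, hM, Matrix.charpoly, Matrix.det_fin_three]
  simp only [Matrix.charmatrix_apply]
  simp
  exact Or.inl (by ring)

/-- The projection `(u, w, q) ↦ (u, w)`. -/
noncomputable def basePoint : (ℝ × ℝ × ℝ) →L[ℝ] ℝ × ℝ :=
  (ContinuousLinearMap.fst ℝ ℝ (ℝ × ℝ)).prod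
    ((ContinuousLinearMap.fst ℝ ℝ ℝ).comp (ContinuousLinearMap.snd ℝ ℝ (ℝ × ℝ)))

/-- The coordinate `w` of `(u, w, q)`. -/
noncomputable def coordW : (ℝ × ℝ × ℝ) →L[ℝ] ℝ :=
  (ContinuousLinearMap.fst ℝ ℝ ℝ).comp (ContinuousLinearMap.snd ℝ ℝ (ℝ × ℝ))

/-- The coordinate `q` of `(u, w, q)`. -/
noncomputable def coordQ : (ℝ × ℝ × ℝ) →L[ℝ] ℝ :=
  (ContinuousLinearMap.snd ℝ ℝ ℝ).comp (ContinuousLinearMap.snd ℝ ℝ (ℝ × ℝ))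

theorem hasFDerivAt_comp_basePoint {f : ℝ × ℝ → ℝ} {x : ℝ × ℝ × ℝ}
    (hf : DifferentiableAt ℝ f (basePoint x)) :
    HasFDerivAt (fun y => f (basePoint y)) ((fderiv ℝ f (basePoint x)).comp basePoint) x :=
  hf.hasFDerivAt.comp x basePoint.hasFDerivAt

theorem lieCartanFn_eq :
    lieCartanFn h = fun x => eqL h (basePoint x) * (coordQ x * coordQ x) +
      eqM h (basePoint x) * coordQ x + coordW x * eqN₁ h (basePoint x) := by
  funext x
  simp only [lieCartanFn, eqN_eq]
  rw [sq]
  rfl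

theorem fderiv_lieCartanFn {x : ℝ × ℝ × ℝ} (hL : DifferentiableAt ℝ (eqL h) (basePoint x))
    (hM : DifferentiableAt ℝ (eqM h) (basePoint x))
    (hN : DifferentiableAt ℝ (eqN₁ h) (basePoint x)) :
    fderiv ℝ (lieCartanFn h) x (1, 0, 0) =
        du (eqL h) (basePoint x) * coordQ x ^ 2 + du (eqM h) (basePoint x) * coordQ x +
          coordW x * du (eqN₁ h) (basePoint x) ∧
      fderiv ℝ (lieCartanFn h) x (0, 1, 0) =
        dw (eqL h) (basePoint x) * coordQ x ^ 2 + dw (eqM h) (basePoint x) * coordQ x +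
          eqN₁ h (basePoint x) + coordW x * dw (eqN₁ h) (basePoint x) ∧
      fderiv ℝ (lieCartanFn h) x (0, 0, 1) =
        2 * eqL h (basePoint x) * coordQ x + eqM h (basePoint x) := by
  have hq : HasFDerivAt coordQ coordQ x := coordQ.hasFDerivAt
  have hw : HasFDerivAt coordW coordW x := coordW.hasFDerivAt
  have hF := (((hasFDerivAt_comp_basePoint hL).mul (hq.mul hq)).add
    ((hasFDerivAt_comp_basePoint hM).mul hq)).add (hw.mul (hasFDerivAt_comp_basePoint hN))
  rw [(hF.congr_of_eventuallyEq (Eventually.of_forall fun y => congrFun lieCartanFn_eq y)).fderiv]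
  have b1 : basePoint (1, 0, 0) = (1, 0) := rfl
  have b2 : basePoint (0, 1, 0) = (0, 1) := rfl
  have b3 : basePoint (0, 0, 1) = 0 := rfl
  have q1 : coordQ (1, 0, 0) = 0 := rfl
  have q2 : coordQ (0, 1, 0) = 0 := rfl
  have q3 : coordQ (0, 0, 1) = 1 := rfl
  have w1 : coordW (1, 0, 0) = 0 := rfl
  have w2 : coordW (0, 1, 0) = 1 := rfl
  have w3 : coordW (0, 0, 1) = 0 := rfl
  simp only [_root_.add_apply, _root_.smul_apply, ContinuousLinearMap.comp_apply, smul_eq_mul,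
    _root_.Pi.mul_apply, b1, b2, b3, q1, q2, q3, w1, w2, w3, map_zero, du, dw]
  refine ⟨?_, ?_, ?_⟩ <;> ring

/-- For k = 3 the derivatives of L, M and N₁ are only known to be continuous. The terms containing
them are therefore grouped as continuous functions times w or q, which `hasFDerivAt_mul_of_eq_zero`
can differentiate at 0. -/
theorem lieCartanField_eventuallyEq (hk : 3 ≤ k) (hΩ : ContDiffOn ℝ k h Ω) (hΩo : IsOpen Ω)
    (hΩ0 : (0 : ℝ × ℝ) ∈ Ω) :
    lieCartanField h =ᶠ[𝓝 0] fun x =>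
      (2 * eqL h (basePoint x) * coordQ x + eqM h (basePoint x),
        (2 * eqL h (basePoint x) * coordQ x + eqM h (basePoint x)) * coordQ x,
        -((du (eqL h) (basePoint x) * coordQ x + du (eqM h) (basePoint x)) * coordQ x +
          du (eqN₁ h) (basePoint x) * coordW x +
          (dw (eqL h) (basePoint x) * coordQ x ^ 2 + dw (eqM h) (basePoint x) * coordQ x +
          eqN₁ h (basePoint x) + coordW x * dw (eqN₁ h) (basePoint x)) * coordQ x)) := by
  have hk3 := one_add_two_le hk
  have hmem : ∀ᶠ x : ℝ × ℝ × ℝ in 𝓝 0, basePoint x ∈ Ω :=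
    basePoint.continuous.continuousAt.preimage_mem_nhds
      (by rw [map_zero]; exact hΩo.mem_nhds hΩ0)
  have hd : ∀ f : ℝ × ℝ → ℝ, ContDiffOn ℝ 1 f Ω → ∀ z ∈ Ω, DifferentiableAt ℝ f z :=
    fun f hf z hz => (hf.differentiableOn (by norm_num)).differentiableAt (hΩo.mem_nhds hz)
  refine hmem.mono fun x hx => ?_
  obtain ⟨e1, e2, e3⟩ := fderiv_lieCartanFn (hd _ (contDiffOn_eqL hΩ hΩo hk3) _ hx)
    (hd _ (contDiffOn_eqM hΩ hΩo hk3) _ hx) (hd _ (contDiffOn_eqN₁ hΩ hΩo hk3) _ hx)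
  have hq : x.2.2 = coordQ x := rfl
  simp only [lieCartanField, e1, e2, e3, hq]
  refine Prod.ext rfl (Prod.ext ?_ ?_)
  · simp only; ring
  · simp only; ring

theorem hasFDerivAt_lieCartanField (hk : 3 ≤ k) (hΩ : ContDiffOn ℝ k h Ω) (hΩo : IsOpen Ω)
    (hΩ0 : (0 : ℝ × ℝ) ∈ Ω) (h0 : h 0 = 0) (hu : du h 0 = 0) (ha : coeffA h = 0) :
    HasFDerivAt (lieCartanField h)
      (((-(2 * coeffB h)) • coordQ + (-fderiv ℝ (du (du h)) 0).comp basePoint).prod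
        ((0 : (ℝ × ℝ × ℝ) →L[ℝ] ℝ).prod (coeffA30 h • coordQ))) 0 := by
  have hk3 := one_add_two_le hk
  have hn := hΩo.mem_nhds hΩ0
  have hdM := hasFDerivAt_eqM hk hΩ hΩo hΩ0 h0 ha
  have hdN := hasFDerivAt_eqN₁ hk hΩ hΩo hΩ0 hu ha
  have hMu : du (eqM h) 0 = -coeffA30 h := by
    rw [du, hdM.fderiv, neg_apply]; rfl
  have hNu : du (eqN₁ h) 0 = 0 := by
    rw [du, hdN.fderiv]; simp
  have cb : ∀ f : ℝ × ℝ → ℝ, ContinuousAt f 0 → ContinuousAt (fun x => f (basePoint x)) 0 := by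
    intro f hf
    refine ContinuousAt.comp (g := f) ?_ basePoint.continuous.continuousAt
    rwa [map_zero]
  have cd : ∀ f : ℝ × ℝ → ℝ, ContDiffOn ℝ 1 f Ω →
      ContinuousAt (fun x => f (basePoint x)) 0 ∧ ContinuousAt (fun x => du f (basePoint x)) 0 ∧
      ContinuousAt (fun x => dw f (basePoint x)) 0 := fun f hf =>
    ⟨cb _ (hf.continuousOn.continuousAt hn),
      cb _ ((hf.du hΩo (n := 0) (by norm_num)).continuousOn.continuousAt hn),
      cb _ ((hf.dw hΩo (n := 0) (by norm_num)).continuousOn.continuousAt hn)⟩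
  obtain ⟨l1, l2, l3⟩ := cd _ (contDiffOn_eqL hΩ hΩo hk3)
  obtain ⟨m1, m2, m3⟩ := cd _ (contDiffOn_eqM hΩ hΩo hk3)
  obtain ⟨n1, n2, n3⟩ := cd _ (contDiffOn_eqN₁ hΩ hΩo hk3)
  have hq : HasFDerivAt coordQ coordQ 0 := coordQ.hasFDerivAt
  have hw : HasFDerivAt coordW coordW 0 := coordW.hasFDerivAt
  have hq0 : coordQ 0 = 0 := rfl
  have hw0 : coordW 0 = 0 := rfl
  have hb0 : basePoint 0 = 0 := rfl
  have hM0 : eqM h 0 = 0 := by rw [eqM_zero h0, ha, neg_zero]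
  have dM : HasFDerivAt (fun x => eqM h (basePoint x))
      ((-fderiv ℝ (du (du h)) 0).comp basePoint) 0 := by
    refine HasFDerivAt.comp (g := eqM h) 0 ?_ basePoint.hasFDerivAt
    rwa [hb0]
  have d1 := (hasFDerivAt_mul_of_eq_zero (y := -(2 * coeffB h))
    (f := fun x => 2 * eqL h (basePoint x)) (continuousAt_const.mul l1)
    (by rw [hb0, eqL_zero h0]; ring) hq hq0).add dM
  have d2 := hasFDerivAt_mul_of_eq_zero (y := 0)
    (f := fun x => 2 * eqL h (basePoint x) * coordQ x + eqM h (basePoint x))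
    (by fun_prop) (by simp only [hb0, hq0, hM0]; ring) hq hq0
  have d3 := hasFDerivAt_mul_of_eq_zero (y := -coeffA30 h)
    (f := fun x => du (eqL h) (basePoint x) * coordQ x + du (eqM h) (basePoint x))
    (by fun_prop) (by simp only [hb0, hq0, hMu]; ring) hq hq0
  have d4 := hasFDerivAt_mul_of_eq_zero (y := 0) (f := fun x => du (eqN₁ h) (basePoint x))
    n2 (by rw [hb0, hNu]) hw hw0
  have d5 := hasFDerivAt_mul_of_eq_zero (y := 0)
    (f := fun x => dw (eqL h) (basePoint x) * coordQ x ^ 2 + dw (eqM h) (basePoint x) * coordQ x +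
          eqN₁ h (basePoint x) + coordW x * dw (eqN₁ h) (basePoint x))
    (by fun_prop) (by simp only [hb0, hq0, hw0, eqN₁_zero hu]; ring) hq hq0
  have d6 := ((d3.add d4).add d5).neg.congr_fderiv (g' := coeffA30 h • coordQ) (by ext <;> simp)
  rw [zero_smul] at d2
  exact (d1.prodMk (d2.prodMk d6)).congr_of_eventuallyEq
    (lieCartanField_eventuallyEq hk hΩ hΩo hΩ0)

/-- On w = 0 one has 𝓕 = q (L q + M), so the surface contains the curves q = 0 and q = -M/L over the
u-axis; their tangents at 0 span the eigenlines for -a₃₀ and a₃₀. The origin is a critical point of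
𝓕, which is why tangency is expressed by the tangent cone. -/
theorem hasHyperbolicSaddle (hk : 3 ≤ k) (hα : ContMDiff (𝓡 3) 𝓘(ℝ, ℝ) k αc)
    (hp : IsRegularEndPoint αc p) (hh : IsEndChart k αc p h) (ha : coeffA h = 0)
    (hab : coeffA30 h * coeffB h ≠ 0) :
    HasHyperbolicSaddle (lieCartanSurface h) (lieCartanField h) 0 (-coeffA30 h) (coeffA30 h) := by
  have hαc : Continuous (localFn αc p) := (contDiff_localFn hα hp).continuous
  obtain ⟨Ω, hΩo, hΩ0, hΩ, -⟩ := hh.exists_domain hαc hp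
  have h0 := hh.map_zero hαc hp
  have hu := hh.du_zero hk hα hp
  have hb : coeffB h ≠ 0 := right_ne_zero_of_mul hab
  have ha3 : coeffA30 h ≠ 0 := left_ne_zero_of_mul hab
  have hM0 : eqM h 0 = 0 := by rw [eqM_zero h0, ha, neg_zero]
  have hX0 : lieCartanField h 0 = 0 := by
    rw [(lieCartanField_eventuallyEq hk hΩ hΩo hΩ0).eq_of_nhds]
    have hq0 : coordQ 0 = 0 := rfl
    have hw0 : coordW 0 = 0 := rfl
    have hb0 : basePoint 0 = 0 := rfl
    simp [hq0, hw0, hb0, hM0]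
  have hA := hasFDerivAt_lieCartanField hk hΩ hΩo hΩ0 h0 hu ha
  set A : (ℝ × ℝ × ℝ) →L[ℝ] (ℝ × ℝ × ℝ) :=
    ((-(2 * coeffB h)) • coordQ + (-fderiv ℝ (du (du h)) 0).comp basePoint).prod
        ((0 : (ℝ × ℝ × ℝ) →L[ℝ] ℝ).prod (coeffA30 h • coordQ)) with hAdef
  have hAv : ∀ v : ℝ × ℝ × ℝ, A v = (-coeffA30 h * v.1 + -dw (du (du h)) 0 * v.2.1 +
      -(2 * coeffB h) * v.2.2, 0, coeffA30 h * v.2.2) := by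
    intro v
    have e : A v = (-(2 * coeffB h) * v.2.2 + -(fderiv ℝ (du (du h)) 0 (v.1, v.2.1)), 0,
      coeffA30 h * v.2.2) := rfl
    rw [e, fderiv_apply_eq, show du (du (du h)) 0 = coeffA30 h from rfl]
    refine Prod.ext ?_ rfl
    simp only
    ring
  refine ⟨?_, hX0, ?_, A, hA, charpoly_eq_of_apply hAv, fun v hv => ?_, fun v hv => ?_⟩
  · have : lieCartanFn h 0 = 0 := by
      have h1 : eqN h ((0 : ℝ), (0 : ℝ)) = 0 := eqN_axis 0
      simp [lieCartanFn, h1]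
    exact this
  · nlinarith [sq_pos_of_ne_zero ha3]
  -- Eigenvectors for -a₃₀ are multiples of (1, 0, 0), and the u-axis lies in the surface.
  · rw [hAv] at hv
    have h2 : 0 = -coeffA30 h * v.2.1 := congrArg (fun x : ℝ × ℝ × ℝ => x.2.1) hv
    have h3 : coeffA30 h * v.2.2 = -coeffA30 h * v.2.2 :=
      congrArg (fun x : ℝ × ℝ × ℝ => x.2.2) hv
    have v2 : v.2.1 = 0 := (mul_eq_zero.1 h2.symm).resolve_left (neg_ne_zero.2 ha3)
    have v3 : v.2.2 = 0 := by
      have : coeffA30 h * v.2.2 = 0 := by linarith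
      exact (mul_eq_zero.1 this).resolve_left ha3
    have hγ : HasDerivAt (fun t : ℝ => t • v) v 0 := by
      simpa using (hasDerivAt_id (0 : ℝ)).smul_const v
    have := mem_tangentConeAt_of_hasDerivAt (Q := lieCartanSurface h) hγ
      (Eventually.of_forall fun t => ?_)
    · simpa using this
    · change lieCartanFn h (t • v) = 0
      simp [lieCartanFn, v2, v3, eqN_axis]
  -- Eigenvectors for a₃₀ are (v₁, 0, -a₃₀ v₁ / b), the velocities of the second curve.
  · rw [hAv] at hv
    have h1 : -coeffA30 h * v.1 + -dw (du (du h)) 0 * v.2.1 + -(2 * coeffB h) * v.2.2 =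
      coeffA30 h * v.1 := congrArg (fun x : ℝ × ℝ × ℝ => x.1) hv
    have h2 : 0 = coeffA30 h * v.2.1 := congrArg (fun x : ℝ × ℝ × ℝ => x.2.1) hv
    have v2 : v.2.1 = 0 := (mul_eq_zero.1 h2.symm).resolve_left ha3
    have v1 : coeffA30 h * v.1 = -(coeffB h * v.2.2) := by
      rw [v2] at h1; linarith
    have hL0 : eqL h 0 ≠ 0 := by rw [eqL_zero h0]; exact neg_ne_zero.2 hb
    have hLc := (contDiffOn_eqL hΩ hΩo (one_add_two_le hk)).continuousOn.continuousAt
      (hΩo.mem_nhds hΩ0)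
    have hg := hasFDerivAt_mul_of_eq_zero (f := fun z => (-eqL h z)⁻¹) (y := (coeffB h)⁻¹)
      (hLc.neg.inv₀ (neg_ne_zero.2 hL0)) (by rw [eqL_zero h0, neg_neg])
      (hasFDerivAt_eqM hk hΩ hΩo hΩ0 h0 ha) hM0
    have hl : HasDerivAt (fun t : ℝ => (t * v.1, (0 : ℝ))) (v.1, 0) 0 := by
      have := (hasDerivAt_id (0 : ℝ)).mul_const v.1
      rw [one_mul] at this
      exact this.prodMk (hasDerivAt_const _ _)
    have hg' : HasDerivAt (fun t : ℝ => (-eqL h (t * v.1, 0))⁻¹ * eqM h (t * v.1, 0)) v.2.2 0 := by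
      have hz : ((0 : ℝ) * v.1, (0 : ℝ)) = 0 := by simp
      rw [← hz] at hg
      have := HasFDerivAt.comp_hasDerivAt (f := fun t : ℝ => (t * v.1, (0 : ℝ))) (0 : ℝ) hg hl
      refine this.congr_deriv ?_
      rw [hz]
      change (coeffB h)⁻¹ * -(fderiv ℝ (du (du h)) 0 (v.1, 0)) = v.2.2
      rw [fderiv_apply_eq, show du (du (du h)) 0 = coeffA30 h from rfl]
      simp only [zero_mul, add_zero]
      rw [mul_comm v.1, v1, neg_neg, inv_mul_cancel_left₀ hb]
    have hx : HasDerivAt (fun t : ℝ => t * v.1) v.1 0 := by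
      simpa using (hasDerivAt_id (0 : ℝ)).mul_const v.1
    have hγ : HasDerivAt (fun t : ℝ => (t * v.1, (0 : ℝ),
        (-eqL h (t * v.1, 0))⁻¹ * eqM h (t * v.1, 0))) v 0 := by
      have : v = (v.1, 0, v.2.2) := by rw [← v2]
      rw [this]
      exact hx.prodMk ((hasDerivAt_const _ _).prodMk hg')
    have hmem := mem_tangentConeAt_of_hasDerivAt (Q := lieCartanSurface h) hγ
      (Eventually.of_forall fun t => ?_)
    · have hM0' : eqM h (0, 0) = 0 := hM0
      have hγ0 : ((0 : ℝ) * v.1, (0 : ℝ), (-eqL h (0 * v.1, 0))⁻¹ * eqM h (0 * v.1, 0)) = 0 := by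
        simp [hM0']
      exact (congrArg (fun x => v ∈ tangentConeAt ℝ (lieCartanSurface h) x) hγ0).mp hmem
    · change eqL h (t * v.1, 0) * ((-eqL h (t * v.1, 0))⁻¹ * eqM h (t * v.1, 0)) ^ 2 +
        eqM h (t * v.1, 0) * ((-eqL h (t * v.1, 0))⁻¹ * eqM h (t * v.1, 0)) +
        eqN h (t * v.1, 0) = 0
      rw [eqN_axis]
      -- Where L = 0 the inverse is 0 by convention, so q = 0 and the point is still in the surface;
      -- no restriction on t is needed.
      rcases eq_or_ne (eqL h (t * v.1, 0)) 0 with hL | hL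
      · rw [hL]; simp
      · field_simp; ring

theorem eqForm_zero_eq_zero_iff (h0 : h 0 = 0) (ha : coeffA h = 0) (hb : coeffB h ≠ 0)
    (v : ℝ × ℝ) : eqForm h 0 v = 0 ↔ v.2 = 0 := by
  have hN : eqN h 0 = 0 := eqN_axis 0
  rw [eqForm, eqL_zero h0, eqM_zero h0, ha, hN]
  simp [hb]

end LieCartan

end EndPoint

theorem proposition2p3 (k : WithTop ℕ∞) (hk : 3 ≤ k)
    (αc : EndPoint.S3 → ℝ) (hα : ContMDiff (𝓡 3) 𝓘(ℝ, ℝ) k αc)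
    (p : EndPoint.E3) (hp : EndPoint.IsRegularEndPoint αc p)
    (h : ℝ × ℝ → ℝ) (hh : EndPoint.IsEndChart k αc p h) :
    -- near `p` the end locus is parametrized by the regular curve `v = h(u, w)`, `w = 0`
    (∃ ε : ℝ, 0 < ε ∧ ∃ U : Set EndPoint.E3, IsOpen U ∧ p ∈ U ∧
      EndPoint.endLocus αc ∩ U = EndPoint.endCurve αc p h '' Set.Ioo (-ε) ε ∧
      Set.InjOn (EndPoint.endCurve αc p h) (Set.Ioo (-ε) ε) ∧
      ContDiffOn ℝ k (EndPoint.endCurve αc p h) (Set.Ioo (-ε) ε) ∧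
      ∀ u ∈ Set.Ioo (-ε) ε, deriv (EndPoint.endCurve αc p h) u ≠ 0) ∧
    -- biregular end points
    (EndPoint.IsBiregularEndPoint αc p ↔ EndPoint.coeffA h ≠ 0) ∧
    (EndPoint.IsInflexionEndPoint αc p ↔ EndPoint.coeffA h = 0) ∧
    (EndPoint.IsBiregularEndPoint αc p → EndPoint.HasBiregularPattern k αc p h) ∧
    -- inflexion, bitransversal end points
    (EndPoint.IsInflexionEndPoint αc p → EndPoint.coeffA30 h * EndPoint.coeffB h ≠ 0 →
      EndPoint.HasHyperbolicSaddle (EndPoint.lieCartanSurface h) (EndPoint.lieCartanField h) 0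
        (-EndPoint.coeffA30 h) (EndPoint.coeffA30 h) ∧
      (∀ v : ℝ × ℝ, EndPoint.eqForm h 0 v = 0 ↔ v.2 = 0) ∧
      (EndPoint.coeffA30 h * EndPoint.coeffB h < 0 →
        EndPoint.HasHyperbolicInflexionPattern k αc p h) ∧
      (0 < EndPoint.coeffA30 h * EndPoint.coeffB h →
        EndPoint.HasEllipticInflexionPattern k αc p h)) := by
  have hαc : Continuous (EndPoint.localFn αc p) := (EndPoint.contDiff_localFn hα hp).continuous
  refine ⟨EndPoint.exists_endLocus_eq_endCurve hαc (le_trans (by norm_num) hk) hp hh,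
    EndPoint.isBiregularEndPoint_iff hk hα hp hh, EndPoint.isInflexionEndPoint_iff hk hα hp hh,
    fun hb => EndPoint.hasBiregularPattern hk hα hp hh
      ((EndPoint.isBiregularEndPoint_iff hk hα hp hh).1 hb), fun hi hab => ?_⟩
  have ha := (EndPoint.isInflexionEndPoint_iff hk hα hp hh).1 hi
  exact ⟨EndPoint.hasHyperbolicSaddle hk hα hp hh ha hab,
    EndPoint.eqForm_zero_eq_zero_iff (hh.map_zero hαc hp) ha (right_ne_zero_of_mul hab),
    EndPoint.hasInflexionPattern hk hα hp hh ha hab⟩
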